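/- **Tangles.** A four-end tangle has ends nw, ne, sw, se. $S_1\ast S_2$ is vertical composition ($S_1$ above $S_2$), $S_1+S_2$ is horizontal composition ($S_1$ left of $S_2$). $[1]$ is one crossing with over-strand nw–se and under-strand ne–sw; $[-1]$ is one crossing with over-strand ne–sw and under-strand nw–se; $[0]$ consists of two crossingless strands nw–ne and sw–se. For $k\neq0$, $[k]$ is the horizontal composite of $|k|$ copies of $[1]$ (if $k>0$) or $[-1]$ (if $k<0$). $\sigma(S)$ is the image of $S$ under the planar reflection in its nw–se diagonal, with the orientation of all arcs reversed. An arborescent tangle $T$, with a given decomposition, is one built by $\ast$ and $+$ from copies of $[1]$, $[-1]$ (and possibly $[0]$, $\sigma([0])$). $D(T)$ is the link diagram obtained by joining the nw end of $T$ to its sw end and the ne end to its se end. **Alexander polynomial.** Let an oriented link diagram $L$ have components $K_1,\dots,K_m$, arcs $x_1,\dots,x_n$ with $x_j\subset K_{\nu(j)}$, and crossings $\mathfrak c_i$. A crossing with over-arc $x_j$, entering under-arc $x_k$ and leaving under-arc $x_l$ gives the relator $x_jx_kx_j^{-1}x_l^{-1}$ if it is positive and $x_j^{-1}x_kx_jx_l^{-1}$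 if it is negative; a closed arc that passes under no crossing contributes a trivial relator, so that there are $n$ relators $r_1,\dots,r_n$. Let $\Phi$ be the ring homomorphism from the group ring over $\mathbb Z$ of the free group on $x_1,\dots,x_n$ to $\mathbb Z[t_1^{\pm1},\dots,t_m^{\pm1}]$ with $\Phi(x_j)=t_{\nu(j)}$, let $M=(\Phi(\partial r_i/\partial x_j))_{i,j}$ (Fox derivatives), and let $M'$ be $M$ with an arbitrary $i_0$-th row and $j_0$-th column deleted. Then $\Delta_L\doteq\det M'$ if $m=1$ and $\Delta_L\doteq\det M'/(1-t_{\nu(j_0)})$ if $m\ge2$, where $\doteq$ is equality up to a factor $\pm t_1^{k_1}\cdots t_m^{k_m}$. **The rules.** Let $L=D(T)$ be oriented. For a subtangle $S$ and $e\in\{\mathrm{nw},\mathrm{ne},\mathrm{sw},\mathrm{se}\}$ let $S^{e}$ be the arc at that end of $S$, directed outward, so that $\Phi(S^e)=t_c$ or $t_c^{-1}$, where $K_c$ is the component containing the arc, according as the outward direction agrees with the orientation of $K_c$ or not. When $S$ is reflected, the values at its ends become $\Phi(\sigma(S)^{\rm nw})=\Phi(S^{\rm nw})^{-1}$, $\Phi(\sigma(S)^{\rm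 se})=\Phi(S^{\rm se})^{-1}$, $\Phi(\sigma(S)^{\rm ne})=\Phi(S^{\rm sw})^{-1}$, $\Phi(\sigma(S)^{\rm sw})=\Phi(S^{\rm ne})^{-1}$. For $k\in\mathbb Z$ and a unit $a$ put $[k]_a=1+a+\dots+a^{k-1}$ if $k>0$, $[0]_a=0$, and $[k]_a=-a^k(1+a+\dots+a^{|k|-1})$ if $k<0$. Given $t_{\rm ne},t_{\rm se},t_{\rm sw}$ put $$b_1\circ_v b_2=b_1+\frac{1-t_{\rm ne}^{-1}}{1-t_{\rm se}}b_2+\frac{t_{\rm sw}-t_{\rm se}^{-1}}{1-t_{\rm se}^{-1}}b_1b_2,\qquad c_1\circ_h c_2=c_1+\frac{1-t_{\rm sw}}{1-t_{\rm se}^{-1}}c_2+\frac{t_{\rm ne}^{-1}-t_{\rm se}}{1-t_{\rm se}}c_1c_2 .$$ Compute $z_v(S),z_h(S)$, in the field of fractions of $\mathbb Z[t_1^{\pm1},\dots,t_m^{\pm1}]$, recursively by any succession of the following rules. 1. $z_v(\sigma(S))=z_h(S)$ and $z_h(\sigma(S))=z_v(S)$. 2. With $t_{\rm ne}=\Phi(S_1^{\rm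 ne})$, $t_{\rm se}=\Phi(S_1^{\rm se})$, $t_{\rm sw}=\Phi(S_1^{\rm sw})$, $$z_v(S_1\ast S_2)=z_v(S_1)z_v(S_2),\qquad \frac{z_h(S_1\ast S_2)}{z_v(S_1\ast S_2)}=\frac{z_h(S_1)}{z_v(S_1)}\circ_v\frac{z_h(S_2)}{z_v(S_2)},$$ $$z_h(S_1+S_2)=z_h(S_1)z_h(S_2),\qquad \frac{z_v(S_1+S_2)}{z_h(S_1+S_2)}=\frac{z_v(S_1)}{z_h(S_1)}\circ_h\frac{z_v(S_2)}{z_h(S_2)},$$ where the equations for the ratios are read with the denominators $z_v(S_i)$, respectively $z_h(S_i)$, cleared (so that they make sense also if one of these vanishes): $z_h(S_1\ast S_2)=z_h(S_1)z_v(S_2)+\frac{1-t_{\rm ne}^{-1}}{1-t_{\rm se}}z_v(S_1)z_h(S_2)+\frac{t_{\rm sw}-t_{\rm se}^{-1}}{1-t_{\rm se}^{-1}}z_h(S_1)z_h(S_2)$, and likewise for $z_v(S_1+S_2)$. 3. For each $k\in\mathbb Z$, with $t_{\rm ne}=\Phi([k]^{\rm ne})$, $t_{\rm se}=\Phi([k]^{\rm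 se})$, $$z_h([k])=1,\qquad z_v([k])=\begin{cases}t_{\rm ne}(t_{\rm se}-1)[h]_{t_{\rm ne}t_{\rm se}},&k=2h\\(1-t_{\rm se})[h]_{t_{\rm ne}t_{\rm se}}-1,&k=2h-1.\end{cases}$$ **Theorem.** Let $T$ be an arborescent tangle with a given decomposition, and let $L=D(T)$ be oriented. Then the diagram of $L$ has as many relators as arcs, and for every outcome $(z_v(T),z_h(T))$ of the recursive computation and every choice of $i_0$, $j_0$, $$\Delta_L\doteq z_h(T)\ \text{ if } L \text{ is a knot},\qquad \Delta_L\doteq\frac{z_h(T)}{1-t_{\rm ne}}\ \text{ otherwise, where } t_{\rm ne}=\Phi(T^{\rm ne}).$$ -/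

import Mathlib

namespace Arborescent

/-! ## Fox calculus -/

section Fox

variable {α : Type}

open Classical in
/-- The Fox derivative `∂w/∂x_a` of a word `w`, a letter `(b, true)` being `x_b` and `(b, false)`
being `x_b⁻¹`. -/
noncomputable def foxWord (a : α) : List (α × Bool) → MonoidAlgebra ℤ (FreeGroup α)
  | [] => 0
  | (b, true) :: w =>
      (if b = a then 1 else 0) + MonoidAlgebra.of ℤ _ (FreeGroup.of b) * foxWord a w
  | (b, false) :: w =>
      MonoidAlgebra.of ℤ _ (FreeGroup.of b)⁻¹ * (foxWord a w - if b = a then 1 else 0)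

theorem foxWord_append (a : α) (u w : List (α × Bool)) :
    foxWord a (u ++ w) = foxWord a u + MonoidAlgebra.of ℤ _ (FreeGroup.mk u) * foxWord a w := by
  induction u with
  | nil =>
    have h : (FreeGroup.mk ([] : List (α × Bool))) = 1 := rfl
    simp only [List.nil_append, foxWord, h, map_one, one_mul, zero_add]
  | cons p u ih =>
    obtain ⟨b, e⟩ := p
    cases e
    · have h : FreeGroup.mk ((b, false) :: u) = (FreeGroup.of b)⁻¹ * FreeGroup.mk u := rfl
      simp only [List.cons_append, foxWord, ih, h, map_mul]
      noncomm_ring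
    · have h : FreeGroup.mk ((b, true) :: u) = FreeGroup.of b * FreeGroup.mk u := rfl
      simp only [List.cons_append, foxWord, ih, h, map_mul]
      noncomm_ring

theorem foxWord_step (a : α) {u w : List (α × Bool)} (h : FreeGroup.Red.Step u w) :
    foxWord a u = foxWord a w := by
  cases h with
  | @not L₁ L₂ b e =>
    rw [foxWord_append, foxWord_append]
    congr 2
    cases e
    · simp only [Bool.not_false, foxWord, add_sub_cancel_left, ← mul_assoc, ← map_mul,
        inv_mul_cancel, map_one, one_mul]
    · simp only [Bool.not_true, foxWord, ← mul_assoc, ← map_mul, mul_inv_cancel, map_one,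
        one_mul, add_sub_cancel]

/-- The Fox derivative `∂/∂x_a` on the free group. -/
noncomputable def fox (a : α) (g : FreeGroup α) : MonoidAlgebra ℤ (FreeGroup α) :=
  Quot.liftOn g (foxWord a) fun _ _ h => foxWord_step a h

theorem fox_one (a : α) : fox a 1 = 0 := rfl

open Classical in
theorem fox_of (a b : α) : fox a (FreeGroup.of b) = if b = a then 1 else 0 := by
  change foxWord a [(b, true)] = _
  simp [foxWord]

theorem fox_mul (a : α) (g h : FreeGroup α) :
    fox a (g * h) = fox a g + MonoidAlgebra.of ℤ _ g * fox a h := by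
  induction g using Quot.inductionOn with
  | h u =>
    induction h using Quot.inductionOn with
    | h w => exact foxWord_append a u w

end Fox

/-! ## Laurent polynomials, up to units

The ring `ℤ[t_c^{±1} : c ∈ C]` is regarded inside its field of fractions. -/

/-- The field of fractions of the ring of Laurent polynomials in `t_c`, `c ∈ C`. -/
abbrev RatFun (C : Type) : Type := FractionRing (MvPolynomial C ℤ)

/-- The variable `t_c`. -/
noncomputable def tvar {C : Type} (c : C) : RatFun C :=
  algebraMap (MvPolynomial C ℤ) (RatFun C) (MvPolynomial.X c)

theorem tvar_ne_zero {C : Type} (c : C) : tvar c ≠ 0 := by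
  have h := (IsFractionRing.injective (MvPolynomial C ℤ) (RatFun C)).ne (MvPolynomial.X_ne_zero c)
  rw [map_zero] at h
  exact h

/-- `a ≐ b`: equality up to a factor `± ∏ t_c ^ k_c`. -/
def DotEq {C : Type} (a b : RatFun C) : Prop :=
  ∃ (s : ℤˣ) (k : C →₀ ℤ),
    a = ((s : ℤ) : RatFun C) * (k.prod fun c e => tvar c ^ e) * b

/-! ## Oriented link diagrams and their Alexander polynomials -/

/-- The data of an oriented link diagram that enter into its Wirtinger presentation: the arcs, the
components, the crossings, the over-arc of each crossing, the under-arcs that enter and leave it,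
and whether it is positive. -/
structure OrientedDiagram where
  Arc : Type
  Comp : Type
  Crossing : Type
  comp : Arc → Comp
  overArc : Crossing → Arc
  underIn : Crossing → Arc
  underOut : Crossing → Arc
  positive : Crossing → Bool

namespace OrientedDiagram

variable (D : OrientedDiagram)

/-- The arcs that are whole components passing under nothing. -/
def CircleArc : Type := {a : D.Arc // ∀ c, a ≠ D.underIn c ∧ a ≠ D.underOut c}

/-- The index set of the relators: one for each crossing. To each arc that is a full circle (absent
from most diagrams) belongs the trivial relator, so that there are as many relators as arcs. -/
abbrev RelatorIndex : Type := D.Crossing ⊕ D.CircleArc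

/-- The Wirtinger relators: `x_j x_k x_j⁻¹ x_l⁻¹` at a positive and `x_j⁻¹ x_k x_j x_l⁻¹` at a
negative crossing, with `x_j` the over-arc and `x_k`, `x_l` the entering and leaving under-arcs. -/
def relator : D.RelatorIndex → FreeGroup D.Arc
  | Sum.inl c =>
      let xj := FreeGroup.of (D.overArc c)
      let xk := FreeGroup.of (D.underIn c)
      let xl := FreeGroup.of (D.underOut c)
      if D.positive c then xj * xk * xj⁻¹ * xl⁻¹ else xj⁻¹ * xk * xj * xl⁻¹
  | Sum.inr _ => 1

/-- `Φ : ℤ[F] → ℤ[t_c^{±1}]`, `x_a ↦ t_{ν(a)}`. -/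
noncomputable def Phi : MonoidAlgebra ℤ (FreeGroup D.Arc) →ₐ[ℤ] RatFun D.Comp :=
  MonoidAlgebra.lift ℤ (RatFun D.Comp) (FreeGroup D.Arc)
    ((Units.coeHom (RatFun D.Comp)).comp
      (FreeGroup.lift fun a => Units.mk0 (tvar (D.comp a)) (tvar_ne_zero _)))

/-- The Alexander matrix `Φ(∂r_i/∂x_j)` for given enumerations of the arcs and of the relators. -/
noncomputable def alexanderMatrix {n : ℕ} (x : Fin n ≃ D.Arc) (r : Fin n ≃ D.RelatorIndex) :
    Matrix (Fin n) (Fin n) (RatFun D.Comp) :=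
  Matrix.of fun i j => D.Phi (fox (x j) (D.relator (r i)))

/-- The diagram has exactly one component. -/
def IsKnot : Prop := Nat.card D.Comp = 1

open Classical in
/-- The Alexander polynomial, computed by deleting the `i₀`-th row and the `j₀`-th column. -/
noncomputable def alexander {n : ℕ} (x : Fin (n + 1) ≃ D.Arc)
    (r : Fin (n + 1) ≃ D.RelatorIndex) (i₀ j₀ : Fin (n + 1)) : RatFun D.Comp :=
  let M' := (D.alexanderMatrix x r).submatrix i₀.succAbove j₀.succAbove
  if D.IsKnot then M'.det else M'.det / (1 - tvar (D.comp (x j₀)))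

end OrientedDiagram

/-! ## Arborescent tangles -/

/-- The four ends of a tangle. -/
inductive Corner : Type
  | nw | ne | sw | se

namespace Corner

/-- The end at the other side of the centre. -/
def opposite : Corner → Corner
  | nw => se
  | se => nw
  | ne => sw
  | sw => ne

/-- Reflection in the vertical axis. -/
def flipH : Corner → Corner
  | nw => ne
  | ne => nw
  | sw => se
  | se => sw

/-- Reflection in the horizontal axis. -/
def flipV : Corner → Corner
  | nw => sw
  | sw => nw
  | ne => se
  | se => ne

/-- Reflection in the NW-SE diagonal. -/
def reflect : Corner → Corner
  | nw => nw
  | se => se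
  | ne => sw
  | sw => ne

end Corner

/-- A (decomposed) arborescent tangle, built by vertical composition `S₁ ∗ S₂` (`S₁` above `S₂`) and
horizontal composition `S₁ + S₂` (`S₁` to the left of `S₂`) from the following pieces.
* `one`: the tangle `[1]`, a crossing with over-strand NW-SE and under-strand NE-SW;
* `negOne`: the tangle `[-1]`, a crossing with over-strand NE-SW and under-strand NW-SE;
* `zero`: the tangle `[0]`, with the crossingless strands NW-NE and SW-SE;
* `infty`: the mirror image of `[0]` in the diagonal, with the crossingless strands NW-SW and
  NE-SE. -/
inductive Tangle : Type
  | zero : Tangle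
  | infty : Tangle
  | one : Tangle
  | negOne : Tangle
  | vert : Tangle → Tangle → Tangle
  | horiz : Tangle → Tangle → Tangle

namespace Tangle

/-- The ends of the pieces of which a tangle is built: four for every piece. -/
def Pt : Tangle → Type
  | zero => Corner
  | infty => Corner
  | one => Corner
  | negOne => Corner
  | vert a b => a.Pt ⊕ b.Pt
  | horiz a b => a.Pt ⊕ b.Pt

/-- The four ends of the tangle itself. -/
def ends : (S : Tangle) → Corner → S.Pt
  | zero, c => c
  | infty, c => c
  | one, c => c
  | negOne, c => c
  | vert a _, Corner.nw => Sum.inl (a.ends Corner.nw)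
  | vert a _, Corner.ne => Sum.inl (a.ends Corner.ne)
  | vert _ b, Corner.sw => Sum.inr (b.ends Corner.sw)
  | vert _ b, Corner.se => Sum.inr (b.ends Corner.se)
  | horiz a _, Corner.nw => Sum.inl (a.ends Corner.nw)
  | horiz _ b, Corner.ne => Sum.inr (b.ends Corner.ne)
  | horiz a _, Corner.sw => Sum.inl (a.ends Corner.sw)
  | horiz _ b, Corner.se => Sum.inr (b.ends Corner.se)

/-- The other end of the same strand of the same piece. -/
def mate : (S : Tangle) → S.Pt → S.Pt
  | zero, c => Corner.flipH c
  | infty, c => Corner.flipV c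
  | one, c => Corner.opposite c
  | negOne, c => Corner.opposite c
  | vert a _, Sum.inl p => Sum.inl (a.mate p)
  | vert _ b, Sum.inr p => Sum.inr (b.mate p)
  | horiz a _, Sum.inl p => Sum.inl (a.mate p)
  | horiz _ b, Sum.inr p => Sum.inr (b.mate p)

/-- The ends of under-strands of crossings. -/
def IsUnder : (S : Tangle) → S.Pt → Prop
  | zero, _ => False
  | infty, _ => False
  | one, c => c = Corner.ne ∨ c = Corner.sw
  | negOne, c => c = Corner.nw ∨ c = Corner.se
  | vert a _, Sum.inl p => a.IsUnder p
  | vert _ b, Sum.inr p => b.IsUnder p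
  | horiz a _, Sum.inl p => a.IsUnder p
  | horiz _ b, Sum.inr p => b.IsUnder p

/-- The ends of pieces that are glued in the tangle. -/
def Glued : (S : Tangle) → S.Pt → S.Pt → Prop
  | zero, _, _ => False
  | infty, _, _ => False
  | one, _, _ => False
  | negOne, _, _ => False
  | vert a _, Sum.inl p, Sum.inl q => a.Glued p q
  | vert _ b, Sum.inr p, Sum.inr q => b.Glued p q
  | vert a b, Sum.inl p, Sum.inr q =>
      (p = a.ends Corner.sw ∧ q = b.ends Corner.nw) ∨
      (p = a.ends Corner.se ∧ q = b.ends Corner.ne)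
  | vert _ _, Sum.inr _, Sum.inl _ => False
  | horiz a _, Sum.inl p, Sum.inl q => a.Glued p q
  | horiz _ b, Sum.inr p, Sum.inr q => b.Glued p q
  | horiz a b, Sum.inl p, Sum.inr q =>
      (p = a.ends Corner.ne ∧ q = b.ends Corner.nw) ∨
      (p = a.ends Corner.se ∧ q = b.ends Corner.sw)
  | horiz _ _, Sum.inr _, Sum.inl _ => False

/-- The crossings of a tangle. -/
def Crossing : Tangle → Type
  | zero => Empty
  | infty => Empty
  | one => Unit
  | negOne => Unit
  | vert a b => a.Crossing ⊕ b.Crossing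
  | horiz a b => a.Crossing ⊕ b.Crossing

/-- The four ends at a crossing. -/
def crossingPt : (S : Tangle) → S.Crossing → Corner → S.Pt
  | one, _, d => d
  | negOne, _, d => d
  | vert a _, Sum.inl c, d => Sum.inl (a.crossingPt c d)
  | vert _ b, Sum.inr c, d => Sum.inr (b.crossingPt c d)
  | horiz a _, Sum.inl c, d => Sum.inl (a.crossingPt c d)
  | horiz _ b, Sum.inr c, d => Sum.inr (b.crossingPt c d)

/-- Whether a crossing is a copy of `[1]` (and not of `[-1]`). -/
def isOne : (S : Tangle) → S.Crossing → Bool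
  | one, _ => true
  | negOne, _ => false
  | vert a _, Sum.inl c => a.isOne c
  | vert _ b, Sum.inr c => b.isOne c
  | horiz a _, Sum.inl c => a.isOne c
  | horiz _ b, Sum.inr c => b.isOne c

/-- An end of the over-strand at a crossing. -/
def overPt (S : Tangle) (c : S.Crossing) : S.Pt :=
  S.crossingPt c (if S.isOne c then Corner.nw else Corner.ne)

/-- An end of the under-strand at a crossing. -/
def underPt (S : Tangle) (c : S.Crossing) : S.Pt :=
  S.crossingPt c (if S.isOne c then Corner.ne else Corner.nw)

/-! ### The denominator -/

/-- The ends of pieces that are glued in the denominator `D(T)`: there the NW end of `T` is joined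
with the SW end, and the NE end with the SE end. -/
def GluedD (T : Tangle) (p q : T.Pt) : Prop :=
  T.Glued p q ∨ (p = T.ends Corner.nw ∧ q = T.ends Corner.sw) ∨
    (p = T.ends Corner.ne ∧ q = T.ends Corner.se)

/-- The arcs of `D(T)`. -/
def ArcD (T : Tangle) : Type :=
  Quot fun p q : T.Pt => T.GluedD p q ∨ (¬ T.IsUnder p ∧ q = T.mate p)

/-- The components of `D(T)`. -/
def CompD (T : Tangle) : Type :=
  Quot fun p q : T.Pt => T.GluedD p q ∨ q = T.mate p

/-- The arc of `D(T)` through an end of a piece. -/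
def arcOf (T : Tangle) (p : T.Pt) : T.ArcD := Quot.mk _ p

/-- The component of `D(T)` through an end of a piece. -/
def compOf (T : Tangle) (p : T.Pt) : T.CompD := Quot.mk _ p

/-- An orientation of `D(T)`: `out p` says that the strand through the end `p` of a piece is directed
out of that piece at `p`. -/
structure Orientation (T : Tangle) where
  out : T.Pt → Bool
  out_mate : ∀ p, out (T.mate p) = !out p
  out_glued : ∀ p q, T.GluedD p q → out q = !out p

/-- The oriented link diagram `D(T)`. -/
def denominator (T : Tangle) (o : T.Orientation) : OrientedDiagram where
  Arc := T.ArcD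
  Comp := T.CompD
  Crossing := T.Crossing
  comp := Quot.lift T.compOf fun _ _ h =>
    Quot.sound (h.elim Or.inl fun h => Or.inr h.2)
  overArc c := T.arcOf (T.overPt c)
  underIn c := T.arcOf (if o.out (T.underPt c) then T.mate (T.underPt c) else T.underPt c)
  underOut c := T.arcOf (if o.out (T.underPt c) then T.underPt c else T.mate (T.underPt c))
  -- At a copy of `[1]` with over-strand running to SE, the side to its left is NE; so the crossing is
  -- positive if the under-strand runs to NE. At a copy of `[-1]` with over-strand running to NE, the
  -- side to its left is NW; so it is positive if the under-strand runs to NW.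
  positive c :=
    let ne := o.out (T.crossingPt c Corner.ne)
    let se := o.out (T.crossingPt c Corner.se)
    if T.isOne c then ne == se else ne != se

/-- The value of `Φ` at the arc through an end `p` of a piece, directed out of the piece: `t_c` or
`t_c⁻¹`, according as this is the direction of the component `c` or not. -/
noncomputable def Orientation.label {T : Tangle} (o : T.Orientation) (p : T.Pt) :
    RatFun (T.denominator o).Comp :=
  if o.out p then tvar (T.compOf p) else (tvar (T.compOf p))⁻¹

/-! ### Diagonal reflection and integer tangles -/

/-- The tangle `σ(S)`, the image of `S` under the planar reflection in the NW-SE diagonal. -/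
def reflect : Tangle → Tangle
  | zero => infty
  | infty => zero
  | one => one
  | negOne => negOne
  | vert a b => horiz a.reflect b.reflect
  | horiz a b => vert a.reflect b.reflect

/-- The end of a piece of `S` of which a given end in `σ(S)` is the mirror image. -/
def unreflectPt : (S : Tangle) → S.reflect.Pt → S.Pt
  | zero, c => Corner.reflect c
  | infty, c => Corner.reflect c
  | one, c => Corner.reflect c
  | negOne, c => Corner.reflect c
  | vert a _, Sum.inl p => Sum.inl (a.unreflectPt p)
  | vert _ b, Sum.inr p => Sum.inr (b.unreflectPt p)
  | horiz a _, Sum.inl p => Sum.inl (a.unreflectPt p)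
  | horiz _ b, Sum.inr p => Sum.inr (b.unreflectPt p)

/-- `IsInt S k`: `S` is the integer tangle `[k]`, that is, `[0]` or a horizontal composite (however
bracketed) of `|k|` copies of `[1]` or of `[-1]`. -/
inductive IsInt : Tangle → ℤ → Prop
  | zero : IsInt Tangle.zero 0
  | one : IsInt Tangle.one 1
  | negOne : IsInt Tangle.negOne (-1)
  | add {a b : Tangle} {k l : ℤ} (ha : IsInt a k) (hb : IsInt b l) (hkl : 0 < k * l) :
      IsInt (Tangle.horiz a b) (k + l)

end Tangle

/-! ## The rules -/

section Rules

variable {K : Type} [Field K]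

/-- `[k]_a`. -/
def qint (k : ℤ) (a : K) : K :=
  if 0 ≤ k then ∑ i ∈ Finset.range k.natAbs, a ^ i
  else -(a ^ k * ∑ i ∈ Finset.range k.natAbs, a ^ i)

/-- `b₁ ∘_v b₂`. -/
def compV (tne tse tsw b₁ b₂ : K) : K :=
  b₁ + (1 - tne⁻¹) / (1 - tse) * b₂ + (tsw - tse⁻¹) / (1 - tse⁻¹) * (b₁ * b₂)

/-- `c₁ ∘_h c₂`. -/
def compH (tne tse tsw c₁ c₂ : K) : K :=
  c₁ + (1 - tsw) / (1 - tse⁻¹) * c₂ + (tne⁻¹ - tse) / (1 - tse) * (c₁ * c₂)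

/-- The product `v₁ v₂ ((h₁/v₁) ∘_v (h₂/v₂))`, with cleared denominators. -/
def clearedV (tne tse tsw v₁ h₁ v₂ h₂ : K) : K :=
  h₁ * v₂ + (1 - tne⁻¹) / (1 - tse) * (v₁ * h₂) + (tsw - tse⁻¹) / (1 - tse⁻¹) * (h₁ * h₂)

/-- The product `h₁ h₂ ((v₁/h₁) ∘_h (v₂/h₂))`, with cleared denominators. -/
def clearedH (tne tse tsw v₁ h₁ v₂ h₂ : K) : K :=
  v₁ * h₂ + (1 - tsw) / (1 - tse⁻¹) * (h₁ * v₂) + (tne⁻¹ - tse) / (1 - tse) * (v₁ * v₂)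

theorem clearedV_iff (tne tse tsw v₁ h₁ v₂ h₂ h : K) (hv₁ : v₁ ≠ 0) (hv₂ : v₂ ≠ 0) :
    h / (v₁ * v₂) = compV tne tse tsw (h₁ / v₁) (h₂ / v₂) ↔
      h = clearedV tne tse tsw v₁ h₁ v₂ h₂ := by
  have e : clearedV tne tse tsw v₁ h₁ v₂ h₂ =
      compV tne tse tsw (h₁ / v₁) (h₂ / v₂) * (v₁ * v₂) := by
    simp only [clearedV, compV]
    generalize (1 - tne⁻¹) / (1 - tse) = A
    generalize (tsw - tse⁻¹) / (1 - tse⁻¹) = B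
    field_simp
  rw [e, div_eq_iff (mul_ne_zero hv₁ hv₂)]

theorem clearedH_iff (tne tse tsw v₁ h₁ v₂ h₂ v : K) (hh₁ : h₁ ≠ 0) (hh₂ : h₂ ≠ 0) :
    v / (h₁ * h₂) = compH tne tse tsw (v₁ / h₁) (v₂ / h₂) ↔
      v = clearedH tne tse tsw v₁ h₁ v₂ h₂ := by
  have e : clearedH tne tse tsw v₁ h₁ v₂ h₂ =
      compH tne tse tsw (v₁ / h₁) (v₂ / h₂) * (h₁ * h₂) := by
    simp only [clearedH, compH]
    generalize (1 - tsw) / (1 - tse⁻¹) = A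
    generalize (tne⁻¹ - tse) / (1 - tse) = B
    field_simp
  rw [e, div_eq_iff (mul_ne_zero hh₁ hh₂)]

/-- `Computes S φ v h`: for the tangle `S`, whose pieces have the labels `φ` at their ends (the values
of `Φ` at the outward arcs), the rules lead to `z_v(S) = v`, `z_h(S) = h`. In `σ(S)` all arcs are
reversed, so the labels are inverted. By `clearedV_iff` and `clearedH_iff`, the rules for `∗` and `+`
are the rules for the ratios `z_h/z_v` and `z_v/z_h` whenever these ratios exist. -/
inductive Computes : (S : Tangle) → (S.Pt → K) → K → K → Prop
  | reflect {S : Tangle} {φ : S.Pt → K} {v h : K} (hS : Computes S φ v h) :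
      Computes S.reflect (fun p => (φ (S.unreflectPt p))⁻¹) h v
  | vert {a b : Tangle} {φ : (Tangle.vert a b).Pt → K} {v₁ h₁ v₂ h₂ : K}
      (ha : Computes a (fun p => φ (Sum.inl p)) v₁ h₁)
      (hb : Computes b (fun p => φ (Sum.inr p)) v₂ h₂) :
      Computes (Tangle.vert a b) φ (v₁ * v₂)
        (clearedV (φ (Sum.inl (a.ends Corner.ne))) (φ (Sum.inl (a.ends Corner.se)))
          (φ (Sum.inl (a.ends Corner.sw))) v₁ h₁ v₂ h₂)
  | horiz {a b : Tangle} {φ : (Tangle.horiz a b).Pt → K} {v₁ h₁ v₂ h₂ : K}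
      (ha : Computes a (fun p => φ (Sum.inl p)) v₁ h₁)
      (hb : Computes b (fun p => φ (Sum.inr p)) v₂ h₂) :
      Computes (Tangle.horiz a b) φ
        (clearedH (φ (Sum.inl (a.ends Corner.ne))) (φ (Sum.inl (a.ends Corner.se)))
          (φ (Sum.inl (a.ends Corner.sw))) v₁ h₁ v₂ h₂)
        (h₁ * h₂)
  | even {S : Tangle} {φ : S.Pt → K} {l : ℤ} (hS : S.IsInt (2 * l)) :
      Computes S φ
        (φ (S.ends Corner.ne) * (φ (S.ends Corner.se) - 1) *
          qint l (φ (S.ends Corner.ne) * φ (S.ends Corner.se))) 1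
  | odd {S : Tangle} {φ : S.Pt → K} {l : ℤ} (hS : S.IsInt (2 * l - 1)) :
      Computes S φ
        ((1 - φ (S.ends Corner.se)) *
          qint l (φ (S.ends Corner.ne) * φ (S.ends Corner.se)) - 1) 1

/-- The rules always lead to a result. -/
theorem exists_computes (S : Tangle) (φ : S.Pt → K) : ∃ v h, Computes S φ v h := by
  induction S with
  | zero => exact ⟨_, _, Computes.even (l := 0) Tangle.IsInt.zero⟩
  | one => exact ⟨_, _, Computes.odd (l := 1) Tangle.IsInt.one⟩
  | negOne => exact ⟨_, _, Computes.odd (l := 0) Tangle.IsInt.negOne⟩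
  | infty =>
    have e : φ = fun c : Corner => ((φ (Corner.reflect (Corner.reflect c)))⁻¹)⁻¹ := by
      funext c
      cases c <;> exact (inv_inv _).symm
    rw [e]
    exact ⟨_, _, Computes.reflect (S := Tangle.zero)
      (φ := fun c : Corner => (φ (Corner.reflect c))⁻¹)
      (Computes.even (l := 0) Tangle.IsInt.zero)⟩
  | vert a b iha ihb =>
    obtain ⟨_, _, ha⟩ := iha fun p => φ (Sum.inl p)
    obtain ⟨_, _, hb⟩ := ihb fun p => φ (Sum.inr p)
    exact ⟨_, _, Computes.vert ha hb⟩
  | horiz a b iha ihb =>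
    obtain ⟨_, _, ha⟩ := iha fun p => φ (Sum.inl p)
    obtain ⟨_, _, hb⟩ := ihb fun p => φ (Sum.inr p)
    exact ⟨_, _, Computes.horiz ha hb⟩

end Rules

end Arborescent

/-! Every end `p` of a piece carries an unknown, the Fox derivative with respect to the outward arc
`x_p`. A strand or gluing between `p` and `q` means `x_p x_q = 1` and gives the equation `f p + φ p
* f q = 0`. A crossing gives the derivative of the word `x_nw x_ne x_se x_sw` of the loop around it,
the two over-ends being written as one letter and its inverse.

A tangle has two equations fewer than unknowns (`card_pt`), so its determinant is an alternating
form in two additional equations between the four ends. By `hasForm`, this form is, up to a factor,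
the 2×2 determinant of the values of these equations on two solutions: the trivial one, `1 - φ`, and
`outcomeVec`, which is built from `(z_v, z_h)`. Juxtaposed tangles have four free slots
(`rowDet_juxtapose`); a composition fills two of them with gluing equations, and the resulting 4×4
determinants (`det_vertSlots`, `det_horizSlots`) reproduce the rules for `∗` and `+`.

Horizontal composition also yields the factor `(1 - t_se) / (1 - t_ne)`, which is not a unit. It is
absorbed by `rootRatio`, formed from square roots of the `1 - t_c` in an algebraic closure. When the
tangle is closed `rootRatio` is `1`, so the final identity is free of roots and descends to the
original field (`Orientation.exists_minor`).

For the denominator the system is square, and one of its minors is `z_h` up to a unit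
(`exists_main_minor`). The rows satisfy a linear relation with unit coefficients, because the word
of the loop around the tangle becomes trivial on closing; the columns satisfy one with coefficients
`1 - φ p`, by the fundamental formula of Fox calculus. Hence the minor at row `j` and column `p` is
proportional to `1 - φ p` (`mul_rowMinor`). This determines all minors and accounts for the divisor
in the definition of the Alexander polynomial.

To reach the Alexander matrix, the arcs are given their actual directions (`closedRows_mul_turn`).
The equations of strands and gluings then identify consecutive unknowns along an arc, and
eliminating them (`Wiring.det_eq_det_collapse`) leaves one unknown for each arc, one row for each
crossing and a zero row for each circle. The same walk along the arcs shows that relators and arcs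
are equally many.

Finally, every computation gives a common unit multiple of the pair found along the decomposition
(`Computes.eq_outcome`), because reflection and the closed formula for `[k]` are compatible with the
rules of composition. -/

namespace Arborescent

/-! ### Gaussian integers `[k]_a` -/

section QInt

variable {K : Type} [Field K]

theorem qint_natCast (n : ℕ) (a : K) : qint (n : ℤ) a = ∑ i ∈ Finset.range n, a ^ i := by
  simp [qint]

theorem qint_negSucc (n : ℕ) (a : K) :
    qint (Int.negSucc n) a = -(a ^ (Int.negSucc n) * ∑ i ∈ Finset.range (n + 1), a ^ i) := by
  simp [qint]

theorem qint_add_one (k : ℤ) {a : K} (ha : a ≠ 0) : qint (k + 1) a = qint k a + a ^ k := by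
  cases k with
  | ofNat n =>
    have h : (Int.ofNat n + 1 : ℤ) = ((n + 1 : ℕ) : ℤ) := by simp
    rw [h, qint_natCast, Int.ofNat_eq_natCast, qint_natCast, Finset.sum_range_succ, zpow_natCast]
  | negSucc n =>
    cases n with
    | zero => simp [qint]
    | succ n =>
      have h : (Int.negSucc (n + 1) + 1 : ℤ) = Int.negSucc n := by
        simp only [Int.negSucc_eq]; push_cast; ring
      rw [h, qint_negSucc, qint_negSucc, ← h, zpow_add_one₀ ha,
        Finset.sum_range_succ' _ (n + 1)]
      simp only [pow_succ, ← Finset.sum_mul]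
      ring

theorem qint_mul_sub_one (k : ℤ) {a : K} (ha : a ≠ 0) : (a - 1) * qint k a = a ^ k - 1 := by
  induction k using Int.induction_on with
  | zero => simp [qint]
  | succ n ih => rw [qint_add_one _ ha, mul_add, ih, zpow_add_one₀ ha]; ring
  | pred n ih =>
    have h := qint_add_one (-(n : ℤ) - 1) ha
    rw [sub_add_cancel] at h
    have h' := zpow_add_one₀ ha (-(n : ℤ) - 1)
    rw [sub_add_cancel] at h'
    rw [h, h'] at ih
    linear_combination ih

/-- The power `a ^ k` is written as `1 + (a - 1) * qint k a`, because `clearedH` produces exactly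
this polynomial in the two values of `qint`. -/
theorem qint_add (k l : ℤ) {a : K} (ha : a ≠ 0) :
    qint (k + l) a = qint k a + (1 + (a - 1) * qint k a) * qint l a := by
  rw [qint_mul_sub_one k ha, add_sub_cancel]
  induction l using Int.induction_on with
  | zero => simp [qint]
  | succ n ih => rw [← add_assoc, qint_add_one _ ha, ih, qint_add_one _ ha, zpow_add₀ ha]; ring
  | pred n ih =>
    have h := qint_add_one (-(n : ℤ) - 1) ha
    have h' := qint_add_one (k + (-(n : ℤ) - 1)) ha
    have e : k + (-(n : ℤ) - 1) + 1 = k + -(n : ℤ) := by ring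
    rw [sub_add_cancel] at h
    rw [e, zpow_add₀ ha] at h'
    rw [h', h] at ih
    linear_combination ih

theorem qint_one (a : K) : qint 1 a = 1 := by simp [qint]

end QInt

/-! ### Compatible labellings -/

section UnitOf

variable {L : Type} [Field L]

/-- `a` is a unit that belongs to `U`. -/
def UnitOf (U : Subgroup Lˣ) (a : L) : Prop := ∃ u ∈ U, (u : L) = a

variable {U : Subgroup Lˣ} {a b : L}

theorem UnitOf.ne_zero (h : UnitOf U a) : a ≠ 0 := by
  obtain ⟨u, -, rfl⟩ := h
  exact u.ne_zero

theorem UnitOf.one : UnitOf U (1 : L) := ⟨1, U.one_mem, rfl⟩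

theorem UnitOf.mul (ha : UnitOf U a) (hb : UnitOf U b) : UnitOf U (a * b) := by
  obtain ⟨u, hu, rfl⟩ := ha
  obtain ⟨v, hv, rfl⟩ := hb
  exact ⟨u * v, U.mul_mem hu hv, rfl⟩

theorem UnitOf.inv (ha : UnitOf U a) : UnitOf U a⁻¹ := by
  obtain ⟨u, hu, rfl⟩ := ha
  exact ⟨u⁻¹, U.inv_mem hu, Units.val_inv_eq_inv_val u⟩

theorem UnitOf.neg (hU : -1 ∈ U) (ha : UnitOf U a) : UnitOf U (-a) := by
  obtain ⟨u, hu, rfl⟩ := ha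
  exact ⟨-1 * u, U.mul_mem hU hu, by simp⟩

theorem UnitOf.sign (hU : -1 ∈ U) (s : ℤˣ) : UnitOf U ((s : ℤ) : L) := by
  rcases Int.units_eq_one_or s with rfl | rfl
  · simpa using UnitOf.one
  · simpa using UnitOf.one.neg hU

end UnitOf

section Labels

variable {K : Type} [Field K]

/-- A labelling of the ends of the pieces of a tangle by units from `U`, different from `1`, such
that the labels of joined ends are inverse to each other. -/
structure Compatible (U : Subgroup Kˣ) (S : Tangle) (φ : S.Pt → K) : Prop where
  unit : ∀ p, UnitOf U (φ p)
  ne_one : ∀ p, φ p ≠ 1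
  mate : ∀ p, φ (S.mate p) = (φ p)⁻¹
  glued : ∀ p q, S.Glued p q → φ q = (φ p)⁻¹

variable {U : Subgroup Kˣ}

theorem Compatible.ne_zero {S : Tangle} {φ : S.Pt → K} (h : Compatible U S φ) (p : S.Pt) :
    φ p ≠ 0 := (h.unit p).ne_zero

theorem Compatible.vert_left {a b : Tangle} {φ : (Tangle.vert a b).Pt → K}
    (h : Compatible U (Tangle.vert a b) φ) : Compatible U a fun p => φ (Sum.inl p) :=
  ⟨fun _ => h.unit _, fun _ => h.ne_one _, fun p => h.mate (Sum.inl p),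
    fun p q hg => h.glued (Sum.inl p) (Sum.inl q) hg⟩

theorem Compatible.vert_right {a b : Tangle} {φ : (Tangle.vert a b).Pt → K}
    (h : Compatible U (Tangle.vert a b) φ) : Compatible U b fun p => φ (Sum.inr p) :=
  ⟨fun _ => h.unit _, fun _ => h.ne_one _, fun p => h.mate (Sum.inr p),
    fun p q hg => h.glued (Sum.inr p) (Sum.inr q) hg⟩

theorem Compatible.horiz_left {a b : Tangle} {φ : (Tangle.horiz a b).Pt → K}
    (h : Compatible U (Tangle.horiz a b) φ) : Compatible U a fun p => φ (Sum.inl p) :=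
  ⟨fun _ => h.unit _, fun _ => h.ne_one _, fun p => h.mate (Sum.inl p),
    fun p q hg => h.glued (Sum.inl p) (Sum.inl q) hg⟩

theorem Compatible.horiz_right {a b : Tangle} {φ : (Tangle.horiz a b).Pt → K}
    (h : Compatible U (Tangle.horiz a b) φ) : Compatible U b fun p => φ (Sum.inr p) :=
  ⟨fun _ => h.unit _, fun _ => h.ne_one _, fun p => h.mate (Sum.inr p),
    fun p q hg => h.glued (Sum.inr p) (Sum.inr q) hg⟩

theorem Compatible.vert_nw {a b : Tangle} {φ : (Tangle.vert a b).Pt → K}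
    (h : Compatible U (Tangle.vert a b) φ) :
    φ (Sum.inr (b.ends Corner.nw)) = (φ (Sum.inl (a.ends Corner.sw)))⁻¹ :=
  h.glued (Sum.inl _) (Sum.inr _) (Or.inl ⟨rfl, rfl⟩)

theorem Compatible.vert_ne {a b : Tangle} {φ : (Tangle.vert a b).Pt → K}
    (h : Compatible U (Tangle.vert a b) φ) :
    φ (Sum.inr (b.ends Corner.ne)) = (φ (Sum.inl (a.ends Corner.se)))⁻¹ :=
  h.glued (Sum.inl _) (Sum.inr _) (Or.inr ⟨rfl, rfl⟩)

theorem Compatible.horiz_nw {a b : Tangle} {φ : (Tangle.horiz a b).Pt → K}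
    (h : Compatible U (Tangle.horiz a b) φ) :
    φ (Sum.inr (b.ends Corner.nw)) = (φ (Sum.inl (a.ends Corner.ne)))⁻¹ :=
  h.glued (Sum.inl _) (Sum.inr _) (Or.inl ⟨rfl, rfl⟩)

theorem Compatible.horiz_sw {a b : Tangle} {φ : (Tangle.horiz a b).Pt → K}
    (h : Compatible U (Tangle.horiz a b) φ) :
    φ (Sum.inr (b.ends Corner.sw)) = (φ (Sum.inl (a.ends Corner.se)))⁻¹ :=
  h.glued (Sum.inl _) (Sum.inr _) (Or.inr ⟨rfl, rfl⟩)

/-- The product of the labels at the four ends is `1`. -/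
theorem Compatible.prod_ends : ∀ {S : Tangle} {φ : S.Pt → K}, Compatible U S φ →
    φ (S.ends Corner.nw) * φ (S.ends Corner.ne) * φ (S.ends Corner.se) * φ (S.ends Corner.sw) = 1
  | .zero, φ, h => by
    have h1 : φ Corner.ne = (φ Corner.nw)⁻¹ := h.mate Corner.nw
    have h2 : φ Corner.sw = (φ Corner.se)⁻¹ := h.mate Corner.se
    have n1 := h.ne_zero Corner.nw
    have n2 := h.ne_zero Corner.se
    simp only [Tangle.ends]
    rw [h1, h2]; field_simp
  | .infty, φ, h => by
    have h1 : φ Corner.sw = (φ Corner.nw)⁻¹ := h.mate Corner.nw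
    have h2 : φ Corner.ne = (φ Corner.se)⁻¹ := h.mate Corner.se
    have n1 := h.ne_zero Corner.nw
    have n2 := h.ne_zero Corner.se
    simp only [Tangle.ends]
    rw [h1, h2]; field_simp
  | .one, φ, h => by
    have h1 : φ Corner.se = (φ Corner.nw)⁻¹ := h.mate Corner.nw
    have h2 : φ Corner.ne = (φ Corner.sw)⁻¹ := h.mate Corner.sw
    have n1 := h.ne_zero Corner.nw
    have n2 := h.ne_zero Corner.sw
    simp only [Tangle.ends]
    rw [h1, h2]; field_simp
  | .negOne, φ, h => by
    have h1 : φ Corner.se = (φ Corner.nw)⁻¹ := h.mate Corner.nw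
    have h2 : φ Corner.ne = (φ Corner.sw)⁻¹ := h.mate Corner.sw
    have n1 := h.ne_zero Corner.nw
    have n2 := h.ne_zero Corner.sw
    simp only [Tangle.ends]
    rw [h1, h2]; field_simp
  | .vert a b, φ, h => by
    have ha := h.vert_left.prod_ends
    have hb := h.vert_right.prod_ends
    have n1 := h.ne_zero (Sum.inl (a.ends Corner.sw))
    have n2 := h.ne_zero (Sum.inl (a.ends Corner.se))
    simp only [h.vert_nw, h.vert_ne] at hb
    field_simp at hb
    simp only [Tangle.ends]
    linear_combination ha + φ (Sum.inl (a.ends Corner.nw)) * φ (Sum.inl (a.ends Corner.ne)) * hb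
  | .horiz a b, φ, h => by
    have ha := h.horiz_left.prod_ends
    have hb := h.horiz_right.prod_ends
    have n1 := h.ne_zero (Sum.inl (a.ends Corner.ne))
    have n2 := h.ne_zero (Sum.inl (a.ends Corner.se))
    simp only [h.horiz_nw, h.horiz_sw] at hb
    field_simp at hb
    simp only [Tangle.ends]
    linear_combination ha + φ (Sum.inl (a.ends Corner.nw)) * φ (Sum.inl (a.ends Corner.sw)) * hb

end Labels

/-! ### Diagonal reflection -/

namespace Tangle

theorem unreflectPt_ends : ∀ (S : Tangle) (c : Corner),
    S.unreflectPt (S.reflect.ends c) = S.ends (Corner.reflect c)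
  | zero, _ | infty, _ | one, _ | negOne, _ => rfl
  | vert a b, c => by
    cases c
    · exact congrArg Sum.inl (unreflectPt_ends a Corner.nw)
    · exact congrArg Sum.inr (unreflectPt_ends b Corner.ne)
    · exact congrArg Sum.inl (unreflectPt_ends a Corner.sw)
    · exact congrArg Sum.inr (unreflectPt_ends b Corner.se)
  | horiz a b, c => by
    cases c
    · exact congrArg Sum.inl (unreflectPt_ends a Corner.nw)
    · exact congrArg Sum.inl (unreflectPt_ends a Corner.ne)
    · exact congrArg Sum.inr (unreflectPt_ends b Corner.sw)
    · exact congrArg Sum.inr (unreflectPt_ends b Corner.se)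

theorem unreflectPt_surjective : ∀ S : Tangle, Function.Surjective S.unreflectPt
  | zero, c | infty, c | one, c | negOne, c => ⟨Corner.reflect c, by cases c <;> rfl⟩
  | vert a b, p | horiz a b, p => by
    cases p with
    | inl p =>
      obtain ⟨q, hq⟩ := unreflectPt_surjective a p
      exact ⟨Sum.inl q, congrArg Sum.inl hq⟩
    | inr p =>
      obtain ⟨q, hq⟩ := unreflectPt_surjective b p
      exact ⟨Sum.inr q, congrArg Sum.inr hq⟩

theorem unreflectPt_mate : ∀ (S : Tangle) (p : S.reflect.Pt),
    S.unreflectPt (S.reflect.mate p) = S.mate (S.unreflectPt p)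
  | zero, c | infty, c | one, c | negOne, c => by cases c <;> rfl
  | vert a b, p | horiz a b, p => by
    cases p with
    | inl p => exact congrArg Sum.inl (unreflectPt_mate a p)
    | inr p => exact congrArg Sum.inr (unreflectPt_mate b p)

theorem exists_reflect_glued : ∀ (S : Tangle) (p q : S.Pt), S.Glued p q →
    ∃ p' q', S.unreflectPt p' = p ∧ S.unreflectPt q' = q ∧ S.reflect.Glued p' q'
  | zero, _, _, h | infty, _, _, h | one, _, _, h | negOne, _, _, h => h.elim
  | vert a b, p, q, h | horiz a b, p, q, h => by
    rcases p with p | p <;> rcases q with q | q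
    · obtain ⟨p', q', hp, hq, hg⟩ := exists_reflect_glued a p q h
      exact ⟨Sum.inl p', Sum.inl q', congrArg Sum.inl hp, congrArg Sum.inl hq, hg⟩
    · rcases h with ⟨rfl, rfl⟩ | ⟨rfl, rfl⟩
      · exact ⟨Sum.inl _, Sum.inr _, congrArg Sum.inl (unreflectPt_ends a _),
          congrArg Sum.inr (unreflectPt_ends b _), Or.inl ⟨rfl, rfl⟩⟩
      · exact ⟨Sum.inl _, Sum.inr _, congrArg Sum.inl (unreflectPt_ends a _),
          congrArg Sum.inr (unreflectPt_ends b _), Or.inr ⟨rfl, rfl⟩⟩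
    · exact h.elim
    · obtain ⟨p', q', hp, hq, hg⟩ := exists_reflect_glued b p q h
      exact ⟨Sum.inr p', Sum.inr q', congrArg Sum.inr hp, congrArg Sum.inr hq, hg⟩

end Tangle

/-- This is the direction in which an induction on `Computes` descends, from `σ(S)` to `S`. It
suffices that every end, and every gluing, of `S` comes from one of `σ(S)`. -/
theorem Compatible.of_reflect {K : Type} [Field K] {U : Subgroup Kˣ} {S : Tangle} {φ : S.Pt → K}
    (h : Compatible U S.reflect fun p => (φ (S.unreflectPt p))⁻¹) : Compatible U S φ where
  unit p := by
    obtain ⟨p, rfl⟩ := S.unreflectPt_surjective p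
    obtain ⟨u, hu, e⟩ := h.unit p
    refine ⟨u⁻¹, U.inv_mem hu, ?_⟩
    rw [Units.val_inv_eq_inv_val, e, inv_inv]
  ne_one p := by
    obtain ⟨p, rfl⟩ := S.unreflectPt_surjective p
    exact fun e => h.ne_one p (by simp only [e, inv_one])
  mate p := by
    obtain ⟨p, rfl⟩ := S.unreflectPt_surjective p
    have := h.mate p
    simp only [Tangle.unreflectPt_mate, inv_inv] at this
    rw [← this, inv_inv]
  glued p q hg := by
    obtain ⟨p, q, rfl, rfl, hg'⟩ := S.exists_reflect_glued p q hg
    have := h.glued p q hg'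
    simp only [inv_inv] at this
    rw [← this, inv_inv]

/-! ### The outcome of the rules is unique up to a unit -/

section Outcome

variable {K : Type} [Field K]

/-- The pair `(z_v, z_h)` computed along the given decomposition. -/
def outcome : (S : Tangle) → (S.Pt → K) → K × K
  | .zero, _ => (0, 1)
  | .infty, _ => (1, 0)
  | .one, φ => (-φ Corner.se, 1)
  | .negOne, _ => (-1, 1)
  | .vert a b, φ =>
      let x := outcome a fun p => φ (Sum.inl p)
      let y := outcome b fun p => φ (Sum.inr p)
      (x.1 * y.1, clearedV (φ (Sum.inl (a.ends Corner.ne))) (φ (Sum.inl (a.ends Corner.se)))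
          (φ (Sum.inl (a.ends Corner.sw))) x.1 x.2 y.1 y.2)
  | .horiz a b, φ =>
      let x := outcome a fun p => φ (Sum.inl p)
      let y := outcome b fun p => φ (Sum.inr p)
      (clearedH (φ (Sum.inl (a.ends Corner.ne))) (φ (Sum.inl (a.ends Corner.se)))
          (φ (Sum.inl (a.ends Corner.sw))) x.1 x.2 y.1 y.2, x.2 * y.2)

/-- The rules of composition are homogeneous in each of the two pairs `(z_v, z_h)`; so an ambiguity
by units stays an ambiguity by units. -/
theorem clearedV_smul (e s w v₁ h₁ v₂ h₂ c d : K) :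
    clearedV e s w (c * v₁) (c * h₁) (d * v₂) (d * h₂) = c * d * clearedV e s w v₁ h₁ v₂ h₂ := by
  simp only [clearedV]; ring

theorem clearedH_smul (e s w v₁ h₁ v₂ h₂ c d : K) :
    clearedH e s w (c * v₁) (c * h₁) (d * v₂) (d * h₂) = c * d * clearedH e s w v₁ h₁ v₂ h₂ := by
  simp only [clearedH]; ring

/-- Under the diagonal reflection NE and SW change places and labels are inverted, which turns the
coefficients of one rule into those of the other. -/
theorem clearedH_inv (e s w v₁ h₁ v₂ h₂ : K) :
    clearedH w⁻¹ s⁻¹ e⁻¹ h₁ v₁ h₂ v₂ = clearedV e s w v₁ h₁ v₂ h₂ := by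
  simp only [clearedH, clearedV, inv_inv]

theorem clearedV_inv (e s w v₁ h₁ v₂ h₂ : K) :
    clearedV w⁻¹ s⁻¹ e⁻¹ h₁ v₁ h₂ v₂ = clearedH e s w v₁ h₁ v₂ h₂ := by
  simp only [clearedH, clearedV, inv_inv]

variable {U : Subgroup Kˣ}

/-- Reflection exchanges the two rules of composition, so the unit arises only at the crossings: `-φ
se` from each `[1]` and `-1` from each `[-1]`. -/
theorem outcome_reflect (hU : -1 ∈ U) : ∀ {S : Tangle} {φ : S.Pt → K}, Compatible U S φ →
    ∃ u ∈ U, (outcome S φ).2 = u * (outcome S.reflect fun p => (φ (S.unreflectPt p))⁻¹).1 ∧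
      (outcome S φ).1 = u * (outcome S.reflect fun p => (φ (S.unreflectPt p))⁻¹).2
  | .zero, φ, h => ⟨1, U.one_mem, by simp [outcome, Tangle.reflect]⟩
  | .infty, φ, h => ⟨1, U.one_mem, by simp [outcome, Tangle.reflect]⟩
  | .one, φ, h => by
    obtain ⟨u, hu, e⟩ := h.unit Corner.se
    refine ⟨-1 * u, U.mul_mem hU hu, ?_⟩
    have := u.ne_zero
    simp [outcome, Tangle.reflect, Tangle.unreflectPt, Corner.reflect, ← e]
  | .negOne, φ, h => ⟨-1, hU, by simp [outcome, Tangle.reflect]⟩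
  | .vert a b, φ, h => by
    obtain ⟨u, hu, h1, h2⟩ := outcome_reflect hU h.vert_left
    obtain ⟨u', hu', h1', h2'⟩ := outcome_reflect hU h.vert_right
    refine ⟨u * u', U.mul_mem hu hu', ?_, ?_⟩
    · simp only [outcome, Tangle.reflect, Tangle.unreflectPt, Tangle.unreflectPt_ends,
        Corner.reflect, clearedH_inv, h1, h2, h1', h2', clearedV_smul, Units.val_mul]
    · simp only [outcome, Tangle.reflect, Tangle.unreflectPt, h2, h2', Units.val_mul]
      ring
  | .horiz a b, φ, h => by
    obtain ⟨u, hu, h1, h2⟩ := outcome_reflect hU h.horiz_left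
    obtain ⟨u', hu', h1', h2'⟩ := outcome_reflect hU h.horiz_right
    refine ⟨u * u', U.mul_mem hu hu', ?_, ?_⟩
    · simp only [outcome, Tangle.reflect, Tangle.unreflectPt, h1, h1', Units.val_mul]
      ring
    · simp only [outcome, Tangle.reflect, Tangle.unreflectPt, Tangle.unreflectPt_ends,
        Corner.reflect, clearedV_inv, h1, h2, h1', h2', clearedH_smul, Units.val_mul]

/-- In this lemma and its three companions integer tangles are added according to parity. The parity
of the left summand decides whether its SW label is `s⁻¹` or `e⁻¹`; that of the right summand,
whether its NE and SE labels are `e, s` or `s, e`. -/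
theorem clearedH_even_even {e s : K} (e0 : e ≠ 0) (s0 : s ≠ 0) (s1 : 1 - s ≠ 0) (X Y : K) :
    clearedH e s s⁻¹ (e * (s - 1) * X) 1 (e * (s - 1) * Y) 1 =
      e * (s - 1) * (X + (1 + (e * s - 1) * X) * Y) := by
  have s2 : 1 - s⁻¹ ≠ 0 := fun h => s1 (by field_simp at h; linear_combination -h)
  rw [clearedH, div_self s2]
  field_simp
  ring

theorem clearedH_even_odd {e s : K} (e0 : e ≠ 0) (s0 : s ≠ 0) (s1 : 1 - s ≠ 0) (X Y : K) :
    clearedH e s s⁻¹ (e * (s - 1) * X) 1 ((1 - e) * Y - 1) 1 =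
      (1 - e) * (X + (1 + (e * s - 1) * X) * Y) - 1 := by
  have s2 : 1 - s⁻¹ ≠ 0 := fun h => s1 (by field_simp at h; linear_combination -h)
  rw [clearedH, div_self s2]
  field_simp
  ring

theorem one_sub_inv_div {e s : K} (e0 : e ≠ 0) (s0 : s ≠ 0) (s1 : 1 - s ≠ 0) :
    (1 - e⁻¹) / (1 - s⁻¹) = s * (1 - e) / (e * (1 - s)) := by
  have s2 : 1 - s⁻¹ ≠ 0 := fun h => s1 (by field_simp at h; linear_combination -h)
  rw [div_eq_div_iff s2 (mul_ne_zero e0 s1)]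
  field_simp
  ring

theorem clearedH_odd_even {e s : K} (e0 : e ≠ 0) (s0 : s ≠ 0) (s1 : 1 - s ≠ 0) (X Y : K) :
    clearedH e s e⁻¹ ((1 - s) * X - 1) 1 (e * (s - 1) * Y) 1 =
      (1 - s) * (X + (1 + (e * s - 1) * X) * Y) - 1 := by
  rw [clearedH, one_sub_inv_div e0 s0 s1]
  field_simp
  ring

theorem clearedH_odd_odd {e s : K} (e0 : e ≠ 0) (s0 : s ≠ 0) (s1 : 1 - s ≠ 0) {X Y Z : K}
    (h : X + (1 + (e * s - 1) * X) * Y = 1 + e * s * Z) :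
    clearedH e s e⁻¹ ((1 - s) * X - 1) 1 ((1 - e) * Y - 1) 1 = s * (e - 1) * Z := by
  have h' : e * (s * (e - 1) * Z) = (e - 1) * (X + (1 + (e * s - 1) * X) * Y - 1) := by
    rw [h]; ring
  rw [← mul_right_inj' e0, h', clearedH, one_sub_inv_div e0 s0 s1]
  field_simp
  ring

/-- The parity of `k` determines which ends the strands join. The resulting relations between labels
belong to the induction, since they express the labels of the right summand through those of the
left one. -/
theorem outcome_isInt {S : Tangle} {k : ℤ} (hS : S.IsInt k) :
    ∀ {φ : S.Pt → K}, Compatible U S φ → (outcome S φ).2 = 1 ∧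
      (∀ l, k = 2 * l → φ (S.ends Corner.ne) = (φ (S.ends Corner.nw))⁻¹ ∧
        φ (S.ends Corner.sw) = (φ (S.ends Corner.se))⁻¹ ∧
        (outcome S φ).1 = φ (S.ends Corner.ne) * (φ (S.ends Corner.se) - 1) *
          qint l (φ (S.ends Corner.ne) * φ (S.ends Corner.se))) ∧
      (∀ l, k = 2 * l - 1 → φ (S.ends Corner.se) = (φ (S.ends Corner.nw))⁻¹ ∧
        φ (S.ends Corner.ne) = (φ (S.ends Corner.sw))⁻¹ ∧
        (outcome S φ).1 = (1 - φ (S.ends Corner.se)) *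
          qint l (φ (S.ends Corner.ne) * φ (S.ends Corner.se)) - 1) := by
  induction hS with
  | zero =>
    intro φ h
    refine ⟨rfl, fun l hl => ⟨h.mate Corner.nw, h.mate Corner.se, ?_⟩, fun l hl => by omega⟩
    obtain rfl : l = 0 := by omega
    simp [outcome, qint]
  | one =>
    intro φ h
    refine ⟨rfl, fun l hl => by omega, fun l hl => ⟨h.mate Corner.nw, h.mate Corner.sw, ?_⟩⟩
    obtain rfl : l = 1 := by omega
    simp [outcome, qint_one, Tangle.ends]
  | negOne =>
    intro φ h
    refine ⟨rfl, fun l hl => by omega, fun l hl => ⟨h.mate Corner.nw, h.mate Corner.sw, ?_⟩⟩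
    obtain rfl : l = 0 := by omega
    simp [outcome, qint]
  | @add a b k l _ _ _ iha ihb =>
    intro φ h
    obtain ⟨ha, hae, hao⟩ := iha h.horiz_left
    obtain ⟨hb, hbe, hbo⟩ := ihb h.horiz_right
    have gn := h.horiz_nw
    have gw := h.horiz_sw
    have e0 := h.ne_zero (Sum.inl (a.ends Corner.ne))
    have s0 := h.ne_zero (Sum.inl (a.ends Corner.se))
    have s1 := sub_ne_zero.2 (h.ne_one (Sum.inl (a.ends Corner.se))).symm
    have es := mul_ne_zero e0 s0
    have q0 (i j : ℤ) := qint_add i j es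
    have q1 (m : ℤ) := qint_add 1 m es
    refine ⟨by simp [outcome, ha, hb], fun m hm => ?_, fun m hm => ?_⟩ <;>
    simp only [outcome, ha, hb, Tangle.ends] <;>
    rcases Int.even_or_odd' k with ⟨i, hi | hi⟩
    · obtain ⟨a1, a2, a3⟩ := hae i hi
      obtain ⟨b1, b2, b3⟩ := hbe (m - i) (by omega)
      rw [gn, inv_inv] at b1
      rw [gw, inv_inj] at b2
      rw [a3, b3, b1, ← b2, a2, clearedH_even_even e0 s0 s1, ← q0, add_sub_cancel]
      exact ⟨a1, rfl, rfl⟩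
    · obtain ⟨a1, a2, a3⟩ := hao (i + 1) (by omega)
      obtain ⟨b1, b2, b3⟩ := hbo (m - i) (by omega)
      rw [gn, inv_inv] at b1
      rw [gw, inv_inv] at b2
      have e2 := inv_eq_iff_eq_inv.1 a2.symm
      -- Two odd summands `2(i+1) - 1` and `2(m-i) - 1` have sum `2m`, while their indices have sum
      -- `m + 1`; splitting off the first term leaves `1 + a [m]_a`.
      have q2 := q0 (i + 1) (m - i)
      rw [show i + 1 + (m - i) = 1 + m by ring, q1, qint_one, mul_one, add_sub_cancel] at q2
      rw [a3, b3, b1, b2, e2, mul_comm (φ (Sum.inl (a.ends Corner.se))),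
        clearedH_odd_odd e0 s0 s1 q2.symm]
      exact ⟨a1, rfl, rfl⟩
    · obtain ⟨a1, a2, a3⟩ := hae i hi
      obtain ⟨b1, b2, b3⟩ := hbo (m - i) (by omega)
      rw [gn, inv_inv] at b1
      rw [gw, inv_inv] at b2
      rw [a3, b3, b1, b2, a2, mul_comm (φ (Sum.inl (a.ends Corner.se))),
        clearedH_even_odd e0 s0 s1, ← q0, add_sub_cancel]
      exact ⟨a1, (inv_inv _).symm, rfl⟩
    · obtain ⟨a1, a2, a3⟩ := hao (i + 1) (by omega)
      obtain ⟨b1, b2, b3⟩ := hbe (m - (i + 1)) (by omega)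
      rw [gn, inv_inv] at b1
      rw [gw, inv_inj] at b2
      have e2 := inv_eq_iff_eq_inv.1 a2.symm
      rw [a3, b3, b1, ← b2, e2, clearedH_odd_even e0 s0 s1, ← q0, add_sub_cancel]
      exact ⟨a1, (inv_inv _).symm, rfl⟩

/-- Both values are multiplied by the same unit. Only this form of the claim passes through the
rules of composition, which are homogeneous in the pair but not in its entries separately. -/
theorem Computes.eq_outcome (hU : -1 ∈ U) {S : Tangle} {φ : S.Pt → K} {v h : K}
    (hc : Computes S φ v h) (hφ : Compatible U S φ) :
    ∃ u ∈ U, v = u * (outcome S φ).1 ∧ h = u * (outcome S φ).2 := by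
  induction hc with
  | reflect _ ih =>
    obtain ⟨u, hu, rfl, rfl⟩ := ih hφ.of_reflect
    obtain ⟨u', hu', h1, h2⟩ := outcome_reflect hU hφ.of_reflect
    refine ⟨u * u', U.mul_mem hu hu', ?_, ?_⟩
    · rw [h1, Units.val_mul, mul_assoc]
    · rw [h2, Units.val_mul, mul_assoc]
  | vert _ _ iha ihb =>
    obtain ⟨u, hu, rfl, rfl⟩ := iha hφ.vert_left
    obtain ⟨u', hu', rfl, rfl⟩ := ihb hφ.vert_right
    refine ⟨u * u', U.mul_mem hu hu', ?_, ?_⟩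
    · simp only [outcome, Units.val_mul]; ring
    · simp only [outcome, clearedV_smul, Units.val_mul]
  | horiz _ _ iha ihb =>
    obtain ⟨u, hu, rfl, rfl⟩ := iha hφ.horiz_left
    obtain ⟨u', hu', rfl, rfl⟩ := ihb hφ.horiz_right
    refine ⟨u * u', U.mul_mem hu hu', ?_, ?_⟩
    · simp only [outcome, clearedH_smul, Units.val_mul]
    · simp only [outcome, Units.val_mul]; ring
  | even hS =>
    obtain ⟨h1, h2, -⟩ := outcome_isInt hS hφ
    refine ⟨1, U.one_mem, ?_, ?_⟩
    · rw [(h2 _ rfl).2.2, Units.val_one, one_mul]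
    · rw [h1, Units.val_one, one_mul]
  | odd hS =>
    obtain ⟨h1, -, h2⟩ := outcome_isInt hS hφ
    refine ⟨1, U.one_mem, ?_, ?_⟩
    · rw [(h2 _ rfl).2.2, Units.val_one, one_mul]
    · rw [h1, Units.val_one, one_mul]

end Outcome

/-! ### Determinants of square systems of equations whose rows are not enumerated by the unknowns -/

section RowDet

variable {L : Type} [Field L] {P J R ι : Type}

open Classical in
/-- The determinant of the system with rows `M j`, the rows being identified with the columns by
means of `e`. -/
noncomputable def rowDet [Finite P] (e : P ≃ J) (M : J → P → L) : L :=
  letI := Fintype.ofFinite P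
  Matrix.det (Matrix.of fun p => M (e p))

theorem rowDet_eq [Fintype P] [DecidableEq P] (e : P ≃ J) (M : J → P → L) :
    rowDet e M = Matrix.det (Matrix.of fun p => M (e p)) := by
  unfold rowDet
  convert rfl

theorem rowDet_comp [Finite P] {J' : Type} (e : P ≃ J) (f : J ≃ J') (M : J' → P → L) :
    rowDet (e.trans f) M = rowDet e (fun j => M (f j)) := rfl

theorem rowDet_reindex {P' : Type} [Finite P] [Finite P'] (g : P ≃ P') (e : P ≃ J)
    (M : J → P' → L) :
    rowDet (g.symm.trans e) M = rowDet e (fun j p => M j (g p)) := by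
  classical
  have := Fintype.ofFinite P
  have := Fintype.ofFinite P'
  rw [rowDet_eq, rowDet_eq, ← Matrix.det_submatrix_equiv_self g]
  congr 1
  ext p q
  simp [Matrix.submatrix]

/-- Another identification of rows and columns changes the determinant at most by a sign. -/
theorem exists_sign_rowDet [Finite P] (e e' : P ≃ J) :
    ∃ s : ℤˣ, ∀ M : J → P → L, rowDet e M = ((s : ℤ) : L) * rowDet e' M := by
  classical
  have := Fintype.ofFinite P
  refine ⟨Equiv.Perm.sign (e.trans e'.symm), fun M => ?_⟩
  rw [rowDet_eq, rowDet_eq, ← Matrix.det_permute]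
  congr 1
  ext p q
  simp [Matrix.submatrix]

theorem elim_update_comp {X : Type} [DecidableEq P] [DecidableEq ι] (e : P ≃ R ⊕ ι)
    (N : R → P → X) (ρ : ι → P → X) (i : ι) (x : P → X) :
    (fun p => Sum.elim N (Function.update ρ i x) (e p)) =
      Function.update (fun p => Sum.elim N ρ (e p)) (e.symm (Sum.inr i)) x := by
  funext p
  by_cases hp : p = e.symm (Sum.inr i)
  · subst hp
    simp
  · rw [Function.update_of_ne hp]
    rcases h : e p with r | j
    · rfl
    · have hj : j ≠ i := by
        rintro rfl
        exact hp (e.eq_symm_apply.2 h)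
      simp [Function.update_of_ne hj]

/-- The determinant as an alternating function of some of the rows. -/
noncomputable def slotDet [Finite P] (e : P ≃ R ⊕ ι) (N : R → P → L) :
    (P → L) [⋀^ι]→ₗ[L] L where
  toFun ρ := rowDet e (Sum.elim N ρ)
  map_update_add' := by
    classical
    have := Fintype.ofFinite P
    intro _ ρ i x y
    simp only [rowDet_eq, elim_update_comp]
    exact Matrix.detRowAlternating.map_update_add _ _ _ _
  map_update_smul' := by
    classical
    have := Fintype.ofFinite P
    intro _ ρ i c x
    simp only [rowDet_eq, elim_update_comp]
    exact Matrix.detRowAlternating.map_update_smul _ _ _ _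
  map_eq_zero_of_eq' := by
    classical
    have := Fintype.ofFinite P
    intro ρ i j h hij
    rw [rowDet_eq]
    refine Matrix.det_zero_of_row_eq (i := e.symm (Sum.inr i)) (j := e.symm (Sum.inr j)) ?_ ?_
    · simpa using hij
    · funext q
      simp [h]

end RowDet

/-! ### Juxtaposition -/

section Juxtaposition

variable {L : Type} [Field L] {P C : Type}

open Classical in
/-- The linear form on `P → L` which is given by a linear form on `C → L`, by means of a map
`C → P`. -/
noncomputable def extend [Fintype C] (en : C → P) : (C → L) →ₗ[L] (P → L) where
  toFun α p := ∑ c, if en c = p then α c else 0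
  map_add' α β := by
    funext p
    rw [Pi.add_apply, ← Finset.sum_add_distrib]
    refine Finset.sum_congr rfl fun c _ => ?_
    split_ifs <;> simp
  map_smul' a α := by
    funext p
    rw [RingHom.id_apply, Pi.smul_apply, smul_eq_mul, Finset.mul_sum]
    refine Finset.sum_congr rfl fun c _ => ?_
    split_ifs <;> simp

open Classical in
theorem extend_apply [Fintype C] (en : C → P) (α : C → L) (p : P) :
    extend en α p = ∑ c, if en c = p then α c else 0 := rfl

theorem sum_extend_mul [Fintype C] [Fintype P] (en : C → P) (α : C → L) (f : P → L) :
    ∑ p, extend en α p * f p = ∑ c, α c * f (en c) := by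
  classical
  simp only [extend_apply, Finset.sum_mul]
  rw [Finset.sum_comm]
  refine Finset.sum_congr rfl fun c _ => ?_
  simp

theorem extend_sumMap {Pa Pb : Type} [Fintype C] (ena : C → Pa) (enb : C → Pb) (ρ : C ⊕ C → L) :
    extend (Sum.map ena enb) ρ =
      Sum.elim (extend ena fun c => ρ (Sum.inl c)) (extend enb fun c => ρ (Sum.inr c)) := by
  classical
  funext p
  rcases p with p | p <;> simp [extend_apply, Fintype.sum_sum_type]

theorem extend_comp {C' : Type} [Fintype C] [Fintype C'] (f : C' → C) (en : C → P) (α : C' → L) :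
    extend (fun c => en (f c)) α = extend en (extend f α) := by
  classical
  funext p
  have h : ∀ c, (if en c = p then extend f α c else 0) =
      ∑ c', if f c' = c then (if en c = p then α c' else 0) else 0 := by
    intro c
    rw [extend_apply]
    split_ifs <;> simp
  rw [extend_apply, extend_apply, Finset.sum_congr rfl fun c _ => h c, Finset.sum_comm]
  simp

/-- Sort the four values with `false` first. If the second one is `false`, so is the first;
otherwise the last three are `true`. -/
theorem exists_perm_slots (b : Fin 2 ⊕ Fin 2 → Bool) : ∃ σ : Equiv.Perm (Fin 2 ⊕ Fin 2),
    (∀ i, b (σ (Sum.inl i)) = false) ∨ (∀ i, b (σ (Sum.inr i)) = true) := by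
  let τ := Tuple.sort fun i : Fin 4 => b (finSumFinEquiv.symm i)
  have hτ : Monotone fun i : Fin 4 => b (finSumFinEquiv.symm (τ i)) :=
    Tuple.monotone_sort fun i : Fin 4 => b (finSumFinEquiv.symm i)
  refine ⟨(finSumFinEquiv.trans τ).trans finSumFinEquiv.symm, ?_⟩
  cases h : b (finSumFinEquiv.symm (τ 1)) with
  | false =>
    left
    intro i
    have hi : (finSumFinEquiv (Sum.inl i : Fin 2 ⊕ Fin 2) : Fin 4) ≤ 1 := by
      fin_cases i <;> decide
    exact Bool.eq_false_of_le_false ((hτ hi).trans h.le)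
  | true =>
    right
    intro i
    have hi : 1 ≤ (finSumFinEquiv (Sum.inr i : Fin 2 ⊕ Fin 2) : Fin 4) := by
      fin_cases i <;> decide
    exact Bool.eq_true_of_true_le (h.ge.trans (hτ hi))

variable {Pa Pb Ra Rb : Type} [Fintype C]

/-- The rows of two systems of equations in different unknowns. -/
def sumRows (A : Ra → Pa → L) (B : Rb → Pb → L) : Ra ⊕ Rb → Pa ⊕ Pb → L :=
  Sum.elim (fun r => Sum.elim (A r) 0) (fun r => Sum.elim 0 (B r))

def sumSlots (ea : Pa ≃ Ra ⊕ Fin 2) (eb : Pb ≃ Rb ⊕ Fin 2) :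
    Pa ⊕ Pb ≃ (Ra ⊕ Rb) ⊕ (Fin 2 ⊕ Fin 2) :=
  (Equiv.sumCongr ea eb).trans (Equiv.sumSumSumComm _ _ _ _)

/-- The equations of the two systems are block diagonal, so the hypothesis on the additional rows
makes the whole matrix block triangular. -/
theorem rowDet_sum [Finite Pa] [Finite Pb] (ea : Pa ≃ Ra ⊕ Fin 2) (eb : Pb ≃ Rb ⊕ Fin 2)
    (A : Ra → Pa → L) (B : Rb → Pb → L) (ρ : Fin 2 ⊕ Fin 2 → Pa ⊕ Pb → L)
    (h : (∀ i p, ρ (Sum.inl i) (Sum.inr p) = 0) ∨ (∀ i p, ρ (Sum.inr i) (Sum.inl p) = 0)) :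
    rowDet (sumSlots ea eb) (Sum.elim (sumRows A B) ρ) =
      rowDet ea (Sum.elim A fun i p => ρ (Sum.inl i) (Sum.inl p)) *
        rowDet eb (Sum.elim B fun i p => ρ (Sum.inr i) (Sum.inr p)) := by
  classical
  have := Fintype.ofFinite Pa
  have := Fintype.ofFinite Pb
  rw [rowDet_eq, rowDet_eq, rowDet_eq]
  rcases h with h | h
  · rw [← Matrix.det_fromBlocks_zero₁₂ _ (Matrix.of fun p q => Sum.elim (sumRows A B) ρ
      (sumSlots ea eb (Sum.inr p)) (Sum.inl q))]
    congr 1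
    ext p q
    rcases p with p | p <;> rcases q with q | q
    · rcases hp : ea p with r | r <;> simp [sumSlots, hp, sumRows]
    · rcases hp : ea p with r | r <;> simp [sumSlots, hp, sumRows, h]
    · rfl
    · rcases hp : eb p with r | r <;> simp [sumSlots, hp, sumRows]
  · rw [← Matrix.det_fromBlocks_zero₂₁ _ (Matrix.of fun p q => Sum.elim (sumRows A B) ρ
      (sumSlots ea eb (Sum.inl p)) (Sum.inr q))]
    congr 1
    ext p q
    rcases p with p | p <;> rcases q with q | q
    · rcases hp : ea p with r | r <;> simp [sumSlots, hp, sumRows]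
    · rfl
    · rcases hp : eb p with r | r <;> simp [sumSlots, hp, sumRows, h]
    · rcases hp : eb p with r | r <;> simp [sumSlots, hp, sumRows]

/-- If two systems have determinants `c ⟨ρ_i, k_j⟩` as functions of two additional equations `ρ_i`
between the unknowns in `C`, then the same is true of their union and four additional equations
between the unknowns in `C ⊕ C`. -/
theorem rowDet_juxtapose [Finite Pa] [Finite Pb] {ea : Pa ≃ Ra ⊕ Fin 2} {eb : Pb ≃ Rb ⊕ Fin 2}
    {A : Ra → Pa → L} {B : Rb → Pb → L} {ena : C → Pa} {enb : C → Pb}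
    {ka kb : Matrix (Fin 2) C L} {ca cb : L}
    (ha : ∀ x : Fin 2 → C → L, rowDet ea (Sum.elim A fun i => extend ena (x i)) =
      ca * Matrix.det (Matrix.of fun i => ka.mulVec (x i)))
    (hb : ∀ x : Fin 2 → C → L, rowDet eb (Sum.elim B fun i => extend enb (x i)) =
      cb * Matrix.det (Matrix.of fun i => kb.mulVec (x i)))
    (ρ : Fin 2 ⊕ Fin 2 → C ⊕ C → L) :
    rowDet (sumSlots ea eb) (Sum.elim (sumRows A B) fun i => extend (Sum.map ena enb) (ρ i)) =
      ca * cb * Matrix.det (Matrix.of fun i => (Matrix.fromBlocks ka 0 0 kb).mulVec (ρ i)) := by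
  classical
  let F : (C ⊕ C → L) [⋀^Fin 2 ⊕ Fin 2]→ₗ[L] L :=
    (slotDet (sumSlots ea eb) (sumRows A B)).compLinearMap (extend (Sum.map ena enb))
  let G : (C ⊕ C → L) [⋀^Fin 2 ⊕ Fin 2]→ₗ[L] L :=
    (ca * cb) • (Matrix.detRowAlternating (R := L)).compLinearMap
      (Matrix.mulVecLin (Matrix.fromBlocks ka 0 0 kb))
  -- Both sides are alternating in `ρ`, so it is enough to compare them on basis vectors.
  suffices h : F = G from congrArg (fun H => H ρ) h
  have key : ∀ ρ : Fin 2 ⊕ Fin 2 → C ⊕ C → L,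
      ((∀ i c, ρ (Sum.inl i) (Sum.inr c) = 0) ∨ (∀ i c, ρ (Sum.inr i) (Sum.inl c) = 0)) →
        F ρ = G ρ := by
    intro ρ h
    have hF : F ρ = rowDet (sumSlots ea eb) (Sum.elim (sumRows A B)
      fun i => extend (Sum.map ena enb) (ρ i)) := rfl
    have hG : G ρ = ca * cb *
      Matrix.det (Matrix.of fun i => (Matrix.fromBlocks ka 0 0 kb).mulVec (ρ i)) := rfl
    rw [hF, hG, rowDet_sum]
    · simp only [extend_sumMap, Sum.elim_inl, Sum.elim_inr]
      rw [ha, hb, mul_mul_mul_comm]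
      congr 1
      rcases h with h | h
      · rw [← Matrix.det_fromBlocks_zero₁₂ _ (Matrix.of fun i j =>
          (Matrix.fromBlocks ka 0 0 kb).mulVec (ρ (Sum.inr i)) (Sum.inl j))]
        congr 1
        ext p q
        rcases p with p | p <;> rcases q with q | q <;>
          simp [Matrix.mulVec, dotProduct, Fintype.sum_sum_type, h]
      · rw [← Matrix.det_fromBlocks_zero₂₁ _ (Matrix.of fun i j =>
          (Matrix.fromBlocks ka 0 0 kb).mulVec (ρ (Sum.inl i)) (Sum.inr j))]
        congr 1
        ext p q
        rcases p with p | p <;> rcases q with q | q <;>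
          simp [Matrix.mulVec, dotProduct, Fintype.sum_sum_type, h]
    · refine h.imp (fun h i p => ?_) (fun h i p => ?_)
      · simp [extend_apply, h]
      · simp [extend_apply, h]
  refine Module.Basis.ext_alternating (Pi.basisFun L (C ⊕ C)) fun v _ => ?_
  -- A basis vector lives on the left or on the right. After a permutation of the slots, which
  -- changes both sides by the same sign, the block triangular case `key` applies.
  obtain ⟨σ, hσ⟩ := exists_perm_slots fun i => (v i).isRight
  have h := key (fun i => Pi.basisFun L (C ⊕ C) (v (σ i))) (hσ.imp (fun h i c => ?_) fun h i c => ?_)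
  · have hF := F.map_perm (fun i => Pi.basisFun L (C ⊕ C) (v i)) σ
    have hG := G.map_perm (fun i => Pi.basisFun L (C ⊕ C) (v i)) σ
    simp only [Function.comp_def] at hF hG
    rw [hF, hG] at h
    exact smul_left_cancel _ h
  · have := h i
    rcases hv : v (σ (Sum.inl i)) with d | d
    · simp
    · simp [hv] at this
  · have := h i
    rcases hv : v (σ (Sum.inr i)) with d | d
    · simp [hv] at this
    · simp

end Juxtaposition

/-! ### The strands and gluings of a tangle -/

instance : DecidableEq Corner := fun a b => by
  cases a <;> cases b <;> first | exact isTrue rfl | exact isFalse (fun h => by cases h)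

instance : Fintype Corner where
  elems := {Corner.nw, Corner.ne, Corner.sw, Corner.se}
  complete c := by cases c <;> simp

theorem Corner.sum_univ {M : Type} [AddCommMonoid M] (f : Corner → M) :
    ∑ c, f c = f .nw + f .ne + f .sw + f .se := by
  change ∑ c ∈ ({Corner.nw, Corner.ne, Corner.sw, Corner.se} : Finset Corner), f c = _
  rw [Finset.sum_insert (by decide), Finset.sum_insert (by decide), Finset.sum_insert (by decide),
    Finset.sum_singleton, add_assoc, add_assoc]

namespace Tangle

theorem finite_pt : ∀ S : Tangle, Finite S.Pt
  | zero | infty | one | negOne => inferInstanceAs (Finite Corner)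
  | vert a b | horiz a b =>
    have := finite_pt a
    have := finite_pt b
    inferInstanceAs (Finite (a.Pt ⊕ b.Pt))

instance (S : Tangle) : Finite S.Pt := finite_pt S

/-- The index set of the equations between two ends of pieces: one for every strand of a piece
which is not an under-strand, and one for every pair of glued ends. -/
def Plumb : Tangle → Type
  | zero => Fin 2
  | infty => Fin 2
  | one => Unit
  | negOne => Unit
  | vert a b => (a.Plumb ⊕ b.Plumb) ⊕ Fin 2
  | horiz a b => (a.Plumb ⊕ b.Plumb) ⊕ Fin 2

/-- The first of the two ends that belong to an element of `Plumb`. -/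
def plumbFst : (S : Tangle) → S.Plumb → S.Pt
  | zero, i => ![Corner.nw, Corner.se] i
  | infty, i => ![Corner.nw, Corner.ne] i
  | one, _ => Corner.nw
  | negOne, _ => Corner.ne
  | vert a _, Sum.inl (Sum.inl y) => Sum.inl (a.plumbFst y)
  | vert _ b, Sum.inl (Sum.inr y) => Sum.inr (b.plumbFst y)
  | vert _ b, Sum.inr i => Sum.inr (b.ends (![Corner.nw, Corner.ne] i))
  | horiz a _, Sum.inl (Sum.inl y) => Sum.inl (a.plumbFst y)
  | horiz _ b, Sum.inl (Sum.inr y) => Sum.inr (b.plumbFst y)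
  | horiz _ b, Sum.inr i => Sum.inr (b.ends (![Corner.nw, Corner.sw] i))

/-- The second of the two ends that belong to an element of `Plumb`. -/
def plumbSnd : (S : Tangle) → S.Plumb → S.Pt
  | zero, i => ![Corner.ne, Corner.sw] i
  | infty, i => ![Corner.sw, Corner.se] i
  | one, _ => Corner.se
  | negOne, _ => Corner.sw
  | vert a _, Sum.inl (Sum.inl y) => Sum.inl (a.plumbSnd y)
  | vert _ b, Sum.inl (Sum.inr y) => Sum.inr (b.plumbSnd y)
  | vert a _, Sum.inr i => Sum.inl (a.ends (![Corner.sw, Corner.se] i))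
  | horiz a _, Sum.inl (Sum.inl y) => Sum.inl (a.plumbSnd y)
  | horiz _ b, Sum.inl (Sum.inr y) => Sum.inr (b.plumbSnd y)
  | horiz a _, Sum.inr i => Sum.inl (a.ends (![Corner.ne, Corner.se] i))

end Tangle

/-! ### The linear equations of a tangle, and how they behave under composition -/

section Rows

variable {L : Type} [Field L]

open Classical in
/-- The equation `f p + t f q = 0`. -/
noncomputable def pairRow {P : Type} (p q : P) (t : L) : P → L := Pi.single p 1 + Pi.single q t

theorem pairRow_inl {P Q : Type} (p q : P) (t : L) :
    (pairRow (Sum.inl p) (Sum.inl q) t : P ⊕ Q → L) = Sum.elim (pairRow p q t) 0 := by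
  classical
  funext x
  rcases x with x | x <;> simp [pairRow, Pi.single_apply]

theorem pairRow_inr {P Q : Type} (p q : Q) (t : L) :
    (pairRow (Sum.inr p) (Sum.inr q) t : P ⊕ Q → L) = Sum.elim (0 : P → L) (pairRow p q t) := by
  classical
  funext x
  rcases x with x | x <;> simp [pairRow, Pi.single_apply]

theorem extend_pairRow {P C : Type} [Fintype C] (en : C → P) (c d : C) (t : L) :
    extend en (pairRow c d t) = pairRow (en c) (en d) t := by
  classical
  funext p
  simp only [extend_apply, pairRow, Pi.add_apply, Pi.single_apply]
  have h : ∀ x, (if en x = p then ((if x = c then 1 else 0) + if x = d then t else 0) else 0) =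
      (if x = c then (if p = en c then 1 else 0) else 0) +
        (if x = d then (if p = en d then t else 0) else 0) := by
    intro x
    by_cases hc : x = c <;> by_cases hd : x = d <;> by_cases hp : en x = p <;>
      simp_all [eq_comm]
  rw [Finset.sum_congr rfl fun x _ => h x, Finset.sum_add_distrib]
  simp

theorem extend_inl {P Q C : Type} [Fintype C] (en : C → P) (α : C → L) :
    (extend (fun c => (Sum.inl (en c) : P ⊕ Q)) α) = Sum.elim (extend en α) 0 := by
  classical
  funext p
  rcases p with p | p <;> simp [extend_apply]

theorem extend_inr {P Q C : Type} [Fintype C] (en : C → Q) (α : C → L) :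
    (extend (fun c => (Sum.inr (en c) : P ⊕ Q)) α) = Sum.elim (0 : P → L) (extend en α) := by
  classical
  funext p
  rcases p with p | p <;> simp [extend_apply]

/-- The coefficients of the equation of the under-strand at a crossing. -/
def crossCoeff (isOne : Bool) (t : Corner → L) : Corner → L
  | .nw => if isOne then 1 - t .ne else 1
  | .ne => if isOne then t .nw else t .nw - 1
  | .sw => if isOne then t .ne else 0
  | .se => if isOne then 0 else t .nw * t .ne

/-- The equations of a tangle, in terms of the Fox derivatives with respect to the outward arcs. -/
noncomputable def tangleRows (S : Tangle) (φ : S.Pt → L) : S.Crossing ⊕ S.Plumb → S.Pt → L :=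
  Sum.elim
    (fun c => extend (S.crossingPt c) (crossCoeff (S.isOne c) fun d => φ (S.crossingPt c d)))
    (fun y => pairRow (S.plumbFst y) (S.plumbSnd y) (φ (S.plumbFst y)))

/-- Rearrangement of the rows of a composite tangle. -/
def arrange (Ca Ya Cb Yb : Type) :
    ((Ca ⊕ Ya) ⊕ (Cb ⊕ Yb)) ⊕ (Fin 2 ⊕ Fin 2) ≃
      ((Ca ⊕ Cb) ⊕ ((Ya ⊕ Yb) ⊕ Fin 2)) ⊕ Fin 2 where
  toFun
    | .inl (.inl (.inl c)) => .inl (.inl (.inl c))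
    | .inl (.inl (.inr y)) => .inl (.inr (.inl (.inl y)))
    | .inl (.inr (.inl c)) => .inl (.inl (.inr c))
    | .inl (.inr (.inr y)) => .inl (.inr (.inl (.inr y)))
    | .inr (.inl i) => .inr i
    | .inr (.inr i) => .inl (.inr (.inr i))
  invFun
    | .inl (.inl (.inl c)) => .inl (.inl (.inl c))
    | .inl (.inr (.inl (.inl y))) => .inl (.inl (.inr y))
    | .inl (.inl (.inr c)) => .inl (.inr (.inl c))
    | .inl (.inr (.inl (.inr y))) => .inl (.inr (.inr y))
    | .inr i => .inr (.inl i)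
    | .inl (.inr (.inr i)) => .inr (.inr i)
  left_inv := by rintro (((_ | _) | (_ | _)) | (_ | _)) <;> rfl
  right_inv := by rintro (((_ | _) | ((_ | _) | _)) | _) <;> rfl

/-- The positions of the ends of `a ∗ b` among those of `a` and `b`. -/
def vertEmb : Corner → Corner ⊕ Corner
  | .nw => .inl .nw
  | .ne => .inl .ne
  | .sw => .inr .sw
  | .se => .inr .se

/-- The positions of the ends of `a + b` among those of `a` and `b`. -/
def horizEmb : Corner → Corner ⊕ Corner
  | .nw => .inl .nw
  | .ne => .inr .ne
  | .sw => .inl .sw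
  | .se => .inr .se

theorem Tangle.ends_vert (a b : Tangle) (c : Corner) :
    (Tangle.vert a b).ends c = Sum.map a.ends b.ends (vertEmb c) := by cases c <;> rfl

theorem Tangle.ends_horiz (a b : Tangle) (c : Corner) :
    (Tangle.horiz a b).ends c = Sum.map a.ends b.ends (horizEmb c) := by cases c <;> rfl

/-- The four additional equations between the ends of `a` and `b` in `a ∗ b`. -/
noncomputable def vertSlots (t : Corner → L) (x : Fin 2 → Corner → L) :
    Fin 2 ⊕ Fin 2 → Corner ⊕ Corner → L :=
  Sum.elim (fun i => extend vertEmb (x i)) fun i =>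
    pairRow (Sum.inr (![Corner.nw, Corner.ne] i)) (Sum.inl (![Corner.sw, Corner.se] i))
      (t (![Corner.nw, Corner.ne] i))

/-- The four additional equations between the ends of `a` and `b` in `a + b`. -/
noncomputable def horizSlots (t : Corner → L) (x : Fin 2 → Corner → L) :
    Fin 2 ⊕ Fin 2 → Corner ⊕ Corner → L :=
  Sum.elim (fun i => extend horizEmb (x i)) fun i =>
    pairRow (Sum.inr (![Corner.nw, Corner.sw] i)) (Sum.inl (![Corner.ne, Corner.se] i))
      (t (![Corner.nw, Corner.sw] i))

/-- Of the four free slots of the juxtaposed tangles, the gluing equations take two; the other two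
are the free slots of the composite. -/
theorem tangleRows_vert (a b : Tangle) (φ : (Tangle.vert a b).Pt → L) (x : Fin 2 → Corner → L)
    (j : ((a.Crossing ⊕ a.Plumb) ⊕ (b.Crossing ⊕ b.Plumb)) ⊕ (Fin 2 ⊕ Fin 2)) :
    (Sum.elim (tangleRows (Tangle.vert a b) φ) (fun i => extend (Tangle.vert a b).ends (x i)) :
      ((a.Crossing ⊕ b.Crossing) ⊕ ((a.Plumb ⊕ b.Plumb) ⊕ Fin 2)) ⊕ Fin 2 → a.Pt ⊕ b.Pt → L)
      (arrange _ _ _ _ j) =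
    Sum.elim (sumRows (tangleRows a fun p => φ (Sum.inl p)) (tangleRows b fun p => φ (Sum.inr p)))
      (fun i => extend (Sum.map a.ends b.ends)
        (vertSlots (fun c => φ (Sum.inr (b.ends c))) x i)) j := by
  rcases j with ((c | y) | (c | y)) | (i | i)
  · exact extend_inl (C := Corner) (a.crossingPt c) _
  · exact pairRow_inl (a.plumbFst y) (a.plumbSnd y) _
  · exact extend_inr (C := Corner) (b.crossingPt c) _
  · exact pairRow_inr (b.plumbFst y) (b.plumbSnd y) _
  · exact (congrArg (fun en => extend en (x i)) (funext (Tangle.ends_vert a b))).trans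
      (extend_comp vertEmb (Sum.map a.ends b.ends) (x i))
  · exact (extend_pairRow (Sum.map a.ends b.ends) (Sum.inr (![Corner.nw, Corner.ne] i))
      (Sum.inl (![Corner.sw, Corner.se] i)) _).symm

theorem tangleRows_horiz (a b : Tangle) (φ : (Tangle.horiz a b).Pt → L) (x : Fin 2 → Corner → L)
    (j : ((a.Crossing ⊕ a.Plumb) ⊕ (b.Crossing ⊕ b.Plumb)) ⊕ (Fin 2 ⊕ Fin 2)) :
    (Sum.elim (tangleRows (Tangle.horiz a b) φ) (fun i => extend (Tangle.horiz a b).ends (x i)) :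
      ((a.Crossing ⊕ b.Crossing) ⊕ ((a.Plumb ⊕ b.Plumb) ⊕ Fin 2)) ⊕ Fin 2 → a.Pt ⊕ b.Pt → L)
      (arrange _ _ _ _ j) =
    Sum.elim (sumRows (tangleRows a fun p => φ (Sum.inl p)) (tangleRows b fun p => φ (Sum.inr p)))
      (fun i => extend (Sum.map a.ends b.ends)
        (horizSlots (fun c => φ (Sum.inr (b.ends c))) x i)) j := by
  rcases j with ((c | y) | (c | y)) | (i | i)
  · exact extend_inl (C := Corner) (a.crossingPt c) _
  · exact pairRow_inl (a.plumbFst y) (a.plumbSnd y) _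
  · exact extend_inr (C := Corner) (b.crossingPt c) _
  · exact pairRow_inr (b.plumbFst y) (b.plumbSnd y) _
  · exact (congrArg (fun en => extend en (x i)) (funext (Tangle.ends_horiz a b))).trans
      (extend_comp horizEmb (Sum.map a.ends b.ends) (x i))
  · exact (extend_pairRow (Sum.map a.ends b.ends) (Sum.inr (![Corner.nw, Corner.sw] i))
      (Sum.inl (![Corner.ne, Corner.se] i)) _).symm

/-- Laplace expansion along the first two of four rows. -/
theorem det_two_add_two (M : Matrix (Fin 2 ⊕ Fin 2) (Fin 2 ⊕ Fin 2) L) :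
    M.det =
      (M (.inl 0) (.inl 0) * M (.inl 1) (.inl 1) - M (.inl 0) (.inl 1) * M (.inl 1) (.inl 0)) *
        (M (.inr 0) (.inr 0) * M (.inr 1) (.inr 1) - M (.inr 0) (.inr 1) * M (.inr 1) (.inr 0)) -
      (M (.inl 0) (.inl 0) * M (.inl 1) (.inr 0) - M (.inl 0) (.inr 0) * M (.inl 1) (.inl 0)) *
        (M (.inr 0) (.inl 1) * M (.inr 1) (.inr 1) - M (.inr 0) (.inr 1) * M (.inr 1) (.inl 1)) +
      (M (.inl 0) (.inl 0) * M (.inl 1) (.inr 1) - M (.inl 0) (.inr 1) * M (.inl 1) (.inl 0)) *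
        (M (.inr 0) (.inl 1) * M (.inr 1) (.inr 0) - M (.inr 0) (.inr 0) * M (.inr 1) (.inl 1)) +
      (M (.inl 0) (.inl 1) * M (.inl 1) (.inr 0) - M (.inl 0) (.inr 0) * M (.inl 1) (.inl 1)) *
        (M (.inr 0) (.inl 0) * M (.inr 1) (.inr 1) - M (.inr 0) (.inr 1) * M (.inr 1) (.inl 0)) -
      (M (.inl 0) (.inl 1) * M (.inl 1) (.inr 1) - M (.inl 0) (.inr 1) * M (.inl 1) (.inl 1)) *
        (M (.inr 0) (.inl 0) * M (.inr 1) (.inr 0) - M (.inr 0) (.inr 0) * M (.inr 1) (.inl 0)) +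
      (M (.inl 0) (.inr 0) * M (.inl 1) (.inr 1) - M (.inl 0) (.inr 1) * M (.inl 1) (.inr 0)) *
        (M (.inr 0) (.inl 0) * M (.inr 1) (.inl 1) - M (.inr 0) (.inl 1) * M (.inr 1) (.inl 0)) := by
  have e0 : (finSumFinEquiv (m := 2) (n := 2)).symm 0 = .inl 0 := rfl
  have e1 : (finSumFinEquiv (m := 2) (n := 2)).symm 1 = .inl 1 := rfl
  have e2 : (finSumFinEquiv (m := 2) (n := 2)).symm 2 = .inr 0 := rfl
  have e3 : (finSumFinEquiv (m := 2) (n := 2)).symm 3 = .inr 1 := rfl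
  rw [← Matrix.det_submatrix_equiv_self finSumFinEquiv.symm M]
  simp [-Matrix.det_submatrix_equiv_self, Matrix.det_succ_row_zero, Fin.sum_univ_succ, Fin.succAbove, e0, e1, e2, e3]
  ring

/-- The vector of the trivial solution. -/
def trivialVec (t : Corner → L) : Corner → L := fun c => 1 - t c

/-- The vector of a non-trivial solution which vanishes at the NW end. -/
def outcomeVec (t : Corner → L) (z : L × L) : Corner → L
  | .nw => 0
  | .ne => t .ne * z.1 / (1 - t .nw)
  | .se => (-z.1 + t .se * t .ne * (1 - t .sw) / (1 - t .ne) * z.2) / (1 - t .nw)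
  | .sw => -(t .ne * (1 - t .sw) / (1 - t .ne) * z.2) / (1 - t .nw)

/-- Two solutions, as functionals on the equations between the ends. -/
def solutions (t : Corner → L) (z : L × L) : Matrix (Fin 2) Corner L :=
  Matrix.of ![trivialVec t, outcomeVec t z]

/-- This is the rule for `∗` in terms of determinants: imposing the two gluings on the solutions of
`a` and `b` leaves the two solutions that belong to the composite. The factor is a unit. -/
theorem det_vertSlots {ta tb t : Corner → L} {za zb : L × L} (x : Fin 2 → Corner → L)
    (pa : ta .nw * ta .ne * ta .se * ta .sw = 1) (pb : tb .nw * tb .ne * tb .se * tb .sw = 1)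
    (hnw : tb .nw = (ta .sw)⁻¹) (hne : tb .ne = (ta .se)⁻¹)
    (t1 : t .nw = ta .nw) (t2 : t .ne = ta .ne) (t3 : t .sw = tb .sw) (t4 : t .se = tb .se)
    (ha : ∀ c, ta c ≠ 1) :
    Matrix.det (Matrix.of fun i => (Matrix.fromBlocks (solutions ta za) 0 0
      (solutions tb zb)).mulVec (vertSlots tb x i)) =
    tb .ne * Matrix.det (Matrix.of fun i => (solutions t (za.1 * zb.1,
      clearedV (ta .ne) (ta .se) (ta .sw) za.1 za.2 zb.1 zb.2)).mulVec (x i)) := by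
  rw [det_two_add_two, Matrix.det_fin_two]
  simp [Matrix.mulVec, dotProduct, Fintype.sum_sum_type, Corner.sum_univ, vertSlots, pairRow,
    Pi.single_apply, extend_apply, vertEmb, solutions, trivialVec, outcomeVec]
  have za1 := ha .ne
  have za2 := ha .nw
  have za3 := ha .sw
  have za4 := ha .se
  rw [t1, t2, t3, t4]
  generalize x 0 .nw = x1, x 0 .ne = x2, x 0 .sw = x3, x 0 .se = x4, x 1 .nw = y1, x 1 .ne = y2,
    x 1 .sw = y3, x 1 .se = y4, za.1 = v, za.2 = h, zb.1 = v', zb.2 = h', ta .nw = n, ta .ne = e,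
    ta .se = s, ta .sw = w, tb .nw = n', tb .ne = e', tb .se = s', tb .sw = w' at *
  subst hnw hne
  have w0 : w ≠ 0 := by rintro rfl; simp at pa
  have s0 : s ≠ 0 := by rintro rfl; simp at pa
  have e0 : e ≠ 0 := by rintro rfl; simp at pa
  have w0' : w' ≠ 0 := by rintro rfl; simp at pb
  -- The labels at the four ends of each tangle have product `1`; this removes the NW label of `a`
  -- and the SE label of `b` and leaves a rational identity in independent quantities.
  obtain rfl : n = 1 / (e * s * w) := by field_simp; linear_combination pa
  obtain rfl : s' = w * s / w' := by field_simp at pb ⊢; linear_combination pb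
  clear pa pb
  have d1 : e - 1 ≠ 0 := sub_ne_zero.2 za1
  have d2 : e * s * w - 1 ≠ 0 := by
    intro h; apply za2; rw [sub_eq_zero.1 h]; simp
  have d3 : w - 1 ≠ 0 := sub_ne_zero.2 za3
  have d4 : s - 1 ≠ 0 := sub_ne_zero.2 za4
  have q1 : 1 - e = -(e - 1) := by ring
  have q2 : 1 - 1 / (e * s * w) = (e * s * w - 1) / (e * s * w) := by field_simp
  have q3 : 1 - w⁻¹ = (w - 1) / w := by field_simp
  have q4 : 1 - s⁻¹ = (s - 1) / s := by field_simp
  have q5 : 1 - s = -(s - 1) := by ring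
  simp only [clearedV, q1, q2, q3, q4, q5]
  field_simp
  ring

/-- This is the rule for `+`. As the SW label of `b` is inverse to the SE label of `a`, the factor
is a unit times `(1 - t_se) / (1 - t_ne)`, with the labels of `a`. It is the reason for introducing
`rootRatio`. -/
theorem det_horizSlots {ta tb t : Corner → L} {za zb : L × L} (x : Fin 2 → Corner → L)
    (pa : ta .nw * ta .ne * ta .se * ta .sw = 1) (pb : tb .nw * tb .ne * tb .se * tb .sw = 1)
    (hnw : tb .nw = (ta .ne)⁻¹) (hsw : tb .sw = (ta .se)⁻¹)
    (t1 : t .nw = ta .nw) (t2 : t .ne = tb .ne) (t3 : t .sw = ta .sw) (t4 : t .se = tb .se)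
    (ha : ∀ c, ta c ≠ 1) (hb : tb .ne ≠ 1) :
    Matrix.det (Matrix.of fun i => (Matrix.fromBlocks (solutions ta za) 0 0
      (solutions tb zb)).mulVec (horizSlots tb x i)) =
    -(ta .ne * (1 - tb .sw) / (1 - ta .ne)) * Matrix.det (Matrix.of fun i => (solutions t
      (clearedH (ta .ne) (ta .se) (ta .sw) za.1 za.2 zb.1 zb.2, za.2 * zb.2)).mulVec (x i)) := by
  rw [det_two_add_two, Matrix.det_fin_two]
  simp [Matrix.mulVec, dotProduct, Fintype.sum_sum_type, Corner.sum_univ, horizSlots, pairRow,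
    Pi.single_apply, extend_apply, horizEmb, solutions, trivialVec, outcomeVec]
  have za1 := ha .ne
  have za2 := ha .nw
  have za4 := ha .se
  rw [t1, t2, t3, t4]
  generalize x 0 .nw = x1, x 0 .ne = x2, x 0 .sw = x3, x 0 .se = x4, x 1 .nw = y1, x 1 .ne = y2,
    x 1 .sw = y3, x 1 .se = y4, za.1 = v, za.2 = h, zb.1 = v', zb.2 = h', ta .nw = n, ta .ne = e,
    ta .se = s, ta .sw = w, tb .nw = n', tb .ne = e', tb .se = s', tb .sw = w' at *
  subst hnw hsw
  have w0 : w ≠ 0 := by rintro rfl; simp at pa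
  have s0 : s ≠ 0 := by rintro rfl; simp at pa
  have e0 : e ≠ 0 := by rintro rfl; simp at pa
  have e0' : e' ≠ 0 := by rintro rfl; simp at pb
  obtain rfl : n = 1 / (e * s * w) := by field_simp; linear_combination pa
  obtain rfl : s' = e * s / e' := by field_simp at pb ⊢; linear_combination pb
  clear pa pb
  have d1 : e - 1 ≠ 0 := sub_ne_zero.2 za1
  have d2 : e * s * w - 1 ≠ 0 := by
    intro h; apply za2; rw [sub_eq_zero.1 h]; simp
  have d3 : e' - 1 ≠ 0 := sub_ne_zero.2 hb
  have d4 : s - 1 ≠ 0 := sub_ne_zero.2 za4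
  have q1 : 1 - e = -(e - 1) := by ring
  have q2 : 1 - 1 / (e * s * w) = (e * s * w - 1) / (e * s * w) := by field_simp
  have q3 : 1 - e⁻¹ = (e - 1) / e := by field_simp
  have q4 : 1 - s⁻¹ = (s - 1) / s := by field_simp
  have q5 : 1 - s = -(s - 1) := by ring
  have q6 : 1 - e' = -(e' - 1) := by ring
  simp only [clearedH, q1, q2, q3, q4, q5, q6]
  field_simp
  ring

end Rows

/-! ### The determinant of a tangle, by induction on the decomposition -/

section Form

variable {L : Type} [Field L]

/-- Square roots of the numbers `1 - φ p`, up to units, which agree on the ends of the same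
component. -/
structure IsRoot (U : Subgroup Lˣ) (S : Tangle) (φ r : S.Pt → L) : Prop where
  sq : ∀ p, ∃ c, UnitOf U c ∧ r p ^ 2 = c * (1 - φ p)
  mate : ∀ p, r (S.mate p) = r p
  glued : ∀ p q, S.Glued p q → r q = r p

variable {U : Subgroup Lˣ}

theorem IsRoot.ne_zero {S : Tangle} {φ r : S.Pt → L} (h : IsRoot U S φ r)
    (hφ : Compatible U S φ) (p : S.Pt) : r p ≠ 0 := by
  obtain ⟨c, hc, e⟩ := h.sq p
  intro h0
  rw [h0] at e
  have := mul_ne_zero hc.ne_zero (sub_ne_zero.2 (hφ.ne_one p).symm)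
  exact this (by rw [← e]; simp)

theorem IsRoot.vert_left {a b : Tangle} {φ r : (Tangle.vert a b).Pt → L}
    (h : IsRoot U (Tangle.vert a b) φ r) :
    IsRoot U a (fun p => φ (Sum.inl p)) fun p => r (Sum.inl p) :=
  ⟨fun _ => h.sq _, fun p => h.mate (Sum.inl p), fun p q hg => h.glued (Sum.inl p) (Sum.inl q) hg⟩

theorem IsRoot.vert_right {a b : Tangle} {φ r : (Tangle.vert a b).Pt → L}
    (h : IsRoot U (Tangle.vert a b) φ r) :
    IsRoot U b (fun p => φ (Sum.inr p)) fun p => r (Sum.inr p) :=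
  ⟨fun _ => h.sq _, fun p => h.mate (Sum.inr p), fun p q hg => h.glued (Sum.inr p) (Sum.inr q) hg⟩

theorem IsRoot.horiz_left {a b : Tangle} {φ r : (Tangle.horiz a b).Pt → L}
    (h : IsRoot U (Tangle.horiz a b) φ r) :
    IsRoot U a (fun p => φ (Sum.inl p)) fun p => r (Sum.inl p) :=
  ⟨fun _ => h.sq _, fun p => h.mate (Sum.inl p), fun p q hg => h.glued (Sum.inl p) (Sum.inl q) hg⟩

theorem IsRoot.horiz_right {a b : Tangle} {φ r : (Tangle.horiz a b).Pt → L}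
    (h : IsRoot U (Tangle.horiz a b) φ r) :
    IsRoot U b (fun p => φ (Sum.inr p)) fun p => r (Sum.inr p) :=
  ⟨fun _ => h.sq _, fun p => h.mate (Sum.inr p), fun p q hg => h.glued (Sum.inr p) (Sum.inr q) hg⟩

theorem extend_id {C : Type} [Fintype C] (α : C → L) : extend (fun c => c) α = α := by
  classical
  funext p
  simp [extend_apply]

/-- An enumeration of the four ends. -/
def cornerEquiv : Corner ≃ Fin 2 ⊕ Fin 2 where
  toFun
    | .nw => .inl 0
    | .ne => .inl 1
    | .sw => .inr 0
    | .se => .inr 1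
  invFun
    | .inl 0 => .nw
    | .inl 1 => .ne
    | .inr 0 => .sw
    | .inr 1 => .se
  left_inv := by rintro (_ | _ | _ | _) <;> rfl
  right_inv := by
    rintro (i | i) <;> fin_cases i <;> rfl

theorem rowDet_corner {J : Type} (f : Fin 2 ≃ J) {N : J → Corner → L} {v w : Corner → L}
    (hv : N (f 0) = v) (hw : N (f 1) = w) (x : Fin 2 → Corner → L) :
    rowDet (cornerEquiv.trans (Equiv.sumCongr f (Equiv.refl _))) (Sum.elim N x) =
      (v .nw * w .ne - v .ne * w .nw) * (x 0 .sw * x 1 .se - x 0 .se * x 1 .sw) -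
      (v .nw * w .sw - v .sw * w .nw) * (x 0 .ne * x 1 .se - x 0 .se * x 1 .ne) +
      (v .nw * w .se - v .se * w .nw) * (x 0 .ne * x 1 .sw - x 0 .sw * x 1 .ne) +
      (v .ne * w .sw - v .sw * w .ne) * (x 0 .nw * x 1 .se - x 0 .se * x 1 .nw) -
      (v .ne * w .se - v .se * w .ne) * (x 0 .nw * x 1 .sw - x 0 .sw * x 1 .nw) +
      (v .sw * w .se - v .se * w .sw) * (x 0 .nw * x 1 .ne - x 0 .ne * x 1 .nw) := by
  rw [rowDet_eq, ← Matrix.det_submatrix_equiv_self cornerEquiv.symm, det_two_add_two]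
  simp only [Matrix.submatrix_apply, Matrix.of_apply, Equiv.trans_apply, Equiv.apply_symm_apply,
    Equiv.sumCongr_apply, Sum.map_inl, Sum.map_inr, Sum.elim_inl, Sum.elim_inr, Equiv.refl_apply,
    hv, hw]
  rfl

/-- The ratio by which the determinants are to be normalized. -/
def rootRatio {S : Tangle} (r : S.Pt → L) : L :=
  r (S.ends .nw) * r (S.ends .ne) / (r (S.ends .se) * r (S.ends .sw))

/-- The system of equations of a tangle has the determinant that is given, up to a unit and the
factor `rootRatio`, by the outcome of the rules. -/
def HasForm (U : Subgroup Lˣ) (S : Tangle) (φ r : S.Pt → L) : Prop :=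
  ∃ (e : S.Pt ≃ (S.Crossing ⊕ S.Plumb) ⊕ Fin 2) (u : L), UnitOf U u ∧ ∀ x : Fin 2 → Corner → L,
    rowDet e (Sum.elim (tangleRows S φ) fun i => extend S.ends (x i)) =
      u * rootRatio r * Matrix.det (Matrix.of fun i =>
        (solutions (fun c => φ (S.ends c)) (outcome S φ)).mulVec (x i))

theorem hasForm_zero (hU : -1 ∈ U) {φ r : Tangle.zero.Pt → L} (hφ : Compatible U Tangle.zero φ)
    (hr : IsRoot U Tangle.zero φ r) : HasForm U Tangle.zero φ r := by
  obtain ⟨c, hc, hc2⟩ := hr.sq Corner.ne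
  obtain ⟨d, hd, hd2⟩ := hr.sq Corner.se
  refine ⟨cornerEquiv.trans (Equiv.sumCongr (Equiv.emptySum Empty (Fin 2)).symm (Equiv.refl _)),
    -(φ Corner.se * (φ Corner.ne ^ 2)⁻¹ * d * c⁻¹), ?_, fun x => ?_⟩
  · rw [pow_two]
    exact ((((hφ.unit _).mul ((hφ.unit _).mul (hφ.unit _)).inv).mul hd).mul hc.inv).neg hU
  have h1 : φ Corner.ne = (φ Corner.nw)⁻¹ := hφ.mate Corner.nw
  have h2 : φ Corner.sw = (φ Corner.se)⁻¹ := hφ.mate Corner.se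
  have r1 : r Corner.ne = r Corner.nw := hr.mate Corner.nw
  have r2 : r Corner.sw = r Corner.se := hr.mate Corner.se
  have k1 := hφ.ne_zero Corner.nw
  have k2 := hφ.ne_zero Corner.se
  have k3 := hφ.ne_one Corner.nw
  have k4 := hφ.ne_one Corner.se
  have c0 := hc.ne_zero
  have d0 := hd.ne_zero
  have hx : (fun i => extend Tangle.zero.ends (x i)) = x := funext fun i => extend_id (C := Corner) _
  -- The strands of `[0]` join NW to NE and SW to SE, so the roots combine to a quotient of squares.
  -- It cancels the factors other than units; `c` and `d` are the units by which the squares differ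
  -- from `1 - φ`.
  have R : rootRatio r = c * (1 - φ Corner.ne) / (d * (1 - φ Corner.se)) := by
    rw [← hc2, ← hd2]
    simp only [rootRatio, Tangle.ends, r1, r2, pow_two]
  rw [hx, R]
  refine (rowDet_corner _ (v := pairRow Corner.nw Corner.ne (φ Corner.nw))
    (w := pairRow Corner.se Corner.sw (φ Corner.se)) rfl rfl x).trans ?_
  rw [Matrix.det_fin_two]
  simp [dotProduct, Corner.sum_univ, pairRow, Tangle.ends,
    solutions, trivialVec, outcomeVec, outcome]
  rw [h1, h2]
  generalize x 0 .nw = x1, x 0 .ne = x2, x 0 .sw = x3, x 0 .se = x4, x 1 .nw = y1, x 1 .ne = y2,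
    x 1 .sw = y3, x 1 .se = y4, φ Corner.nw = n, φ Corner.se = s at *
  have d1 : n - 1 ≠ 0 := sub_ne_zero.2 k3
  have d2 : s - 1 ≠ 0 := sub_ne_zero.2 k4
  have q1 : 1 - n = -(n - 1) := by ring
  have q2 : 1 - s = -(s - 1) := by ring
  have q3 : 1 - n⁻¹ = (n - 1) / n := by field_simp
  have q4 : 1 - s⁻¹ = (s - 1) / s := by field_simp
  simp only [q1, q2, q3, q4]
  field_simp
  ring

/-- The first case occurs for `σ([0])` and for every tangle closed to its denominator, the second
for the two crossings. -/
theorem rootRatio_eq_one {S : Tangle} {φ r : S.Pt → L} (hφ : Compatible U S φ)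
    (hr : IsRoot U S φ r) (h1 : r (S.ends .sw) = r (S.ends .nw) ∧ r (S.ends .se) = r (S.ends .ne) ∨
      r (S.ends .sw) = r (S.ends .ne) ∧ r (S.ends .se) = r (S.ends .nw)) : rootRatio r = 1 := by
  have k1 := hr.ne_zero hφ (S.ends .nw)
  have k2 := hr.ne_zero hφ (S.ends .ne)
  rcases h1 with ⟨h1, h2⟩ | ⟨h1, h2⟩
  · rw [rootRatio, h1, h2, mul_comm, div_self (mul_ne_zero k2 k1)]
  · rw [rootRatio, h1, h2, div_self (mul_ne_zero k1 k2)]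

theorem hasForm_infty {φ r : Tangle.infty.Pt → L}
    (hφ : Compatible U Tangle.infty φ) (hr : IsRoot U Tangle.infty φ r) :
    HasForm U Tangle.infty φ r := by
  refine ⟨cornerEquiv.trans (Equiv.sumCongr (Equiv.emptySum Empty (Fin 2)).symm (Equiv.refl _)),
    φ Corner.nw, hφ.unit _, fun x => ?_⟩
  have h1 : φ Corner.sw = (φ Corner.nw)⁻¹ := hφ.mate Corner.nw
  have h2 : φ Corner.ne = (φ Corner.se)⁻¹ := hφ.mate Corner.se
  have k1 := hφ.ne_zero Corner.nw
  have k2 := hφ.ne_zero Corner.se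
  have k3 := hφ.ne_one Corner.nw
  have k4 := hφ.ne_one Corner.se
  have hx : (fun i => extend Tangle.infty.ends (x i)) = x := funext fun i => extend_id (C := Corner) _
  rw [hx, rootRatio_eq_one hφ hr (Or.inl ⟨hr.mate Corner.nw, hr.mate Corner.ne⟩)]
  refine (rowDet_corner _ (v := pairRow Corner.nw Corner.sw (φ Corner.nw))
    (w := pairRow Corner.ne Corner.se (φ Corner.ne)) rfl rfl x).trans ?_
  rw [Matrix.det_fin_two]
  simp [dotProduct, Corner.sum_univ, pairRow, Tangle.ends,
    solutions, trivialVec, outcomeVec, outcome]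
  rw [h1, h2]
  generalize x 0 .nw = x1, x 0 .ne = x2, x 0 .sw = x3, x 0 .se = x4, x 1 .nw = y1, x 1 .ne = y2,
    x 1 .sw = y3, x 1 .se = y4, φ Corner.nw = n, φ Corner.se = s at *
  have d1 : n - 1 ≠ 0 := sub_ne_zero.2 k3
  have q1 : 1 - n = -(n - 1) := by ring
  have q3 : 1 - n⁻¹ = (n - 1) / n := by field_simp
  simp only [q1, q3]
  field_simp
  ring

/-- The rows of a crossing. -/
def crossingRows : Fin 2 ≃ Unit ⊕ Unit where
  toFun i := ![Sum.inl (), Sum.inr ()] i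
  invFun := Sum.elim (fun _ => 0) (fun _ => 1)
  left_inv i := by fin_cases i <;> rfl
  right_inv := by rintro (_ | _) <;> rfl

theorem hasForm_one (hU : -1 ∈ U) {φ r : Tangle.one.Pt → L}
    (hφ : Compatible U Tangle.one φ) (hr : IsRoot U Tangle.one φ r) :
    HasForm U Tangle.one φ r := by
  refine ⟨cornerEquiv.trans (Equiv.sumCongr crossingRows (Equiv.refl _)),
    -(φ Corner.nw * φ Corner.nw), ((hφ.unit _).mul (hφ.unit _)).neg hU, fun x => ?_⟩
  have h1 : φ Corner.se = (φ Corner.nw)⁻¹ := hφ.mate Corner.nw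
  have h2 : φ Corner.sw = (φ Corner.ne)⁻¹ := hφ.mate Corner.ne
  have k1 := hφ.ne_zero Corner.nw
  have k2 := hφ.ne_zero Corner.ne
  have k3 := hφ.ne_one Corner.nw
  have k4 := hφ.ne_one Corner.ne
  have hx : (fun i => extend Tangle.one.ends (x i)) = x := funext fun i => extend_id (C := Corner) _
  rw [hx, rootRatio_eq_one hφ hr (Or.inr ⟨hr.mate Corner.ne, hr.mate Corner.nw⟩)]
  refine (rowDet_corner _ (v := crossCoeff true φ)
    (w := pairRow Corner.nw Corner.se (φ Corner.nw)) (extend_id (C := Corner) _) rfl x).trans ?_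
  rw [Matrix.det_fin_two]
  simp [dotProduct, Corner.sum_univ, pairRow, crossCoeff, Tangle.ends,
    solutions, trivialVec, outcomeVec, outcome]
  rw [h1, h2]
  generalize x 0 .nw = x1, x 0 .ne = x2, x 0 .sw = x3, x 0 .se = x4, x 1 .nw = y1, x 1 .ne = y2,
    x 1 .sw = y3, x 1 .se = y4, φ Corner.nw = n, φ Corner.ne = e at *
  have d1 : n - 1 ≠ 0 := sub_ne_zero.2 k3
  have d2 : e - 1 ≠ 0 := sub_ne_zero.2 k4
  have q1 : 1 - n = -(n - 1) := by ring
  have q2 : 1 - e = -(e - 1) := by ring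
  have q3 : 1 - n⁻¹ = (n - 1) / n := by field_simp
  have q4 : 1 - e⁻¹ = (e - 1) / e := by field_simp
  simp only [q1, q2, q3, q4]
  field_simp
  ring

theorem hasForm_negOne {φ r : Tangle.negOne.Pt → L}
    (hφ : Compatible U Tangle.negOne φ) (hr : IsRoot U Tangle.negOne φ r) :
    HasForm U Tangle.negOne φ r := by
  refine ⟨cornerEquiv.trans (Equiv.sumCongr crossingRows (Equiv.refl _)),
    φ Corner.nw * φ Corner.ne, (hφ.unit _).mul (hφ.unit _), fun x => ?_⟩
  have h1 : φ Corner.se = (φ Corner.nw)⁻¹ := hφ.mate Corner.nw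
  have h2 : φ Corner.sw = (φ Corner.ne)⁻¹ := hφ.mate Corner.ne
  have k1 := hφ.ne_zero Corner.nw
  have k2 := hφ.ne_zero Corner.ne
  have k3 := hφ.ne_one Corner.nw
  have k4 := hφ.ne_one Corner.ne
  have hx : (fun i => extend Tangle.negOne.ends (x i)) = x := funext fun i => extend_id (C := Corner) _
  rw [hx, rootRatio_eq_one hφ hr (Or.inr ⟨hr.mate Corner.ne, hr.mate Corner.nw⟩)]
  refine (rowDet_corner _ (v := crossCoeff false φ)
    (w := pairRow Corner.ne Corner.sw (φ Corner.ne)) (extend_id (C := Corner) _) rfl x).trans ?_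
  rw [Matrix.det_fin_two]
  simp [dotProduct, Corner.sum_univ, pairRow, crossCoeff, Tangle.ends,
    solutions, trivialVec, outcomeVec, outcome]
  rw [h1, h2]
  generalize x 0 .nw = x1, x 0 .ne = x2, x 0 .sw = x3, x 0 .se = x4, x 1 .nw = y1, x 1 .ne = y2,
    x 1 .sw = y3, x 1 .se = y4, φ Corner.nw = n, φ Corner.ne = e at *
  have d1 : n - 1 ≠ 0 := sub_ne_zero.2 k3
  have d2 : e - 1 ≠ 0 := sub_ne_zero.2 k4
  have q1 : 1 - n = -(n - 1) := by ring
  have q2 : 1 - e = -(e - 1) := by ring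
  have q3 : 1 - n⁻¹ = (n - 1) / n := by field_simp
  have q4 : 1 - e⁻¹ = (e - 1) / e := by field_simp
  simp only [q1, q2, q3, q4]
  field_simp
  ring

theorem hasForm_vert {a b : Tangle} {φ r : (Tangle.vert a b).Pt → L}
    (hφ : Compatible U (Tangle.vert a b) φ) (hr : IsRoot U (Tangle.vert a b) φ r)
    (ha : HasForm U a (fun p => φ (Sum.inl p)) fun p => r (Sum.inl p))
    (hb : HasForm U b (fun p => φ (Sum.inr p)) fun p => r (Sum.inr p)) :
    HasForm U (Tangle.vert a b) φ r := by
  obtain ⟨ea, u, hu, ha⟩ := ha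
  obtain ⟨eb, v, hv, hb⟩ := hb
  refine ⟨(sumSlots ea eb).trans (arrange _ _ _ _), u * v * φ (Sum.inr (b.ends .ne)),
    (hu.mul hv).mul (hφ.unit _), fun x => ?_⟩
  have h1 := rowDet_juxtapose ha hb (vertSlots (fun c => φ (Sum.inr (b.ends c))) x)
  have h2 := det_vertSlots (ta := fun c => φ (Sum.inl (a.ends c)))
    (tb := fun c => φ (Sum.inr (b.ends c))) (za := outcome a fun p => φ (Sum.inl p))
    (zb := outcome b fun p => φ (Sum.inr p)) x hφ.vert_left.prod_ends hφ.vert_right.prod_ends hφ.vert_nw hφ.vert_ne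
    (t := fun c => φ ((Tangle.vert a b).ends c)) rfl rfl rfl rfl fun c => hφ.ne_one _
  refine ((rowDet_comp _ _ _).trans (congrArg _ (funext (tangleRows_vert a b φ x)))).trans
    (h1.trans ((congrArg _ h2).trans ?_))
  have r1 : r (Sum.inr (b.ends .nw)) = r (Sum.inl (a.ends .sw)) :=
    hr.glued (Sum.inl _) (Sum.inr _) (Or.inl ⟨rfl, rfl⟩)
  have r2 : r (Sum.inr (b.ends .ne)) = r (Sum.inl (a.ends .se)) :=
    hr.glued (Sum.inl _) (Sum.inr _) (Or.inr ⟨rfl, rfl⟩)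
  have n1 := hr.ne_zero hφ (Sum.inl (a.ends .sw))
  have n2 := hr.ne_zero hφ (Sum.inl (a.ends .se))
  -- The roots at the glued ends stand in the denominator for `a` and in the numerator for `b`, so
  -- they cancel.
  have R : rootRatio (S := a.vert b) r =
      rootRatio (fun p => r (Sum.inl p)) * rootRatio (fun p => r (Sum.inr p)) := by
    simp only [rootRatio, r1, r2, Tangle.ends]
    rw [div_mul_div_comm, mul_comm (r (Sum.inl (a.ends .sw))) (r (Sum.inl (a.ends .se))),
      mul_comm (_ * _ : L) (r (Sum.inl (a.ends .se)) * r (Sum.inl (a.ends .sw))),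
      mul_div_mul_left _ _ (mul_ne_zero n2 n1)]
  rw [R, outcome]
  ring

theorem hasForm_horiz {a b : Tangle} {φ r : (Tangle.horiz a b).Pt → L}
    (hφ : Compatible U (Tangle.horiz a b) φ) (hr : IsRoot U (Tangle.horiz a b) φ r)
    (ha : HasForm U a (fun p => φ (Sum.inl p)) fun p => r (Sum.inl p))
    (hb : HasForm U b (fun p => φ (Sum.inr p)) fun p => r (Sum.inr p)) :
    HasForm U (Tangle.horiz a b) φ r := by
  obtain ⟨ea, u, hu, ha⟩ := ha
  obtain ⟨eb, v, hv, hb⟩ := hb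
  obtain ⟨c, hc, hc2⟩ := hr.sq (Sum.inl (a.ends .ne))
  obtain ⟨d, hd, hd2⟩ := hr.sq (Sum.inl (a.ends .se))
  refine ⟨(sumSlots ea eb).trans (arrange _ _ _ _), u * v * (φ (Sum.inl (a.ends .ne)) *
    (φ (Sum.inl (a.ends .se)))⁻¹ * c * d⁻¹),
    (hu.mul hv).mul ((((hφ.unit _).mul (hφ.unit _).inv).mul hc).mul hd.inv), fun x => ?_⟩
  have h1 := rowDet_juxtapose ha hb (horizSlots (fun c => φ (Sum.inr (b.ends c))) x)
  have h2 := det_horizSlots (ta := fun c => φ (Sum.inl (a.ends c)))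
    (tb := fun c => φ (Sum.inr (b.ends c))) (za := outcome a fun p => φ (Sum.inl p))
    (zb := outcome b fun p => φ (Sum.inr p)) x hφ.horiz_left.prod_ends hφ.horiz_right.prod_ends hφ.horiz_nw hφ.horiz_sw
    (t := fun c => φ ((Tangle.horiz a b).ends c)) rfl rfl rfl rfl (fun c => hφ.ne_one _)
    (hφ.ne_one _)
  refine ((rowDet_comp _ _ _).trans (congrArg _ (funext (tangleRows_horiz a b φ x)))).trans
    (h1.trans ((congrArg _ h2).trans ?_))
  have r1 : r (Sum.inr (b.ends .nw)) = r (Sum.inl (a.ends .ne)) :=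
    hr.glued (Sum.inl _) (Sum.inr _) (Or.inl ⟨rfl, rfl⟩)
  have r2 : r (Sum.inr (b.ends .sw)) = r (Sum.inl (a.ends .se)) :=
    hr.glued (Sum.inl _) (Sum.inr _) (Or.inr ⟨rfl, rfl⟩)
  have n1 := hr.ne_zero hφ (Sum.inl (a.ends .sw))
  have n2 := hr.ne_zero hφ (Sum.inl (a.ends .se))
  have n3 := hr.ne_zero hφ (Sum.inr (b.ends .ne))
  have n4 := hr.ne_zero hφ (Sum.inr (b.ends .se))
  have k1 := sub_ne_zero.2 (hφ.ne_one (Sum.inl (a.ends .ne))).symm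
  have k2 := sub_ne_zero.2 (hφ.ne_one (Sum.inl (a.ends .se))).symm
  have k3 := hφ.ne_zero (Sum.inl (a.ends .se))
  have c0 := hc.ne_zero
  have d0 := hd.ne_zero
  -- Here each glued pair stands on one side of the fraction in both tangles, so it leaves a square
  -- instead of cancelling.
  have R : rootRatio (fun p => r (Sum.inl p)) * rootRatio (fun p => r (Sum.inr p)) =
      rootRatio (S := a.horiz b) r * (r (Sum.inl (a.ends .ne)) ^ 2 / r (Sum.inl (a.ends .se)) ^ 2) := by
    simp only [rootRatio, r1, r2, Tangle.ends]
    field_simp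
  -- The squares left over turn the factor of `det_horizSlots` into a unit.
  have Q : -(φ (Sum.inl (a.ends .ne)) * (1 - φ (Sum.inr (b.ends .sw))) /
      (1 - φ (Sum.inl (a.ends .ne)))) * (r (Sum.inl (a.ends .ne)) ^ 2 /
      r (Sum.inl (a.ends .se)) ^ 2) = φ (Sum.inl (a.ends .ne)) *
    (φ (Sum.inl (a.ends .se)))⁻¹ * c * d⁻¹ := by
    rw [hc2, hd2, hφ.horiz_sw]
    field_simp
    ring
  have this (D : L) : u * rootRatio (fun p => r (Sum.inl p)) *
      (v * rootRatio (fun p => r (Sum.inr p))) * (-(φ (Sum.inl (a.ends .ne)) *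
        (1 - φ (Sum.inr (b.ends .sw))) / (1 - φ (Sum.inl (a.ends .ne)))) * D) =
      u * v * (φ (Sum.inl (a.ends .ne)) * (φ (Sum.inl (a.ends .se)))⁻¹ * c * d⁻¹) *
        rootRatio (S := a.horiz b) r * D := by
    rw [← Q]
    linear_combination (u * v * -(φ (Sum.inl (a.ends .ne)) * (1 - φ (Sum.inr (b.ends .sw))) /
      (1 - φ (Sum.inl (a.ends .ne)))) * D) * R
  exact this _

/-- The determinant of the equations of a tangle. -/
theorem hasForm (hU : -1 ∈ U) : ∀ {S : Tangle} {φ r : S.Pt → L}, Compatible U S φ →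
    IsRoot U S φ r → HasForm U S φ r
  | .zero, _, _, hφ, hr => hasForm_zero hU hφ hr
  | .infty, _, _, hφ, hr => hasForm_infty hφ hr
  | .one, _, _, hφ, hr => hasForm_one hU hφ hr
  | .negOne, _, _, hφ, hr => hasForm_negOne hφ hr
  | .vert _ _, _, _, hφ, hr => hasForm_vert hφ hr (hasForm hU hφ.vert_left hr.vert_left)
      (hasForm hU hφ.vert_right hr.vert_right)
  | .horiz _ _, _, _, hφ, hr => hasForm_horiz hφ hr (hasForm hU hφ.horiz_left hr.horiz_left)
      (hasForm hU hφ.horiz_right hr.horiz_right)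

end Form

/-! ### Elimination of unknowns along the arcs of a closed curve system -/

/-- Points on a closed one-dimensional complex, every one of which is the initial point `st` and the
terminal point `nx` of exactly one edge, and the components `arc` of what remains when the edges
of `X` are removed. -/
structure Wiring (X Y P A : Type) where
  st : X ⊕ Y ≃ P
  nx : X ⊕ Y ≃ P
  arc : P → A
  arc_surjective : Function.Surjective arc
  arc_nx : ∀ y, arc (nx (Sum.inr y)) = arc (st (Sum.inr y))
  -- The universal property of the quotient by the edges of `Y`, used in place of chains of edges.
  lift : ∀ (Z : Type) (f : P → Z), (∀ y, f (nx (Sum.inr y)) = f (st (Sum.inr y))) →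
    ∀ p q, arc p = arc q → f p = f q

namespace Wiring

variable {X Y P A : Type} (W : Wiring X Y P A)

/-- The components that are circles. -/
abbrev Circle : Type :=
  {a : A // ∀ x, a ≠ W.arc (W.st (Sum.inl x)) ∧ a ≠ W.arc (W.nx (Sum.inl x))}

/-- The point that follows a given point. -/
def next : Equiv.Perm P := W.st.symm.trans W.nx

theorem next_st (j : X ⊕ Y) : W.next (W.st j) = W.nx j := by simp [next]

/-- A point on each component; on those that are not circles it is the last one. -/
noncomputable def base : X ⊕ W.Circle → P :=
  Sum.elim (fun x => W.st (Sum.inl x)) fun a => Function.surjInv W.arc_surjective a.1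

theorem arc_base_inr (a : W.Circle) : W.arc (W.base (Sum.inr a)) = a.1 :=
  Function.surjInv_eq W.arc_surjective a.1

theorem exists_st_inr {p : P} (hp : p ∉ Set.range W.base) : ∃ y, W.st (Sum.inr y) = p := by
  rcases h : W.st.symm p with x | y
  · exact absurd ⟨Sum.inl x, (W.st.symm_apply_eq.1 h).symm⟩ hp
  · exact ⟨y, (W.st.symm_apply_eq.1 h).symm⟩

theorem arc_next {p : P} (hp : p ∉ Set.range W.base) : W.arc (W.next p) = W.arc p := by
  obtain ⟨y, rfl⟩ := W.exists_st_inr hp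
  rw [next_st, arc_nx]

theorem base_injective : Function.Injective W.base := by
  rintro (x | a) (x' | a') h
  · have := W.st.injective h
    rw [this |> Sum.inl.inj]
  · exact absurd ((W.arc_base_inr a').symm.trans (congrArg W.arc h.symm)) (a'.2 x).1
  · exact absurd ((W.arc_base_inr a).symm.trans (congrArg W.arc h)) (a.2 x').1
  · have := congrArg W.arc h
    rw [arc_base_inr, arc_base_inr] at this
    rw [Subtype.ext this]

/-- Suppose that the walk from `p` meets no chosen point. Its orbit is closed under `next` and, by
periodicity, under the inverse of `next`, so it contains the whole component of `p`. No removed edge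
touches this component, which is therefore a circle; but its chosen point lies in the orbit. -/
theorem exists_iterate_mem [Finite P] (p : P) : ∃ k, W.next^[k] p ∈ Set.range W.base := by
  by_contra! hp
  let O : Set P := {q | ∃ k, W.next^[k] p = q}
  have h1 : ∀ q, q ∈ O → W.next q ∈ O := by
    rintro _ ⟨k, rfl⟩
    exact ⟨k + 1, Function.iterate_succ_apply' _ _ _⟩
  have h2 : ∀ q, W.next q ∈ O → q ∈ O := by
    rintro q ⟨k, hk⟩
    obtain ⟨m, hm, hmp⟩ := W.next.injective.mem_periodicPts p
    obtain ⟨m, rfl⟩ : ∃ n, m = n + 1 := ⟨m - 1, by omega⟩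
    refine ⟨k + m, W.next.injective ?_⟩
    rw [← hk, ← Function.iterate_succ_apply' W.next, Nat.succ_eq_add_one, add_assoc,
      Function.iterate_add_apply, hmp.eq]
  have h0 : p ∈ O := ⟨0, rfl⟩
  have h3 : ∀ q ∈ O, q ∉ Set.range W.base := by
    rintro _ ⟨k, rfl⟩
    exact hp k
  have h4 : ∀ q, W.arc p = W.arc q → q ∈ O := by
    intro q hq
    have := W.lift Prop (fun q => q ∈ O) (fun y => by
      rw [← next_st]
      exact propext ⟨h2 _, h1 _⟩) p q hq
    exact this.mp h0
  have h5 : ∀ x, W.arc p ≠ W.arc (W.st (Sum.inl x)) ∧ W.arc p ≠ W.arc (W.nx (Sum.inl x)) := by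
    intro x
    refine ⟨fun h => h3 _ (h4 _ h) ⟨Sum.inl x, rfl⟩, fun h => ?_⟩
    rw [← next_st] at h
    exact h3 _ (h2 _ (h4 _ h)) ⟨Sum.inl x, rfl⟩
  exact h3 _ (h4 _ (W.arc_base_inr ⟨W.arc p, h5⟩).symm) ⟨_, rfl⟩

variable [Finite P]

open Classical in
/-- The number of steps from a point to the next chosen point. -/
noncomputable def height (p : P) : ℕ := Nat.find (W.exists_iterate_mem p)

/-- The chosen point on the component of a given point. -/
noncomputable def rep (p : P) : P := W.next^[W.height p] p

theorem rep_mem (p : P) : W.rep p ∈ Set.range W.base := by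
  classical
  exact Nat.find_spec (W.exists_iterate_mem p)

theorem height_of_mem {p : P} (hp : p ∈ Set.range W.base) : W.height p = 0 := by
  classical
  exact (Nat.find_eq_zero _).2 hp

theorem rep_base (j : X ⊕ W.Circle) : W.rep (W.base j) = W.base j := by
  rw [rep, W.height_of_mem ⟨j, rfl⟩]
  rfl

theorem height_next {p : P} (hp : p ∉ Set.range W.base) :
    W.height p = W.height (W.next p) + 1 := by
  classical
  refine (Nat.find_eq_iff _).2 ⟨?_, fun n hn => ?_⟩
  · rw [Function.iterate_succ_apply]
    exact W.rep_mem (W.next p)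
  · cases n with
    | zero => exact hp
    | succ n =>
      rw [Function.iterate_succ_apply]
      exact Nat.find_min (W.exists_iterate_mem (W.next p)) (Nat.lt_of_succ_lt_succ hn)

theorem rep_next {p : P} (hp : p ∉ Set.range W.base) : W.rep (W.next p) = W.rep p := by
  rw [rep, rep, W.height_next hp, Function.iterate_succ_apply]

theorem arc_rep (p : P) : W.arc (W.rep p) = W.arc p := by
  induction h : W.height p generalizing p with
  | zero => rw [rep, h]; rfl
  | succ n ih =>
    have hp : p ∉ Set.range W.base := fun hp => by rw [W.height_of_mem hp] at h; omega
    rw [W.height_next hp] at h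
    rw [← W.rep_next hp, ih _ (by omega), W.arc_next hp]

/-- It is enough to compare the two points of an edge of `Y`. The only case not covered by
`rep_next` is an edge that starts at the chosen point of a circle: the walk around the circle then
ends at a chosen point of the same circle, and there is only one. -/
theorem rep_eq_of_arc_eq {p q : P} (h : W.arc p = W.arc q) : W.rep p = W.rep q := by
  refine W.lift P W.rep (fun y => ?_) p q h
  rw [← next_st]
  by_cases hy : W.st (Sum.inr y) ∈ Set.range W.base
  · obtain ⟨j, hj⟩ := hy
    have hn : W.arc (W.rep (W.next (W.base j))) = W.arc (W.base j) := by
      rw [arc_rep, hj, next_st, arc_nx]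
    obtain ⟨i, hi⟩ := W.rep_mem (W.next (W.base j))
    rw [← hj, rep_base, ← hi]
    rw [← hi] at hn
    rcases j with x | a
    · exact absurd (W.st.injective hj) Sum.inl_ne_inr
    · rw [arc_base_inr] at hn
      rcases i with x | b
      · exact absurd hn.symm (a.2 x).1
      · rw [arc_base_inr] at hn
        rw [Subtype.ext hn]
  · exact W.rep_next hy

/-- The components are enumerated by the removed edges and the circles. -/
noncomputable def arcEquiv : X ⊕ W.Circle ≃ A :=
  Equiv.ofBijective (fun j => W.arc (W.base j)) <| by
    refine ⟨fun i j h => ?_, fun a => ?_⟩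
    · have := W.rep_eq_of_arc_eq h
      rw [rep_base, rep_base] at this
      exact W.base_injective this
    · obtain ⟨p, rfl⟩ := W.arc_surjective a
      obtain ⟨j, hj⟩ := W.rep_mem p
      exact ⟨j, by simp only [hj, arc_rep]⟩

theorem arcEquiv_apply (j : X ⊕ W.Circle) : W.arcEquiv j = W.arc (W.base j) := rfl

theorem rep_eq_base_iff (p : P) (j : X ⊕ W.Circle) :
    W.rep p = W.base j ↔ W.arc p = W.arcEquiv j := by
  rw [arcEquiv_apply]
  refine ⟨fun h => by rw [← h, arc_rep], fun h => ?_⟩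
  rw [W.rep_eq_of_arc_eq h, rep_base]

/-- The chosen points and the other ones. -/
noncomputable def pointEquiv : {p : P // p ∉ Set.range W.base} ⊕ (X ⊕ W.Circle) ≃ P :=
  Equiv.ofBijective (Sum.elim Subtype.val W.base) <| by
    refine ⟨Subtype.val_injective.sumElim W.base_injective fun p j h => p.2 ⟨j, h.symm⟩,
      fun p => ?_⟩
    by_cases hp : p ∈ Set.range W.base
    · obtain ⟨j, hj⟩ := hp
      exact ⟨Sum.inr j, hj⟩
    · exact ⟨Sum.inl ⟨p, hp⟩, rfl⟩

variable {L : Type} [Field L]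

open Classical in
/-- Addition of the coefficients which belong to the same component. -/
noncomputable def collapse [Fintype P] (v : P → L) (a : A) : L :=
  ∑ p, if W.arc p = a then v p else 0

open Classical in
-- One step of `next` lowers the height by `1`, so the matrix is triangular with respect to the
-- height, with identity matrices as diagonal blocks.
theorem det_plumbing [Fintype P] :
    Matrix.det (Matrix.of fun p q : {p : P // p ∉ Set.range W.base} =>
      ((if p = q then 1 else 0) - if W.next p = q.1 then 1 else 0 : L)) = 1 := by
  set M := Matrix.of fun p q : {p : P // p ∉ Set.range W.base} =>
      ((if p = q then 1 else 0) - if W.next p = q.1 then 1 else 0 : L) with hM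
  have ht : M.BlockTriangular fun p => OrderDual.toDual (W.height p.1) := by
    intro p q h
    have h : W.height p.1 < W.height q.1 := h
    have h1 : p ≠ q := by rintro rfl; exact lt_irrefl _ h
    have h2 : W.next p ≠ q.1 := by
      intro e
      have := W.height_next p.2
      rw [e] at this
      omega
    simp [hM, h1, h2]
  rw [ht.det]
  refine Finset.prod_eq_one fun k _ => ?_
  have : M.toSquareBlock (fun p => OrderDual.toDual (W.height p.1)) k = 1 := by
    ext p q
    have h2 : W.next p.1 ≠ q.1.1 := by
      intro e
      have := W.height_next p.1.2
      rw [e] at this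
      have h := OrderDual.toDual.injective (p.2.trans q.2.symm)
      omega
    simp [hM, Matrix.toSquareBlock_def, h2, Matrix.one_apply, Subtype.ext_iff]
  rw [this, Matrix.det_one]

open Classical in
/-- Elimination of all unknowns but one on each component. -/
theorem det_eq_det_collapse [Fintype P] [Fintype X] [Fintype W.Circle] {M : P → P → L}
    (hM : ∀ p ∉ Set.range W.base, M p = Pi.single p 1 - Pi.single (W.next p) 1) :
    Matrix.det (Matrix.of M) =
      Matrix.det (Matrix.of fun i j => W.collapse (M (W.base i)) (W.arcEquiv j)) := by
  -- Multiplication by the unitriangular matrix `V` adds to the column of each chosen point the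
  -- columns of all points that it represents. This kills the rows of the other points, since `p`
  -- and `next p` have the same representative.
  let K (p : P) (j : X ⊕ W.Circle) : L := if W.rep p = W.base j then 1 else 0
  let V := Matrix.fromBlocks (1 : Matrix {p : P // p ∉ Set.range W.base} {p : P // p ∉ Set.range W.base} L)
    (Matrix.of fun p j => K p.1 j) 0
    (1 : Matrix (X ⊕ W.Circle) (X ⊕ W.Circle) L)
  have hV : V.det = 1 := by simp [V]
  have hK : ∀ k j, V k (Sum.inr j) = K (W.pointEquiv k) j := by
    rintro (p | i) j
    · rfl
    · change (1 : Matrix _ _ L) i j = if W.rep (W.base i) = W.base j then 1 else 0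
      simp [rep_base, Matrix.one_apply, W.base_injective.eq_iff]
  have hMV : (Matrix.of M).submatrix W.pointEquiv W.pointEquiv * V = Matrix.fromBlocks
      (Matrix.of fun p q : {p : P // p ∉ Set.range W.base} =>
        ((if p = q then 1 else 0) - if W.next p = q.1 then 1 else 0 : L)) 0
      (Matrix.of fun i (q : {p : P // p ∉ Set.range W.base}) => M (W.base i) q.1)
      (Matrix.of fun i j => W.collapse (M (W.base i)) (W.arcEquiv j)) := by
    ext i j
    rcases j with q | j
    · have h : ((Matrix.of M).submatrix W.pointEquiv W.pointEquiv * V) i (Sum.inl q) =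
          M (W.pointEquiv i) q := by
        rw [Matrix.mul_apply, Fintype.sum_sum_type]
        simp [V, Matrix.one_apply]
        rfl
      rw [h]
      rcases i with p | i
      · change M p.1 q.1 = _
        rw [hM p.1 p.2]
        simp [Pi.single_apply, Subtype.ext_iff, eq_comm]
      · rfl
    · have h : ((Matrix.of M).submatrix W.pointEquiv W.pointEquiv * V) i (Sum.inr j) =
          ∑ p, M (W.pointEquiv i) p * K p j := by
        rw [Matrix.mul_apply, ← Equiv.sum_comp W.pointEquiv]
        exact Finset.sum_congr rfl fun k _ => by rw [hK]; rfl
      rw [h]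
      rcases i with p | i
      · change ∑ q, M p.1 q * K q j = 0
        rw [hM p.1 p.2]
        simp only [Pi.sub_apply, sub_mul, Finset.sum_sub_distrib, Pi.single_apply, ite_mul,
          one_mul, zero_mul, Finset.sum_ite_eq', Finset.mem_univ, if_true, K, W.rep_next p.2,
          sub_self]
      · change ∑ q, M (W.base i) q * K q j = W.collapse (M (W.base i)) (W.arcEquiv j)
        refine Finset.sum_congr rfl fun q _ => ?_
        simp [K, rep_eq_base_iff]
  have h := congrArg Matrix.det hMV
  rw [Matrix.det_mul, hV, mul_one, Matrix.det_submatrix_equiv_self, Matrix.det_fromBlocks_zero₁₂] at h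
  refine h.trans ((congrArg (· * _) ?_).trans (one_mul _))
  convert W.det_plumbing (L := L)

end Wiring

/-! ### Directed strands and gluings of a tangle -/

namespace Tangle

theorem finite_crossing : ∀ S : Tangle, Finite S.Crossing
  | zero | infty => inferInstanceAs (Finite Empty)
  | one | negOne => inferInstanceAs (Finite Unit)
  | vert a b | horiz a b =>
    have := finite_crossing a
    have := finite_crossing b
    inferInstanceAs (Finite (a.Crossing ⊕ b.Crossing))

instance (S : Tangle) : Finite S.Crossing := finite_crossing S

theorem finite_plumb : ∀ S : Tangle, Finite S.Plumb
  | zero | infty => inferInstanceAs (Finite (Fin 2))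
  | one | negOne => inferInstanceAs (Finite Unit)
  | vert a b | horiz a b =>
    have := finite_plumb a
    have := finite_plumb b
    inferInstanceAs (Finite ((a.Plumb ⊕ b.Plumb) ⊕ Fin 2))

instance (S : Tangle) : Finite S.Plumb := finite_plumb S

theorem nonempty_pt : ∀ S : Tangle, Nonempty S.Pt
  | zero | infty | one | negOne => ⟨Corner.nw⟩
  | vert a _ | horiz a _ => (nonempty_pt a).map Sum.inl

theorem ends_injective : ∀ S : Tangle, Function.Injective S.ends
  | zero | infty | one | negOne => fun _ _ h => h
  | vert a b => by
    have ha := ends_injective a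
    have hb := ends_injective b
    rintro (_ | _ | _ | _) (_ | _ | _ | _) h <;> first | rfl | cases h | skip
    all_goals first
      | exact absurd (ha (Sum.inl_injective h)) (by decide)
      | exact absurd (hb (Sum.inr_injective h)) (by decide)
  | horiz a b => by
    have ha := ends_injective a
    have hb := ends_injective b
    rintro (_ | _ | _ | _) (_ | _ | _ | _) h <;> first | rfl | cases h | skip
    all_goals first
      | exact absurd (ha (Sum.inl_injective h)) (by decide)
      | exact absurd (hb (Sum.inr_injective h)) (by decide)

theorem mate_crossingPt : ∀ (S : Tangle) (c : S.Crossing) (d : Corner),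
    S.mate (S.crossingPt c d) = S.crossingPt c d.opposite
  | zero, c, _ | infty, c, _ => c.elim
  | one, _, _ | negOne, _, _ => rfl
  | vert a b, c, d | horiz a b, c, d => by
    rcases c with c | c
    · exact congrArg Sum.inl (mate_crossingPt a c d)
    · exact congrArg Sum.inr (mate_crossingPt b c d)

/-- Whether an element of `Plumb` is a pair of glued ends, and not a strand of a piece. -/
def isGlue : (S : Tangle) → S.Plumb → Bool
  | zero, _ => false
  | infty, _ => false
  | one, _ => false
  | negOne, _ => false
  | vert a _, Sum.inl (Sum.inl y) => a.isGlue y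
  | vert _ b, Sum.inl (Sum.inr y) => b.isGlue y
  | vert _ _, Sum.inr _ => true
  | horiz a _, Sum.inl (Sum.inl y) => a.isGlue y
  | horiz _ b, Sum.inl (Sum.inr y) => b.isGlue y
  | horiz _ _, Sum.inr _ => true

theorem plumb_spec : ∀ (S : Tangle) (y : S.Plumb),
    (S.isGlue y = false ∧ S.plumbSnd y = S.mate (S.plumbFst y) ∧ ¬ S.IsUnder (S.plumbFst y) ∧
      ¬ S.IsUnder (S.plumbSnd y)) ∨
    (S.isGlue y = true ∧ S.Glued (S.plumbSnd y) (S.plumbFst y))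
  | zero, y => by
    refine Or.inl ⟨rfl, ?_, id, id⟩
    change Fin 2 at y
    fin_cases y <;> rfl
  | infty, y => by
    refine Or.inl ⟨rfl, ?_, id, id⟩
    change Fin 2 at y
    fin_cases y <;> rfl
  | one, y => Or.inl ⟨rfl, rfl, (by decide : ¬ (Corner.nw = Corner.ne ∨ Corner.nw = Corner.sw)),
      (by decide : ¬ (Corner.se = Corner.ne ∨ Corner.se = Corner.sw))⟩
  | negOne, y => Or.inl ⟨rfl, rfl, (by decide : ¬ (Corner.ne = Corner.nw ∨ Corner.ne = Corner.se)),
      (by decide : ¬ (Corner.sw = Corner.nw ∨ Corner.sw = Corner.se))⟩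
  | vert a b, y => by
    rcases y with (y | y) | i
    · exact (plumb_spec a y).imp_left fun h => ⟨h.1, congrArg Sum.inl h.2.1, h.2.2⟩
    · exact (plumb_spec b y).imp_left fun h => ⟨h.1, congrArg Sum.inr h.2.1, h.2.2⟩
    · refine Or.inr ⟨rfl, ?_⟩
      fin_cases i
      · exact Or.inl ⟨rfl, rfl⟩
      · exact Or.inr ⟨rfl, rfl⟩
  | horiz a b, y => by
    rcases y with (y | y) | i
    · exact (plumb_spec a y).imp_left fun h => ⟨h.1, congrArg Sum.inl h.2.1, h.2.2⟩
    · exact (plumb_spec b y).imp_left fun h => ⟨h.1, congrArg Sum.inr h.2.1, h.2.2⟩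
    · refine Or.inr ⟨rfl, ?_⟩
      fin_cases i
      · exact Or.inl ⟨rfl, rfl⟩
      · exact Or.inr ⟨rfl, rfl⟩

theorem exists_plumb_of_glued : ∀ (S : Tangle) (p q : S.Pt), S.Glued p q →
    ∃ y, S.plumbSnd y = p ∧ S.plumbFst y = q
  | zero, _, _, h | infty, _, _, h | one, _, _, h | negOne, _, _, h => h.elim
  | vert a b, p, q, h | horiz a b, p, q, h => by
    rcases p with p | p <;> rcases q with q | q
    · obtain ⟨y, h1, h2⟩ := exists_plumb_of_glued a p q h
      exact ⟨Sum.inl (Sum.inl y), congrArg Sum.inl h1, congrArg Sum.inl h2⟩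
    · rcases h with ⟨rfl, rfl⟩ | ⟨rfl, rfl⟩
      · exact ⟨Sum.inr 0, rfl, rfl⟩
      · exact ⟨Sum.inr 1, rfl, rfl⟩
    · exact h.elim
    · obtain ⟨y, h1, h2⟩ := exists_plumb_of_glued b p q h
      exact ⟨Sum.inl (Sum.inr y), congrArg Sum.inr h1, congrArg Sum.inr h2⟩

theorem exists_plumb_of_not_isUnder : ∀ (S : Tangle) (p : S.Pt), ¬ S.IsUnder p →
    ∃ y, (S.plumbFst y = p ∧ S.plumbSnd y = S.mate p) ∨
      (S.plumbSnd y = p ∧ S.plumbFst y = S.mate p)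
  | zero, c, _ => by
    cases c
    exacts [⟨(0 : Fin 2), Or.inl ⟨rfl, rfl⟩⟩, ⟨(0 : Fin 2), Or.inr ⟨rfl, rfl⟩⟩,
      ⟨(1 : Fin 2), Or.inr ⟨rfl, rfl⟩⟩, ⟨(1 : Fin 2), Or.inl ⟨rfl, rfl⟩⟩]
  | infty, c, _ => by
    cases c
    exacts [⟨(0 : Fin 2), Or.inl ⟨rfl, rfl⟩⟩, ⟨(1 : Fin 2), Or.inl ⟨rfl, rfl⟩⟩,
      ⟨(0 : Fin 2), Or.inr ⟨rfl, rfl⟩⟩, ⟨(1 : Fin 2), Or.inr ⟨rfl, rfl⟩⟩]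
  | one, c, h => by
    cases c
    exacts [⟨(), Or.inl ⟨rfl, rfl⟩⟩, absurd (Or.inl rfl) h, absurd (Or.inr rfl) h,
      ⟨(), Or.inr ⟨rfl, rfl⟩⟩]
  | negOne, c, h => by
    cases c
    exacts [absurd (Or.inl rfl) h, ⟨(), Or.inl ⟨rfl, rfl⟩⟩, ⟨(), Or.inr ⟨rfl, rfl⟩⟩,
      absurd (Or.inr rfl) h]
  | vert a b, p, h | horiz a b, p, h => by
    rcases p with p | p
    · obtain ⟨y, hy⟩ := exists_plumb_of_not_isUnder a p h
      exact ⟨Sum.inl (Sum.inl y), hy.imp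
        (fun h => ⟨congrArg Sum.inl h.1, congrArg Sum.inl h.2⟩)
        (fun h => ⟨congrArg Sum.inl h.1, congrArg Sum.inl h.2⟩)⟩
    · obtain ⟨y, hy⟩ := exists_plumb_of_not_isUnder b p h
      exact ⟨Sum.inl (Sum.inr y), hy.imp
        (fun h => ⟨congrArg Sum.inr h.1, congrArg Sum.inr h.2⟩)
        (fun h => ⟨congrArg Sum.inr h.1, congrArg Sum.inr h.2⟩)⟩

/-- An orientation of the strands of a tangle: `out p` says that the strand through `p` is directed
out of its piece at `p`. -/
structure IsOriented (S : Tangle) (out : S.Pt → Bool) : Prop where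
  mate : ∀ p, out (S.mate p) = !out p
  glued : ∀ p q, S.Glued p q → out q = !out p

/-- The initial point of the under-strand at a crossing, of another strand of a piece, or of the
connection between two glued ends. -/
def start (S : Tangle) (out : S.Pt → Bool) : S.Crossing ⊕ S.Plumb → S.Pt
  | Sum.inl c => if out (S.underPt c) then S.mate (S.underPt c) else S.underPt c
  | Sum.inr y => if out (S.plumbFst y) = S.isGlue y then S.plumbFst y else S.plumbSnd y

/-- Rearrangement of the rows of a composite tangle. -/
def splitRows (Ca Cb Ya Yb Z : Type) :
    (Ca ⊕ Cb) ⊕ ((Ya ⊕ Yb) ⊕ Z) ≃ ((Ca ⊕ Ya) ⊕ (Cb ⊕ Yb)) ⊕ Z :=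
  (Equiv.sumAssoc _ _ _).symm.trans (Equiv.sumCongr (Equiv.sumSumSumComm _ _ _ _) (Equiv.refl _))

/-- The initial points of the connections in a composite of two tangles. -/
def startGlue {Ja Jb Pa Pb : Type} (sa : Ja → Pa) (sb : Jb → Pb) (ga : Fin 2 → Pa)
    (gb : Fin 2 → Pb) (ob : Pb → Bool) : (Ja ⊕ Jb) ⊕ Fin 2 → Pa ⊕ Pb :=
  Sum.elim (Sum.map sa sb) fun i => if ob (gb i) = true then Sum.inr (gb i) else Sum.inl (ga i)

theorem startGlue_injective {Ja Jb Pa Pb : Type} {sa : Ja → Pa} {sb : Jb → Pb} {ga : Fin 2 → Pa}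
    {gb : Fin 2 → Pb} {oa : Pa → Bool} {ob : Pb → Bool} (ia : Function.Injective sa)
    (ib : Function.Injective sb) (ja : Function.Injective ga) (jb : Function.Injective gb)
    (ha : ∀ j i, sa j = ga i → oa (ga i) = false) (hb : ∀ j i, sb j = gb i → ob (gb i) = false)
    (h : ∀ i, ob (gb i) = !oa (ga i)) : Function.Injective (startGlue sa sb ga gb ob) := by
  refine (ia.sumMap ib).sumElim ?_ ?_
  · intro i j hij
    dsimp only at hij
    split_ifs at hij
    · exact jb (Sum.inr_injective hij)
    · exact ja (Sum.inl_injective hij)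
  · intro j i hij
    split_ifs at hij with ho
    · rcases j with j | j
      · exact Sum.inl_ne_inr hij
      · rw [hb j i (Sum.inr_injective hij)] at ho
        exact Bool.false_ne_true ho
    · rcases j with j | j
      · rw [h, ha j i (Sum.inl_injective hij)] at ho
        exact ho rfl
      · exact Sum.inr_ne_inl hij

theorem start_vert (a b : Tangle) (out : (vert a b).Pt → Bool) :
    (vert a b).start out = fun j => startGlue (a.start fun p => out (Sum.inl p))
      (b.start fun p => out (Sum.inr p)) (fun i => a.ends (![Corner.sw, Corner.se] i))
      (fun i => b.ends (![Corner.nw, Corner.ne] i)) (fun p => out (Sum.inr p))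
      (splitRows _ _ _ _ _ j) := by
  funext j
  rcases j with (c | c) | ((y | y) | i)
  · exact (apply_ite Sum.inl _ _ _).symm
  · exact (apply_ite Sum.inr _ _ _).symm
  · exact (apply_ite Sum.inl _ _ _).symm
  · exact (apply_ite Sum.inr _ _ _).symm
  · rfl

theorem start_horiz (a b : Tangle) (out : (horiz a b).Pt → Bool) :
    (horiz a b).start out = fun j => startGlue (a.start fun p => out (Sum.inl p))
      (b.start fun p => out (Sum.inr p)) (fun i => a.ends (![Corner.ne, Corner.se] i))
      (fun i => b.ends (![Corner.nw, Corner.sw] i)) (fun p => out (Sum.inr p))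
      (splitRows _ _ _ _ _ j) := by
  funext j
  rcases j with (c | c) | ((y | y) | i)
  · exact (apply_ite Sum.inl _ _ _).symm
  · exact (apply_ite Sum.inr _ _ _).symm
  · exact (apply_ite Sum.inl _ _ _).symm
  · exact (apply_ite Sum.inr _ _ _).symm
  · rfl

theorem vec_two_injective {c d : Corner} (h : c ≠ d) : Function.Injective ![c, d] := by
  intro i j hij
  fin_cases i <;> fin_cases j <;> first | rfl | exact absurd hij h | exact absurd hij h.symm

/-- The second clause carries the induction: no edge inside the tangle starts at an end directed
outward, so such an end is still available as the initial point of a new gluing. -/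
theorem start_injective : ∀ {S : Tangle} {out : S.Pt → Bool}, S.IsOriented out →
    Function.Injective (S.start out) ∧ ∀ j c, S.start out j = S.ends c → out (S.ends c) = false
  | zero, out, h => by
    have h1 : out Corner.ne = !out Corner.nw := h.mate Corner.nw
    have h2 : out Corner.sw = !out Corner.se := h.mate Corner.se
    constructor
    · rintro (c | i) (c' | j) <;> try exact Empty.elim (by assumption)
      change Fin 2 at i j
      cases hn : out Corner.nw <;> cases hs : out Corner.se <;> fin_cases i <;> fin_cases j <;>
        simp [start, isGlue, plumbFst, plumbSnd, hn, hs]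
    · rintro (c | i) d
      · exact c.elim
      · change Fin 2 at i
        cases hn : out Corner.nw <;> cases hs : out Corner.se <;> fin_cases i <;> cases d <;>
          simp [start, isGlue, plumbFst, plumbSnd, ends, hn, hs, h1, h2]
  | infty, out, h => by
    have h1 : out Corner.sw = !out Corner.nw := h.mate Corner.nw
    have h2 : out Corner.se = !out Corner.ne := h.mate Corner.ne
    constructor
    · rintro (c | i) (c' | j) <;> try exact Empty.elim (by assumption)
      change Fin 2 at i j
      cases hn : out Corner.nw <;> cases hs : out Corner.ne <;> fin_cases i <;> fin_cases j <;>
        simp [start, isGlue, plumbFst, plumbSnd, hn, hs]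
    · rintro (c | i) d
      · exact c.elim
      · change Fin 2 at i
        cases hn : out Corner.nw <;> cases hs : out Corner.ne <;> fin_cases i <;> cases d <;>
          simp [start, isGlue, plumbFst, plumbSnd, ends, hn, hs, h1, h2]
  | one, out, h => by
    have h1 : out Corner.se = !out Corner.nw := h.mate Corner.nw
    have h2 : out Corner.sw = !out Corner.ne := h.mate Corner.ne
    constructor
    · rintro (⟨⟩ | ⟨⟩) (⟨⟩ | ⟨⟩) <;> cases hn : out Corner.nw <;> cases hs : out Corner.ne <;>
        simp [start, isGlue, plumbFst, plumbSnd, underPt, isOne, crossingPt, mate,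
          Corner.opposite, hn, hs] <;> exact fun _ => Subsingleton.elim (α := Unit) _ _
    · rintro (⟨⟩ | ⟨⟩) d <;> cases hn : out Corner.nw <;> cases hs : out Corner.ne <;> cases d <;>
        simp [start, isGlue, plumbFst, plumbSnd, ends, underPt, isOne, crossingPt, mate,
          Corner.opposite, hn, hs, h1, h2]
  | negOne, out, h => by
    have h1 : out Corner.se = !out Corner.nw := h.mate Corner.nw
    have h2 : out Corner.sw = !out Corner.ne := h.mate Corner.ne
    constructor
    · rintro (⟨⟩ | ⟨⟩) (⟨⟩ | ⟨⟩) <;> cases hn : out Corner.nw <;> cases hs : out Corner.ne <;>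
        simp [start, isGlue, plumbFst, plumbSnd, underPt, isOne, crossingPt, mate,
          Corner.opposite, hn, hs] <;> exact fun _ => Subsingleton.elim (α := Unit) _ _
    · rintro (⟨⟩ | ⟨⟩) d <;> cases hn : out Corner.nw <;> cases hs : out Corner.ne <;> cases d <;>
        simp [start, isGlue, plumbFst, plumbSnd, ends, underPt, isOne, crossingPt, mate,
          Corner.opposite, hn, hs, h1, h2]
  | vert a b, out, h => by
    obtain ⟨ia, ea⟩ := start_injective (S := a) (out := fun p => out (Sum.inl p))
      ⟨fun p => h.mate (Sum.inl p), fun p q hg => h.glued (Sum.inl p) (Sum.inl q) hg⟩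
    obtain ⟨ib, eb⟩ := start_injective (S := b) (out := fun p => out (Sum.inr p))
      ⟨fun p => h.mate (Sum.inr p), fun p q hg => h.glued (Sum.inr p) (Sum.inr q) hg⟩
    rw [start_vert]
    constructor
    · refine (startGlue_injective (oa := fun p => out (Sum.inl p))
        (ob := fun p => out (Sum.inr p)) ia ib
        (a.ends_injective.comp (vec_two_injective (by decide)))
        (b.ends_injective.comp (vec_two_injective (by decide)))
        (fun j i => ea j _) (fun j i => eb j _) fun i => ?_).comp (splitRows _ _ _ _ _).injective
      exact h.glued (Sum.inl _) (Sum.inr _) (by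
        fin_cases i
        exacts [Or.inl ⟨rfl, rfl⟩, Or.inr ⟨rfl, rfl⟩])
    · intro j c
      dsimp only
      generalize splitRows _ _ _ _ _ j = k
      intro hk
      rcases k with (j | j) | i
      · cases c
        exacts [ea j _ (Sum.inl_injective hk), ea j _ (Sum.inl_injective hk),
          absurd hk Sum.inl_ne_inr, absurd hk Sum.inl_ne_inr]
      · cases c
        exacts [absurd hk Sum.inr_ne_inl, absurd hk Sum.inr_ne_inl,
          eb j _ (Sum.inr_injective hk), eb j _ (Sum.inr_injective hk)]
      · exfalso
        change (if out (Sum.inr (b.ends (![Corner.nw, Corner.ne] i))) = true then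
          (Sum.inr (b.ends (![Corner.nw, Corner.ne] i)) : a.Pt ⊕ b.Pt)
          else Sum.inl (a.ends (![Corner.sw, Corner.se] i))) = _ at hk
        split_ifs at hk
        · cases c
          · exact Sum.inr_ne_inl hk
          · exact Sum.inr_ne_inl hk
          · have := b.ends_injective (Sum.inr_injective hk)
            fin_cases i <;> cases this
          · have := b.ends_injective (Sum.inr_injective hk)
            fin_cases i <;> cases this
        · cases c
          · have := a.ends_injective (Sum.inl_injective hk)
            fin_cases i <;> cases this
          · have := a.ends_injective (Sum.inl_injective hk)
            fin_cases i <;> cases this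
          · exact Sum.inl_ne_inr hk
          · exact Sum.inl_ne_inr hk
  | horiz a b, out, h => by
    obtain ⟨ia, ea⟩ := start_injective (S := a) (out := fun p => out (Sum.inl p))
      ⟨fun p => h.mate (Sum.inl p), fun p q hg => h.glued (Sum.inl p) (Sum.inl q) hg⟩
    obtain ⟨ib, eb⟩ := start_injective (S := b) (out := fun p => out (Sum.inr p))
      ⟨fun p => h.mate (Sum.inr p), fun p q hg => h.glued (Sum.inr p) (Sum.inr q) hg⟩
    rw [start_horiz]
    constructor
    · refine (startGlue_injective (oa := fun p => out (Sum.inl p))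
        (ob := fun p => out (Sum.inr p)) ia ib
        (a.ends_injective.comp (vec_two_injective (by decide)))
        (b.ends_injective.comp (vec_two_injective (by decide)))
        (fun j i => ea j _) (fun j i => eb j _) fun i => ?_).comp (splitRows _ _ _ _ _).injective
      exact h.glued (Sum.inl _) (Sum.inr _) (by
        fin_cases i
        exacts [Or.inl ⟨rfl, rfl⟩, Or.inr ⟨rfl, rfl⟩])
    · intro j c
      dsimp only
      generalize splitRows _ _ _ _ _ j = k
      intro hk
      rcases k with (j | j) | i
      · cases c
        exacts [ea j _ (Sum.inl_injective hk), absurd hk Sum.inl_ne_inr,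
          ea j _ (Sum.inl_injective hk), absurd hk Sum.inl_ne_inr]
      · cases c
        exacts [absurd hk Sum.inr_ne_inl, eb j _ (Sum.inr_injective hk),
          absurd hk Sum.inr_ne_inl, eb j _ (Sum.inr_injective hk)]
      · exfalso
        change (if out (Sum.inr (b.ends (![Corner.nw, Corner.sw] i))) = true then
          (Sum.inr (b.ends (![Corner.nw, Corner.sw] i)) : a.Pt ⊕ b.Pt)
          else Sum.inl (a.ends (![Corner.ne, Corner.se] i))) = _ at hk
        split_ifs at hk
        · cases c
          · exact Sum.inr_ne_inl hk
          · have := b.ends_injective (Sum.inr_injective hk)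
            fin_cases i <;> cases this
          · exact Sum.inr_ne_inl hk
          · have := b.ends_injective (Sum.inr_injective hk)
            fin_cases i <;> cases this
        · cases c
          · have := a.ends_injective (Sum.inl_injective hk)
            fin_cases i <;> cases this
          · exact Sum.inl_ne_inr hk
          · have := a.ends_injective (Sum.inl_injective hk)
            fin_cases i <;> cases this
          · exact Sum.inl_ne_inr hk

end Tangle

/-! ### The denominator as a wiring, and the number of its arcs -/

namespace Tangle

theorem card_pt : ∀ S : Tangle, Nat.card S.Pt = Nat.card S.Crossing + Nat.card S.Plumb + 2
  | zero | infty => by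
    change Nat.card Corner = Nat.card Empty + Nat.card (Fin 2) + 2
    simp only [Nat.card_eq_fintype_card]
    rfl
  | one | negOne => by
    change Nat.card Corner = Nat.card Unit + Nat.card Unit + 2
    simp only [Nat.card_eq_fintype_card]
    rfl
  | vert a b | horiz a b => by
    change Nat.card (a.Pt ⊕ b.Pt) =
      Nat.card (a.Crossing ⊕ b.Crossing) + Nat.card ((a.Plumb ⊕ b.Plumb) ⊕ Fin 2) + 2
    simp only [Nat.card_sum, card_pt a, card_pt b, Nat.card_fin]
    omega

variable (T : Tangle)

/-- Connections of the denominator: those of the tangle and the two closing ones. -/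
abbrev ClosedPlumb : Type := T.Plumb ⊕ Fin 2

/-- The first point of a connection of the denominator. -/
def closedFst : T.ClosedPlumb → T.Pt :=
  Sum.elim T.plumbFst fun i => T.ends (![Corner.nw, Corner.ne] i)

/-- The second point of a connection of the denominator. -/
def closedSnd : T.ClosedPlumb → T.Pt :=
  Sum.elim T.plumbSnd fun i => T.ends (![Corner.sw, Corner.se] i)

/-- Whether a connection of the denominator is a pair of glued ends. -/
def closedIsGlue : T.ClosedPlumb → Bool := Sum.elim T.isGlue fun _ => true

/-- The initial points of under-strands and connections of the denominator. -/
def closedStart (out : T.Pt → Bool) : T.Crossing ⊕ T.ClosedPlumb → T.Pt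
  | Sum.inl c => if out (T.underPt c) then T.mate (T.underPt c) else T.underPt c
  | Sum.inr y => if out (T.closedFst y) = T.closedIsGlue y then T.closedFst y else T.closedSnd y

/-- The final points of under-strands and connections of the denominator. -/
def closedNext (out : T.Pt → Bool) : T.Crossing ⊕ T.ClosedPlumb → T.Pt
  | Sum.inl c => if out (T.underPt c) then T.underPt c else T.mate (T.underPt c)
  | Sum.inr y => if out (T.closedFst y) = T.closedIsGlue y then T.closedSnd y else T.closedFst y

variable {T}

/-- Reversing all directions exchanges initial and final points, so a statement about the former
gives one about the latter. -/
theorem closedNext_eq (out : T.Pt → Bool) :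
    T.closedNext out = T.closedStart fun p => !out p := by
  funext j
  rcases j with c | y
  · cases h : out (T.underPt c) <;> simp [closedNext, closedStart, h]
  · cases h : out (T.closedFst y) <;> cases h' : T.closedIsGlue y <;>
      simp [closedNext, closedStart, h, h']

theorem IsOriented.rev {out : T.Pt → Bool} (h : T.IsOriented out) :
    T.IsOriented fun p => !out p :=
  ⟨fun p => by rw [h.mate], fun p q hg => by rw [h.glued p q hg]⟩

/-- Each closing connection starts at the end that is directed outward, where by `start_injective`
nothing else starts. Surjectivity then follows by counting with `card_pt`: the two closing
connections make up for the missing `2`. -/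
theorem closedStart_bijective {out : T.Pt → Bool} (h : T.IsOriented out)
    (hw : out (T.ends Corner.sw) = !out (T.ends Corner.nw))
    (he : out (T.ends Corner.se) = !out (T.ends Corner.ne)) :
    Function.Bijective (T.closedStart out) := by
  have hinj : Function.Injective (T.closedStart out) := by
    obtain ⟨hi, ho⟩ := start_injective h
    have key : T.closedStart out = Sum.elim (T.start out)
        (fun i => if out (T.ends (![Corner.nw, Corner.ne] i)) = true then
          T.ends (![Corner.nw, Corner.ne] i) else T.ends (![Corner.sw, Corner.se] i)) ∘
        (Equiv.sumAssoc _ _ _).symm := by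
      funext j
      rcases j with c | y | i <;> rfl
    rw [key]
    refine (hi.sumElim ?_ ?_).comp (Equiv.injective _)
    · intro i j hij
      dsimp only at hij
      rw [← apply_ite T.ends, ← apply_ite T.ends] at hij
      have := T.ends_injective hij
      split_ifs at this <;> fin_cases i <;> fin_cases j <;> first | rfl | cases this
    · intro j i hij
      have hc : ∀ c, out (T.ends c) = true → T.start out j ≠ T.ends c := fun c hc hj => by
        rw [ho j c hj] at hc
        exact Bool.false_ne_true hc
      split_ifs at hij with hn
      · exact hc _ hn hij
      · refine hc _ ?_ hij
        fin_cases i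
        · exact hw.trans (by simpa using hn)
        · exact he.trans (by simpa using hn)
  refine hinj.bijective_of_nat_card_le ?_
  rw [card_pt, Nat.card_sum, Nat.card_sum, Nat.card_fin]
  omega

theorem closed_spec (y : T.ClosedPlumb) :
    (T.closedIsGlue y = false ∧ T.closedSnd y = T.mate (T.closedFst y) ∧
      ¬ T.IsUnder (T.closedFst y) ∧ ¬ T.IsUnder (T.closedSnd y)) ∨
    (T.closedIsGlue y = true ∧
      (T.GluedD (T.closedSnd y) (T.closedFst y) ∨ T.GluedD (T.closedFst y) (T.closedSnd y))) := by
  rcases y with y | i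
  · exact (T.plumb_spec y).imp id fun h => ⟨h.1, Or.inl (Or.inl h.2)⟩
  · refine Or.inr ⟨rfl, Or.inr (Or.inr ?_)⟩
    fin_cases i
    exacts [Or.inl ⟨rfl, rfl⟩, Or.inr ⟨rfl, rfl⟩]

theorem arcOf_sound {p q : T.Pt} (h : T.GluedD p q ∨ (¬ T.IsUnder p ∧ q = T.mate p)) :
    T.arcOf p = T.arcOf q := Quot.sound h

theorem arcOf_closedSnd (y : T.ClosedPlumb) :
    T.arcOf (T.closedSnd y) = T.arcOf (T.closedFst y) := by
  rcases closed_spec y with ⟨-, h, hu, -⟩ | ⟨-, h | h⟩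
  · exact (arcOf_sound (Or.inr ⟨hu, h⟩)).symm
  · exact arcOf_sound (Or.inl h)
  · exact (arcOf_sound (Or.inl h)).symm

theorem eq_of_arcOf_eq {Z : Type} (f : T.Pt → Z)
    (hf : ∀ y, f (T.closedSnd y) = f (T.closedFst y)) {p q : T.Pt}
    (h : T.arcOf p = T.arcOf q) : f p = f q := by
  have hr : ∀ p q : T.Pt, T.GluedD p q ∨ (¬ T.IsUnder p ∧ q = T.mate p) → f p = f q := by
    rintro p q ((h | h | h) | ⟨h, rfl⟩)
    · obtain ⟨y, rfl, rfl⟩ := exists_plumb_of_glued T p q h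
      exact hf (Sum.inl y)
    · obtain ⟨rfl, rfl⟩ := h
      exact (hf (Sum.inr 0)).symm
    · obtain ⟨rfl, rfl⟩ := h
      exact (hf (Sum.inr 1)).symm
    · obtain ⟨y, ⟨h1, h2⟩ | ⟨h1, h2⟩⟩ := exists_plumb_of_not_isUnder T p h
      · rw [← h1, ← (h2.trans (congrArg _ h1.symm))]
        exact (hf (Sum.inl y)).symm
      · rw [← h2, ← h1]
        exact hf (Sum.inl y)
  exact congrArg (Quot.lift f hr) h

theorem Orientation.isOriented (o : T.Orientation) : T.IsOriented o.out :=
  ⟨o.out_mate, fun p q h => o.out_glued p q (Or.inl h)⟩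

theorem Orientation.out_sw (o : T.Orientation) :
    o.out (T.ends Corner.sw) = !o.out (T.ends Corner.nw) :=
  o.out_glued _ _ (Or.inr (Or.inl ⟨rfl, rfl⟩))

theorem Orientation.out_se (o : T.Orientation) :
    o.out (T.ends Corner.se) = !o.out (T.ends Corner.ne) :=
  o.out_glued _ _ (Or.inr (Or.inr ⟨rfl, rfl⟩))

theorem Orientation.closedNext_bijective (o : T.Orientation) :
    Function.Bijective (T.closedNext o.out) := by
  rw [closedNext_eq]
  exact closedStart_bijective o.isOriented.rev (by rw [o.out_sw]) (by rw [o.out_se])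

/-- The denominator as a wiring of its under-strands and connections. -/
noncomputable def Orientation.wiring (o : T.Orientation) :
    Wiring T.Crossing T.ClosedPlumb T.Pt T.ArcD where
  st := Equiv.ofBijective _ (closedStart_bijective o.isOriented o.out_sw o.out_se)
  nx := Equiv.ofBijective _ o.closedNext_bijective
  arc := T.arcOf
  arc_surjective := Quot.mk_surjective
  arc_nx y := by
    simp only [Equiv.ofBijective_apply, closedNext, closedStart]
    split_ifs
    exacts [arcOf_closedSnd y, (arcOf_closedSnd y).symm]
  lift Z f hf p q h := by
    refine eq_of_arcOf_eq f (fun y => ?_) h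
    have := hf y
    simp only [Equiv.ofBijective_apply, closedNext, closedStart] at this
    split_ifs at this
    exacts [this, this.symm]

/-- There are as many relators as arcs. -/
noncomputable def Orientation.relatorEquiv (o : T.Orientation) :
    (T.denominator o).RelatorIndex ≃ (T.denominator o).Arc :=
  o.wiring.arcEquiv

instance : Finite T.ArcD := Finite.of_surjective T.arcOf Quot.mk_surjective

theorem exists_enumerations (o : T.Orientation) :
    ∃ n : ℕ, Nonempty (Fin (n + 1) ≃ (T.denominator o).Arc) ∧
      Nonempty (Fin (n + 1) ≃ (T.denominator o).RelatorIndex) := by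
  obtain ⟨p⟩ := T.nonempty_pt
  have : Nonempty T.ArcD := ⟨T.arcOf p⟩
  obtain ⟨m, ⟨e⟩⟩ := Finite.exists_equiv_fin T.ArcD
  obtain _ | n := m
  · exact (e (T.arcOf p)).elim0
  · exact ⟨n, ⟨e.symm⟩, ⟨e.symm.trans o.relatorEquiv.symm⟩⟩

end Tangle

/-! ### Minors of a square matrix with given kernel vectors -/

section Minors

variable {L : Type} [Field L] {P J : Type}

/-- Replace row `i` by the form `τ p' e_p - τ p e_p'`. It vanishes on `τ`, as do the other rows, so
the new determinant is zero; expanding it in row `i` gives the claim. -/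
theorem mul_adjugate_of_mulVec_eq_zero [Fintype P] [DecidableEq P] {A : Matrix P P L}
    {τ : P → L} (h0 : τ ≠ 0) (h : A.mulVec τ = 0) (i p p' : P) :
    τ p' * A.adjugate p i = τ p * A.adjugate p' i := by
  have key : (A.updateRow i (τ p' • Pi.single p 1 + (-τ p) • Pi.single p' 1)).det = 0 := by
    refine Matrix.exists_mulVec_eq_zero_iff.1 ⟨τ, h0, ?_⟩
    funext k
    by_cases hk : k = i
    · subst hk
      simp only [Matrix.mulVec, Matrix.updateRow_self, add_dotProduct, smul_dotProduct,
        single_dotProduct, smul_eq_mul, Pi.zero_apply]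
      ring
    · simpa only [Matrix.mulVec, Matrix.updateRow_ne hk] using congrFun h k
  rw [Matrix.det_updateRow_add, Matrix.det_updateRow_smul, Matrix.det_updateRow_smul,
    ← Matrix.adjugate_apply, ← Matrix.adjugate_apply] at key
  linear_combination key

open Classical in
/-- The minor of a system of equations that belongs to a row and a column. -/
noncomputable def rowMinor [Finite P] (e : P ≃ J) (M : J → P → L) (j : J) (p : P) : L :=
  rowDet e (Function.update M j (Pi.single p 1))

theorem rowMinor_eq [Fintype P] [DecidableEq P] (e : P ≃ J) (M : J → P → L) (j : J) (p : P) :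
    rowMinor e M j p = (Matrix.of fun q => M (e q)).adjugate p (e.symm j) := by
  classical
  unfold rowMinor
  rw [rowDet_eq, Matrix.adjugate_apply]
  congr 1
  ext q r
  by_cases hq : e q = j
  · subst hq
    simp only [Matrix.of_apply, Function.update_self, Equiv.symm_apply_apply,
      Matrix.updateRow_self]
    congr!
  · have : q ≠ e.symm j := fun h => hq (e.eq_symm_apply.1 h)
    rw [Matrix.updateRow_ne this, Matrix.of_apply, Matrix.of_apply, Function.update_of_ne hq]

/-- The adjugate is proportional to the product of the right kernel vector `τ` and the left kernel
vector `c`; the preceding lemma is applied to the matrix and to its transpose. -/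
theorem mul_rowMinor [Fintype P] (e : P ≃ J) {M : J → P → L} {c : J → L} {τ : P → L}
    (hc0 : ∀ j, c j ≠ 0) (hτ0 : ∀ p, τ p ≠ 0) (hc : ∀ p, ∑ q, c (e q) * M (e q) p = 0)
    (hτ : ∀ j, ∑ p, M j p * τ p = 0) (j j' : J) (p p' : P) :
    c j' * τ p' * rowMinor e M j p = c j * τ p * rowMinor e M j' p' := by
  classical
  simp only [rowMinor_eq]
  set A := Matrix.of fun q => M (e q) with hA
  have h1 := mul_adjugate_of_mulVec_eq_zero (A := A) (τ := τ)
    (fun h => hτ0 p (congrFun h p)) (funext fun q => hτ (e q)) (e.symm j) p p'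
  have h2 := mul_adjugate_of_mulVec_eq_zero (A := A.transpose) (τ := fun q => c (e q))
    (fun h => hc0 _ (congrFun h p)) (funext fun q => by
      rw [Pi.zero_apply, ← hc q]
      exact Finset.sum_congr rfl fun r _ => mul_comm _ _) p' (e.symm j) (e.symm j')
  simp only [← Matrix.adjugate_transpose, Matrix.transpose_apply, Equiv.apply_symm_apply] at h2
  linear_combination c j' * h1 + τ p * h2

/-- Rescaling of rows and columns. -/
theorem exists_unit_rowMinor {U : Subgroup Lˣ} [Fintype P] (e : P ≃ J) {M N : J → P → L}
    {δ : P → L} {u : J → L} (hδ : ∀ p, UnitOf U (δ p)) (hu : ∀ j, UnitOf U (u j))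
    (h : ∀ j p, M j p * δ p = u j * N j p) (j : J) (p : P) :
    ∃ w, UnitOf U w ∧ rowMinor e M j p = w * rowMinor e N j p := by
  classical
  have hprod : ∀ f : P → L, (∀ p, UnitOf U (f p)) → UnitOf U (∏ p, f p) := fun f hf =>
    Finset.prod_induction f (UnitOf U) (fun _ _ => UnitOf.mul) UnitOf.one fun q _ => hf q
  -- In the minor, row `j` is the basis vector at `p`, on which the rescaling of columns acts by `δ
  -- p`; all other rows are rescaled by `u`.
  let v : P → L := fun q => Function.update u j (δ p) (e q)
  have hv : ∀ q, UnitOf U (v q) := by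
    intro q
    by_cases hq : e q = j
    · simp only [v, hq, Function.update_self, hδ]
    · simp only [v, Function.update_of_ne hq, hu]
  refine ⟨(∏ q, v q) * (∏ q, δ q)⁻¹, (hprod v hv).mul (hprod δ hδ).inv, ?_⟩
  have key : (∏ q, δ q) * rowMinor e M j p = (∏ q, v q) * rowMinor e N j p := by
    unfold rowMinor
    rw [rowDet_eq, rowDet_eq, ← Matrix.det_mul_row, ← Matrix.det_mul_column]
    congr 1
    ext q r
    simp only [Matrix.of_apply, v]
    by_cases hq : e q = j
    · rw [hq, Function.update_self, Function.update_self, Function.update_self, Pi.single_apply]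
      split_ifs with hr
      · rw [hr]
      · simp
    · rw [Function.update_of_ne hq, Function.update_of_ne hq, Function.update_of_ne hq, mul_comm, h]
  have hne := (hprod δ hδ).ne_zero
  field_simp
  linear_combination key

end Minors

/-- In `exists_relation` the finiteness instances of the index sets are arbitrary; hence this form
and that of the three next lemmas. -/
theorem sum_sum_type' {A B M : Type} [AddCommMonoid M] [Fintype A] [Fintype B]
    [I : Fintype (A ⊕ B)] (f : A ⊕ B → M) :
    ∑ x, f x = ∑ a, f (Sum.inl a) + ∑ b, f (Sum.inr b) := by
  rw [← Fintype.sum_sum_type]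
  congr!

theorem sum_fin_two' {M : Type} [AddCommMonoid M] [I : Fintype (Fin 2)] (f : Fin 2 → M) :
    ∑ x, f x = f 0 + f 1 := by
  rw [← Fin.sum_univ_two]
  congr!

theorem sum_unit' {M : Type} [AddCommMonoid M] [I : Fintype Unit] (f : Unit → M) :
    ∑ x, f x = f () := Fintype.sum_unique f

theorem sum_empty' {M : Type} [AddCommMonoid M] [I : Fintype Empty] (f : Empty → M) :
    ∑ x, f x = 0 := Fintype.sum_empty f

/-! ### The linear relation between the equations of a tangle -/

section Rows

variable {L : Type} [Field L]

/-- The value of the equation of an under-strand. -/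
noncomputable def crossValue (S : Tangle) (φ f : S.Pt → L) (c : S.Crossing) : L :=
  ∑ d, crossCoeff (S.isOne c) (fun d => φ (S.crossingPt c d)) d * f (S.crossingPt c d)

/-- The value of the equation of a plumbing. -/
def plumbValue (S : Tangle) (φ f : S.Pt → L) (y : S.Plumb) : L :=
  f (S.plumbFst y) + φ (S.plumbFst y) * f (S.plumbSnd y)

/-- The relation between the equations of a tangle. -/
theorem exists_relation {U : Subgroup Lˣ} (hU : -1 ∈ U) : ∀ {S : Tangle} {φ : S.Pt → L},
    Compatible U S φ → ∃ (a : S.Crossing → L) (b : S.Plumb → L), (∀ c, UnitOf U (a c)) ∧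
      (∀ y, UnitOf U (b y)) ∧ ∀ [Fintype S.Crossing] [Fintype S.Plumb] (f : S.Pt → L),
      ∑ c, a c * crossValue S φ f c + ∑ y, b y * plumbValue S φ f y =
        f (S.ends .nw) + φ (S.ends .nw) * (f (S.ends .ne) + φ (S.ends .ne) *
          (f (S.ends .se) + φ (S.ends .se) * f (S.ends .sw)))
  -- The right-hand side is the Fox derivative of the word `x_nw x_ne x_se x_sw` of the loop around
  -- the tangle, which is a consequence of the equations inside.
  | .zero, φ, h => by
    refine ⟨Empty.elim, fun _ => 1, fun c => c.elim, fun _ => UnitOf.one, ?_⟩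
    intro I I' f
    have h1 : φ Corner.ne = (φ Corner.nw)⁻¹ := h.mate Corner.nw
    have n1 := h.ne_zero Corner.nw
    refine (congrArg₂ (· + ·) (sum_empty' (I := I) _) (sum_fin_two' (I := I') _)).trans ?_
    simp only [plumbValue, Tangle.plumbFst, Tangle.plumbSnd, Tangle.ends, Matrix.cons_val_zero,
      Matrix.cons_val_one, h1]
    field_simp
    ring
  | .infty, φ, h => by
    refine ⟨Empty.elim, ![1, φ Corner.nw], fun c => c.elim, fun y => ?_, ?_⟩
    · change Fin 2 at y
      fin_cases y
      exacts [UnitOf.one, h.unit _]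
    intro I I' f
    have h1 : φ Corner.se = (φ Corner.ne)⁻¹ := h.mate Corner.ne
    have n1 := h.ne_zero Corner.ne
    refine (congrArg₂ (· + ·) (sum_empty' (I := I) _) (sum_fin_two' (I := I') _)).trans ?_
    simp only [plumbValue, Tangle.plumbFst, Tangle.plumbSnd, Tangle.ends, Matrix.cons_val_zero,
      Matrix.cons_val_one, h1]
    field_simp
    ring
  | .one, φ, h => by
    refine ⟨fun _ => 1, fun _ => φ Corner.ne, fun _ => UnitOf.one, fun _ => h.unit _, ?_⟩
    intro I I' f
    have h1 : φ Corner.se = (φ Corner.nw)⁻¹ := h.mate Corner.nw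
    have n1 := h.ne_zero Corner.nw
    refine (congrArg₂ (· + ·) (sum_unit' (I := I) _) (sum_unit' (I := I') _)).trans ?_
    simp only [crossValue, plumbValue, Corner.sum_univ, crossCoeff, Tangle.crossingPt,
      Tangle.isOne, Tangle.plumbFst, Tangle.plumbSnd, Tangle.ends, h1, if_true]
    field_simp
    ring
  | .negOne, φ, h => by
    refine ⟨fun _ => 1, fun _ => 1, fun _ => UnitOf.one, fun _ => UnitOf.one, ?_⟩
    intro I I' f
    have h1 : φ Corner.se = (φ Corner.nw)⁻¹ := h.mate Corner.nw
    have n1 := h.ne_zero Corner.nw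
    refine (congrArg₂ (· + ·) (sum_unit' (I := I) _) (sum_unit' (I := I') _)).trans ?_
    simp only [crossValue, plumbValue, Corner.sum_univ, crossCoeff, Tangle.crossingPt,
      Tangle.isOne, Tangle.plumbFst, Tangle.plumbSnd, Tangle.ends, h1, Bool.false_eq_true, if_false]
    field_simp
    ring
  | .vert a b, φ, h => by
    obtain ⟨a₁, b₁, ha₁, hb₁, e₁⟩ := exists_relation hU h.vert_left
    obtain ⟨a₂, b₂, ha₂, hb₂, e₂⟩ := exists_relation hU h.vert_right
    -- The word of `a ∗ b` is the word of `a` followed by that of `b`, after cancellation of the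
    -- four letters at the glued ends. The word of `a` has value `1`, so no weight is needed for
    -- `b`.
    refine ⟨Sum.elim a₁ a₂, Sum.elim (Sum.elim b₁ b₂)
      ![-1, -φ (Sum.inr (b.ends .nw))], ?_, ?_, ?_⟩
    · rintro (c | c)
      exacts [ha₁ c, ha₂ c]
    · rintro ((y | y) | i)
      · exact hb₁ y
      · exact hb₂ y
      · fin_cases i
        exacts [UnitOf.one.neg hU, (h.unit _).neg hU]
    intro I I' f
    have := Fintype.ofFinite a.Crossing
    have := Fintype.ofFinite b.Crossing
    have := Fintype.ofFinite a.Plumb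
    have := Fintype.ofFinite b.Plumb
    have k₁ := e₁ fun p => f (Sum.inl p)
    have k₂ := e₂ fun p => f (Sum.inr p)
    have hp := h.vert_left.prod_ends
    have hnw := h.vert_nw
    have hne := h.vert_ne
    have n1 := h.ne_zero (Sum.inl (a.ends .sw))
    have n2 := h.ne_zero (Sum.inl (a.ends .se))
    have n3 : φ (Sum.inr (b.ends .nw)) =
        φ (Sum.inl (a.ends .nw)) * φ (Sum.inl (a.ends .ne)) * φ (Sum.inl (a.ends .se)) := by
      rw [hnw]; field_simp; linear_combination -hp
    have hs := sum_sum_type' (I := I) fun c : a.Crossing ⊕ b.Crossing =>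
      Sum.elim a₁ a₂ c * crossValue (.vert a b) φ f c
    have ht := sum_sum_type' (I := I') fun y : (a.Plumb ⊕ b.Plumb) ⊕ Fin 2 =>
      Sum.elim (Sum.elim b₁ b₂) ![-1, -φ (Sum.inr (b.ends .nw))] y * plumbValue (.vert a b) φ f y
    rw [Fintype.sum_sum_type, Fin.sum_univ_two] at ht
    refine (congrArg₂ (· + ·) hs ht).trans ?_
    change (∑ c, a₁ c * crossValue a (fun p => φ (Sum.inl p)) (fun p => f (Sum.inl p)) c +
        ∑ c, a₂ c * crossValue b (fun p => φ (Sum.inr p)) (fun p => f (Sum.inr p)) c) +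
      ((∑ c, b₁ c * plumbValue a (fun p => φ (Sum.inl p)) (fun p => f (Sum.inl p)) c +
        ∑ c, b₂ c * plumbValue b (fun p => φ (Sum.inr p)) (fun p => f (Sum.inr p)) c) +
        (-1 * (f (Sum.inr (b.ends .nw)) + φ (Sum.inr (b.ends .nw)) * f (Sum.inl (a.ends .sw))) +
        -φ (Sum.inr (b.ends .nw)) * (f (Sum.inr (b.ends .ne)) + φ (Sum.inr (b.ends .ne)) *
          f (Sum.inl (a.ends .se))))) =
      f (Sum.inl (a.ends .nw)) + φ (Sum.inl (a.ends .nw)) * (f (Sum.inl (a.ends .ne)) +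
        φ (Sum.inl (a.ends .ne)) * (f (Sum.inr (b.ends .se)) + φ (Sum.inr (b.ends .se)) *
          f (Sum.inr (b.ends .sw))))
    have n4 : φ (Sum.inr (b.ends .nw)) * φ (Sum.inr (b.ends .ne)) =
        φ (Sum.inl (a.ends .nw)) * φ (Sum.inl (a.ends .ne)) := by
      rw [n3, hne]; field_simp
    linear_combination k₁ + k₂ - f (Sum.inl (a.ends .sw)) * n3 + (f (Sum.inr (b.ends .se)) +
      φ (Sum.inr (b.ends .se)) * f (Sum.inr (b.ends .sw)) - f (Sum.inl (a.ends .se))) * n4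
  | .horiz a b, φ, h => by
    obtain ⟨a₁, b₁, ha₁, hb₁, e₁⟩ := exists_relation hU h.horiz_left
    obtain ⟨a₂, b₂, ha₂, hb₂, e₂⟩ := exists_relation hU h.horiz_right
    -- For `a + b` the word of `b` is inserted into that of `a` behind the letters at NW and NE; `k`
    -- is the value of this prefix.
    obtain ⟨k, hk⟩ : ∃ k, k = φ (Sum.inl (a.ends .nw)) * φ (Sum.inl (a.ends .ne)) := ⟨_, rfl⟩
    have hku : UnitOf U k := hk ▸ (h.unit _).mul (h.unit _)
    refine ⟨Sum.elim a₁ (fun c => k * a₂ c), Sum.elim (Sum.elim b₁ (fun y => k * b₂ y))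
      ![-k, -(k * φ (Sum.inl (a.ends .se)))], ?_, ?_, ?_⟩
    · rintro (c | c)
      exacts [ha₁ c, hku.mul (ha₂ c)]
    · rintro ((y | y) | i)
      · exact hb₁ y
      · exact hku.mul (hb₂ y)
      · fin_cases i
        exacts [hku.neg hU, (hku.mul (h.unit _)).neg hU]
    intro I I' f
    have := Fintype.ofFinite a.Crossing
    have := Fintype.ofFinite b.Crossing
    have := Fintype.ofFinite a.Plumb
    have := Fintype.ofFinite b.Plumb
    have k₁ := e₁ fun p => f (Sum.inl p)
    have k₂ := e₂ fun p => f (Sum.inr p)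
    have hp := h.horiz_left.prod_ends
    have hp' := h.horiz_right.prod_ends
    have hnw := h.horiz_nw
    have hsw := h.horiz_sw
    have n1 := h.ne_zero (Sum.inl (a.ends .ne))
    have n2 := h.ne_zero (Sum.inl (a.ends .se))
    have hs := sum_sum_type' (I := I) fun c : a.Crossing ⊕ b.Crossing =>
      Sum.elim a₁ (fun c => k * a₂ c) c * crossValue (.horiz a b) φ f c
    have ht := sum_sum_type' (I := I') fun y : (a.Plumb ⊕ b.Plumb) ⊕ Fin 2 =>
      Sum.elim (Sum.elim b₁ (fun y => k * b₂ y)) ![-k, -(k * φ (Sum.inl (a.ends .se)))] y *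
        plumbValue (.horiz a b) φ f y
    rw [Fintype.sum_sum_type, Fin.sum_univ_two] at ht
    refine (congrArg₂ (· + ·) hs ht).trans ?_
    change (∑ c, a₁ c * crossValue a (fun p => φ (Sum.inl p)) (fun p => f (Sum.inl p)) c +
        ∑ c, k * a₂ c * crossValue b (fun p => φ (Sum.inr p)) (fun p => f (Sum.inr p)) c) +
      ((∑ c, b₁ c * plumbValue a (fun p => φ (Sum.inl p)) (fun p => f (Sum.inl p)) c +
        ∑ c, k * b₂ c * plumbValue b (fun p => φ (Sum.inr p)) (fun p => f (Sum.inr p)) c) +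
        (-k * (f (Sum.inr (b.ends .nw)) + φ (Sum.inr (b.ends .nw)) * f (Sum.inl (a.ends .ne))) +
        -(k * φ (Sum.inl (a.ends .se))) * (f (Sum.inr (b.ends .sw)) + φ (Sum.inr (b.ends .sw)) *
          f (Sum.inl (a.ends .se))))) =
      f (Sum.inl (a.ends .nw)) + φ (Sum.inl (a.ends .nw)) * (f (Sum.inr (b.ends .ne)) +
        φ (Sum.inr (b.ends .ne)) * (f (Sum.inr (b.ends .se)) + φ (Sum.inr (b.ends .se)) *
          f (Sum.inl (a.ends .sw))))
    simp only [mul_assoc k, ← Finset.mul_sum]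
    have m1 : k * φ (Sum.inr (b.ends .nw)) = φ (Sum.inl (a.ends .nw)) := by
      rw [hk, hnw]; field_simp
    have m2 : φ (Sum.inl (a.ends .se)) * φ (Sum.inr (b.ends .sw)) = 1 := by
      rw [hsw]; field_simp
    have m3 : φ (Sum.inr (b.ends .nw)) * φ (Sum.inr (b.ends .ne)) * φ (Sum.inr (b.ends .se)) =
        φ (Sum.inl (a.ends .se)) := by
      rw [hsw] at hp'
      field_simp at hp'
      linear_combination hp'
    linear_combination k₁ + k * k₂ + (f (Sum.inr (b.ends .ne)) - f (Sum.inl (a.ends .ne)) +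
      φ (Sum.inr (b.ends .ne)) * f (Sum.inr (b.ends .se)) + φ (Sum.inr (b.ends .ne)) *
      φ (Sum.inr (b.ends .se)) * f (Sum.inl (a.ends .sw))) * m1 -
      k * f (Sum.inl (a.ends .se)) * m2 +
      k * (f (Sum.inr (b.ends .sw)) - f (Sum.inl (a.ends .sw))) * m3 -
      (f (Sum.inl (a.ends .se)) + φ (Sum.inl (a.ends .se)) * f (Sum.inl (a.ends .sw))) * hk

end Rows

/-! ### The minors of the equations of the denominator -/

section Rows

variable {L : Type} [Field L]

/-- The fundamental formula of Fox calculus, `∑ (∂w/∂x)(x - 1) = w - 1`, for the word of the loop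
around a crossing, whose value is `1`. -/
theorem Corner.sum_trivialVec (isOne : Bool) {t : Corner → L} (hse : t .se = (t .nw)⁻¹)
    (hsw : t .sw = (t .ne)⁻¹) (hnw : t .nw ≠ 0) (hne : t .ne ≠ 0) :
    ∑ d, crossCoeff isOne t d * (1 - t d) = 0 := by
  cases isOne <;>
    simp only [Corner.sum_univ, crossCoeff, hse, hsw, if_true, if_false, Bool.false_eq_true] <;>
    field_simp <;> ring

/-- The equations of the denominator of a tangle. -/
noncomputable def closedRows (T : Tangle) (φ : T.Pt → L) :
    T.Crossing ⊕ T.ClosedPlumb → T.Pt → L :=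
  Sum.elim
    (fun c => extend (T.crossingPt c) (crossCoeff (T.isOne c) fun d => φ (T.crossingPt c d)))
    (fun y => pairRow (T.closedFst y) (T.closedSnd y) (φ (T.closedFst y)))

theorem sum_pairRow_mul {P : Type} [Fintype P] (p q : P) (t : L) (f : P → L) :
    ∑ x, pairRow p q t x * f x = f p + t * f q := by
  classical
  simp only [pairRow, Pi.add_apply, add_mul, Finset.sum_add_distrib, Pi.single_apply, ite_mul,
    one_mul, zero_mul, Finset.sum_ite_eq', Finset.mem_univ, if_true]

/-- Labels of the ends of pieces of the denominator of a tangle. -/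
structure ClosedCompatible (U : Subgroup Lˣ) (T : Tangle) (φ : T.Pt → L) : Prop
    extends Compatible U T φ where
  sw : φ (T.ends .sw) = (φ (T.ends .nw))⁻¹
  se : φ (T.ends .se) = (φ (T.ends .ne))⁻¹

variable {U : Subgroup Lˣ} {T : Tangle} {φ : T.Pt → L}

theorem ClosedCompatible.closedSnd (h : ClosedCompatible U T φ) (y : T.ClosedPlumb) :
    φ (T.closedSnd y) = (φ (T.closedFst y))⁻¹ := by
  rcases T.closed_spec y with ⟨-, hy, -⟩ | ⟨-, (hy | hy | hy) | (hy | hy | hy)⟩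
  · rw [hy, h.mate]
  · rw [h.glued _ _ hy, inv_inv]
  · rw [hy.1, hy.2, h.sw, inv_inv]
  · rw [hy.1, hy.2, h.se, inv_inv]
  · rw [h.glued _ _ hy]
  · rw [hy.1, hy.2, h.sw]
  · rw [hy.1, hy.2, h.se]

theorem sum_closedRows_mul [Fintype T.Pt] (h : ClosedCompatible U T φ) (j) :
    ∑ p, closedRows T φ j p * (1 - φ p) = 0 := by
  rcases j with c | y
  · refine (sum_extend_mul _ _ fun p => 1 - φ p).trans ?_
    refine Corner.sum_trivialVec (T.isOne c) (t := fun d => φ (T.crossingPt c d)) ?_ ?_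
      (h.ne_zero _) (h.ne_zero _)
    · rw [← h.mate, T.mate_crossingPt]
      rfl
    · rw [← h.mate, T.mate_crossingPt]
      rfl
  · refine (sum_pairRow_mul _ _ _ fun p => 1 - φ p).trans ?_
    have := h.ne_zero (T.closedFst y)
    rw [h.closedSnd]
    field_simp
    ring

/-- The closing gluings turn `x_nw x_ne x_se x_sw` into the trivial word, so subtracting their
equations with the weights `1` and `φ nw` makes the right-hand side of `exists_relation` vanish. -/
theorem exists_closed_relation (hU : -1 ∈ U) (h : ClosedCompatible U T φ) [Fintype T.Pt]
    (e : T.Pt ≃ T.Crossing ⊕ T.ClosedPlumb) :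
    ∃ c : T.Crossing ⊕ T.ClosedPlumb → L, (∀ j, UnitOf U (c j)) ∧
      ∀ p, ∑ q, c (e q) * closedRows T φ (e q) p = 0 := by
  classical
  obtain ⟨a, b, ha, hb, hab⟩ := exists_relation hU h.toCompatible
  have := Fintype.ofFinite T.Crossing
  have := Fintype.ofFinite T.Plumb
  refine ⟨Sum.elim a (Sum.elim b ![-1, -φ (T.ends .nw)]), ?_, fun p => ?_⟩
  · rintro (c | y | i)
    · exact ha c
    · exact hb y
    · fin_cases i
      exacts [UnitOf.one.neg hU, (h.unit _).neg hU]
  · have hval : ∀ v : T.Pt → L, v p = ∑ q, v q * (Pi.single p 1 : T.Pt → L) q := fun v => by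
      simp [Pi.single_apply]
    rw [Equiv.sum_comp e fun j => Sum.elim a (Sum.elim b ![-1, -φ (T.ends .nw)]) j *
      closedRows T φ j p]
    simp only [Fintype.sum_sum_type, Fin.sum_univ_two]
    simp only [hval (closedRows T φ _)]
    simp only [closedRows, Sum.elim_inl, Sum.elim_inr, sum_extend_mul, sum_pairRow_mul]
    have h1 := hab (Pi.single p 1)
    simp only [crossValue, plumbValue] at h1
    simp only [Tangle.closedFst, Tangle.closedSnd, Sum.elim_inl, Sum.elim_inr,
      Matrix.cons_val_zero, Matrix.cons_val_one]
    have n1 := h.ne_zero (T.ends .ne)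
    rw [h.se] at h1
    field_simp at h1
    linear_combination h1

/-- Square roots as in `IsRoot`, for the denominator of a tangle. -/
structure IsClosedRoot (U : Subgroup Lˣ) (T : Tangle) (φ r : T.Pt → L) : Prop
    extends IsRoot U T φ r where
  sw : r (T.ends .sw) = r (T.ends .nw)
  se : r (T.ends .se) = r (T.ends .ne)

theorem extend_single {P C : Type} [Fintype C] [DecidableEq C] [DecidableEq P] (en : C → P) (c : C)
    (t : L) : extend en (Pi.single c t) = Pi.single (en c) t := by
  funext p
  simp only [extend_apply, Pi.single_apply]
  rw [Finset.sum_eq_single c]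
  · simp [eq_comm]
  · intro b _ hb
    simp [hb]
  · simp

theorem rowMinor_eq_rowDet {P J : Type} [Finite P] [DecidableEq P] {e : P ≃ J} {M N : J → P → L}
    {j : J} {p : P} (h1 : N j = Pi.single p 1) (h2 : ∀ i, i ≠ j → N i = M i) :
    rowMinor e M j p = rowDet e N := by
  classical
  unfold rowMinor
  congr 1
  funext i
  by_cases hi : i = j
  · subst hi
    rw [Function.update_self, h1]
    congr!
  · rw [Function.update_of_ne hi, h2 i hi]

/-- The two additional equations of `hasForm` are taken to be the gluing of NW with SW and the basis
vector at NE, the latter replacing the gluing of NE with SE. The trivial solution satisfies the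
former and has the value `1 - φ ne` on the latter; the other solution has on the former the value
`z_h / (1 - φ ne)`, up to a unit. -/
theorem exists_main_minor (hU : -1 ∈ U) (h : ClosedCompatible U T φ) {r : T.Pt → L}
    (hr : IsClosedRoot U T φ r) : ∃ (e : T.Pt ≃ T.Crossing ⊕ T.ClosedPlumb) (u : L), UnitOf U u ∧
      rowMinor e (closedRows T φ) (Sum.inr (Sum.inr 1)) (T.ends .ne) = u * (outcome T φ).2 := by
  classical
  obtain ⟨e, u, hu, H⟩ := hasForm hU h.toCompatible hr.toIsRoot
  refine ⟨e.trans (Equiv.sumAssoc _ _ _), u * -φ (T.ends .ne), hu.mul ((h.unit _).neg hU), ?_⟩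
  have key := H ![pairRow .nw .sw (φ (T.ends .nw)), Pi.single .ne 1]
  rw [rootRatio_eq_one h.toCompatible hr.toIsRoot (Or.inl ⟨hr.sw, hr.se⟩), mul_one] at key
  rw [rowMinor_eq_rowDet (N := fun j => Sum.elim (tangleRows T φ) (fun i => extend T.ends
    (![pairRow .nw .sw (φ (T.ends .nw)), Pi.single .ne 1] i)) ((Equiv.sumAssoc _ _ _).symm j)),
    rowDet_comp]
  · refine Eq.trans (congrArg (rowDet e) ?_) (key.trans ?_)
    · funext j
      rw [Equiv.symm_apply_apply]
    · rw [mul_assoc]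
      congr 1
      have n1 := h.ne_zero (T.ends .ne)
      have n2 := h.ne_zero (T.ends .nw)
      have n3 := sub_ne_zero.2 (h.ne_one (T.ends .ne)).symm
      have n4 := sub_ne_zero.2 (h.ne_one (T.ends .nw)).symm
      simp only [Matrix.det_fin_two, Matrix.of_apply, solutions, Matrix.mulVec, dotProduct,
        Corner.sum_univ, Matrix.cons_val_zero, Matrix.cons_val_one, pairRow, Pi.add_apply,
        Pi.single_apply, trivialVec, outcomeVec, h.sw, h.se, reduceCtorEq, if_true, if_false]
      field_simp
      ring
  · exact extend_single T.ends Corner.ne (1 : L)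
  · rintro (c | y | i) hi
    · rfl
    · rfl
    · fin_cases i
      · exact extend_pairRow T.ends _ _ _
      · exact absurd rfl hi

/-- All minors of the equations of the denominator of a tangle. -/
theorem exists_closed_minor (hU : -1 ∈ U) (h : ClosedCompatible U T φ) {r : T.Pt → L}
    (hr : IsClosedRoot U T φ r) (e : T.Pt ≃ T.Crossing ⊕ T.ClosedPlumb) (j) (p : T.Pt) :
    ∃ u, UnitOf U u ∧ (1 - φ (T.ends .ne)) * rowMinor e (closedRows T φ) j p =
      u * ((1 - φ p) * (outcome T φ).2) := by
  have := Fintype.ofFinite T.Pt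
  obtain ⟨e', u, hu, H⟩ := exists_main_minor hU h hr
  obtain ⟨s, hs⟩ := exists_sign_rowDet (L := L) e e'
  obtain ⟨c, hc, hc'⟩ := exists_closed_relation hU h e'
  have key := mul_rowMinor e' (fun j => (hc j).ne_zero)
    (fun p => sub_ne_zero.2 (h.ne_one p).symm) hc' (sum_closedRows_mul h) j (Sum.inr (Sum.inr 1)) p
    (T.ends .ne)
  rw [H] at key
  refine ⟨((s : ℤ) : L) * (c j * (c (Sum.inr (Sum.inr 1)))⁻¹ * u),
    (UnitOf.sign hU s).mul (((hc _).mul (hc _).inv).mul hu), ?_⟩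
  have e1 : rowMinor e (closedRows T φ) j p = ((s : ℤ) : L) * rowMinor e' (closedRows T φ) j p :=
    hs _
  have n := (hc (Sum.inr (Sum.inr 1))).ne_zero
  rw [e1]
  field_simp
  linear_combination ((s : ℤ) : L) * key

end Rows

/-! ### Change of the ground field -/

section Transfer

variable {K L : Type} [Field K] [Field L] (ι : K →+* L)

theorem map_clearedV (e s w v₁ h₁ v₂ h₂ : K) : ι (clearedV e s w v₁ h₁ v₂ h₂) =
    clearedV (ι e) (ι s) (ι w) (ι v₁) (ι h₁) (ι v₂) (ι h₂) := by
  simp only [clearedV, map_add, map_mul, map_sub, map_div₀, map_inv₀, map_one]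

theorem map_clearedH (e s w v₁ h₁ v₂ h₂ : K) : ι (clearedH e s w v₁ h₁ v₂ h₂) =
    clearedH (ι e) (ι s) (ι w) (ι v₁) (ι h₁) (ι v₂) (ι h₂) := by
  simp only [clearedH, map_add, map_mul, map_sub, map_div₀, map_inv₀, map_one]

theorem map_outcome : ∀ (S : Tangle) (φ : S.Pt → K),
    outcome S (fun p => ι (φ p)) = (ι (outcome S φ).1, ι (outcome S φ).2)
  | .zero, _ => by simp [outcome]
  | .infty, _ => by simp [outcome]
  | .one, _ => by simp [outcome]
  | .negOne, _ => by simp [outcome]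
  | .vert a b, φ => by
    simp only [outcome, map_outcome a fun p => φ (Sum.inl p), map_outcome b fun p => φ (Sum.inr p),
      map_clearedV, map_mul]
  | .horiz a b, φ => by
    simp only [outcome, map_outcome a fun p => φ (Sum.inl p), map_outcome b fun p => φ (Sum.inr p),
      map_clearedH, map_mul]

theorem map_extend {P C : Type} [Fintype C] (en : C → P) (α : C → K) (p : P) :
    ι (extend en α p) = extend en (fun c => ι (α c)) p := by
  classical
  simp only [extend_apply, map_sum, apply_ite ι, map_zero]

theorem map_pairRow {P : Type} (p q : P) (t : K) (x : P) :
    ι (pairRow p q t x) = pairRow p q (ι t) x := by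
  classical
  simp only [pairRow, Pi.add_apply, Pi.single_apply, map_add, apply_ite ι, map_zero, map_one]

theorem map_crossCoeff (isOne : Bool) (t : Corner → K) (d : Corner) :
    ι (crossCoeff isOne t d) = crossCoeff isOne (fun d => ι (t d)) d := by
  cases d <;> simp only [crossCoeff, apply_ite ι, map_sub, map_mul, map_zero, map_one]

theorem map_closedRows (T : Tangle) (φ : T.Pt → K) (j) (p : T.Pt) :
    ι (closedRows T φ j p) = closedRows T (fun p => ι (φ p)) j p := by
  rcases j with c | y
  · refine (map_extend ι _ _ _).trans ?_
    simp only [map_crossCoeff]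
    rfl
  · exact map_pairRow ι _ _ _ _

theorem map_rowDet {P J : Type} [Finite P] (e : P ≃ J) (M : J → P → K) :
    ι (rowDet e M) = rowDet e fun j p => ι (M j p) := by
  classical
  have := Fintype.ofFinite P
  rw [rowDet_eq, rowDet_eq, RingHom.map_det]
  rfl

theorem map_rowMinor {P J : Type} [Finite P] (e : P ≃ J) (M : J → P → K) (j : J) (p : P) :
    ι (rowMinor e M j p) = rowMinor e (fun j p => ι (M j p)) j p := by
  classical
  unfold rowMinor
  rw [map_rowDet]
  congr 1
  funext i q
  by_cases h : i = j
  · subst h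
    simp only [Function.update_self, Pi.single_apply, apply_ite ι, map_zero, map_one]
  · rw [Function.update_of_ne h, Function.update_of_ne h]

theorem unitOf_map {U : Subgroup Kˣ} {a : K} (h : UnitOf U a) :
    UnitOf (U.map (Units.map (ι : K →* L))) (ι a) := by
  obtain ⟨u, hu, rfl⟩ := h
  exact ⟨_, Subgroup.mem_map_of_mem _ hu, rfl⟩

end Transfer

/-! ### Labels given by an orientation, and the removal of the square roots -/

namespace Tangle

variable {T : Tangle} {K : Type} [Field K]

theorem compOf_mate (p : T.Pt) : T.compOf (T.mate p) = T.compOf p :=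
  (Quot.sound (r := fun p q : T.Pt => T.GluedD p q ∨ q = T.mate p) (Or.inr rfl)).symm

theorem compOf_glued {p q : T.Pt} (h : T.GluedD p q) : T.compOf q = T.compOf p :=
  (Quot.sound (r := fun p q : T.Pt => T.GluedD p q ∨ q = T.mate p) (Or.inl h)).symm

/-- The labels of the ends of pieces for given values of the variables. -/
def Orientation.labelOf (o : T.Orientation) (t : T.CompD → K) (p : T.Pt) : K :=
  if o.out p then t (T.compOf p) else (t (T.compOf p))⁻¹

theorem Orientation.labelOf_of_not (o : T.Orientation) (t : T.CompD → K) {p q : T.Pt}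
    (h : o.out q = !o.out p) (hc : T.compOf q = T.compOf p) :
    o.labelOf t q = (o.labelOf t p)⁻¹ := by
  unfold labelOf
  rw [h, hc]
  cases o.out p <;> simp

variable {U : Subgroup Kˣ} {t : T.CompD → K}

theorem Orientation.closedCompatible (o : T.Orientation) (ht : ∀ c, UnitOf U (t c))
    (h1 : ∀ c, t c ≠ 1) : ClosedCompatible U T (o.labelOf t) where
  unit p := by
    unfold labelOf
    split_ifs
    exacts [ht _, (ht _).inv]
  ne_one p := by
    unfold labelOf
    split_ifs
    exacts [h1 _, fun h => h1 _ (inv_eq_one.1 h)]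
  mate p := o.labelOf_of_not t (o.out_mate p) (compOf_mate p)
  glued p q h := o.labelOf_of_not t (o.out_glued p q (Or.inl h)) (compOf_glued (Or.inl h))
  sw := o.labelOf_of_not t o.out_sw (compOf_glued (Or.inr (Or.inl ⟨rfl, rfl⟩)))
  se := o.labelOf_of_not t o.out_se (compOf_glued (Or.inr (Or.inr ⟨rfl, rfl⟩)))

/-- In an algebraic closure every `1 - t_c` has a square root, so `exists_closed_minor` applies
there. The unit that it yields is the image of an element of `U`, and the embedding is injective;
hence the equation already holds in `K`. -/
theorem Orientation.exists_minor (o : T.Orientation) (hU : -1 ∈ U) (ht : ∀ c, UnitOf U (t c))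
    (h1 : ∀ c, t c ≠ 1) (e : T.Pt ≃ T.Crossing ⊕ T.ClosedPlumb) (j) (p : T.Pt) :
    ∃ u, UnitOf U u ∧ (1 - o.labelOf t (T.ends .ne)) * rowMinor e (closedRows T (o.labelOf t)) j p =
      u * ((1 - o.labelOf t p) * (outcome T (o.labelOf t)).2) := by
  let ι : K →+* AlgebraicClosure K := algebraMap K (AlgebraicClosure K)
  have hι : Function.Injective ι := ι.injective
  have hl : (fun p => ι (o.labelOf t p)) = o.labelOf fun c => ι (t c) := by
    funext p
    simp only [labelOf, apply_ite ι, map_inv₀]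
  have ht' : ∀ c, UnitOf (U.map (Units.map (ι : K →* AlgebraicClosure K))) (ι (t c)) :=
    fun c => unitOf_map ι (ht c)
  have h1' : ∀ c, ι (t c) ≠ 1 := fun c h => h1 c (hι (h.trans (map_one ι).symm))
  have hU' : -1 ∈ U.map (Units.map (ι : K →* AlgebraicClosure K)) :=
    ⟨-1, hU, Units.ext (by simp)⟩
  have hsq : ∀ c, ∃ z, z ^ 2 = 1 - ι (t c) := fun c =>
    IsAlgClosed.exists_pow_nat_eq _ two_pos
  choose ρ hρ using hsq
  have hr : IsClosedRoot (U.map (Units.map (ι : K →* AlgebraicClosure K))) T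
      (o.labelOf fun c => ι (t c)) fun p => ρ (T.compOf p) := by
    refine { sq := fun p => ?_, mate := fun p => by rw [compOf_mate],
             glued := fun p q h => by rw [compOf_glued (Or.inl h)], sw := ?_, se := ?_ }
    · rw [hρ]
      unfold labelOf
      split_ifs
      · exact ⟨1, UnitOf.one, (one_mul _).symm⟩
      -- At an inward end the label is `t⁻¹`, and `1 - t = -t (1 - t⁻¹)`.
      · refine ⟨-ι (t (T.compOf p)), (ht' _).neg hU', ?_⟩
        have := (ht' (T.compOf p)).ne_zero
        field_simp
        ring
    · rw [compOf_glued (Or.inr (Or.inl ⟨rfl, rfl⟩))]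
    · rw [compOf_glued (Or.inr (Or.inr ⟨rfl, rfl⟩))]
  obtain ⟨u, ⟨v, ⟨w, hw, rfl⟩, rfl⟩, H⟩ :=
    exists_closed_minor hU' (o.closedCompatible ht' h1') hr e j p
  refine ⟨w, ⟨w, hw, rfl⟩, hι ?_⟩
  have e1 : ι (rowMinor e (closedRows T (o.labelOf t)) j p) =
      rowMinor e (closedRows T (o.labelOf fun c => ι (t c))) j p := by
    rw [map_rowMinor]
    simp only [map_closedRows, hl]
  have e2 := map_outcome ι T (o.labelOf t)
  rw [hl] at e2
  have e3 : ∀ p, ι (o.labelOf t p) = o.labelOf (fun c => ι (t c)) p := fun p => congrFun hl p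
  rw [map_mul, map_mul, map_mul, map_sub, map_sub, map_one, e1, e3, e3, H, e2]
  rfl

end Tangle

/-! ### From outward arcs to the given directions -/

namespace Tangle

variable {T : Tangle} {K : Type} [Field K]

/-- Whether a crossing of the denominator is positive. -/
def Orientation.positive (o : T.Orientation) (c : T.Crossing) : Bool :=
  if T.isOne c then o.out (T.crossingPt c .ne) == o.out (T.crossingPt c .se)
  else o.out (T.crossingPt c .ne) != o.out (T.crossingPt c .se)

open Classical in
/-- The equations of the denominator in terms of the Fox derivatives with respect to the arcs with
their given orientation. -/
noncomputable def Orientation.foxRows (o : T.Orientation) (t : T.CompD → K) :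
    T.Crossing ⊕ T.ClosedPlumb → T.Pt → K
  | Sum.inl c =>
    let j := t (T.compOf (T.overPt c))
    let k := t (T.compOf (T.underPt c))
    if o.positive c then
      Pi.single (T.overPt c) (1 - k) + Pi.single (T.closedStart o.out (Sum.inl c)) j -
        Pi.single (T.closedNext o.out (Sum.inl c)) 1
    else
      Pi.single (T.overPt c) (-(j⁻¹ * (1 - k))) +
        Pi.single (T.closedStart o.out (Sum.inl c)) j⁻¹ -
        Pi.single (T.closedNext o.out (Sum.inl c)) 1
  | Sum.inr y =>
    Pi.single (T.closedStart o.out (Sum.inr y)) 1 - Pi.single (T.closedNext o.out (Sum.inr y)) 1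

/-- The factors between the Fox derivatives with respect to arcs that are directed outward, and those
with respect to the arcs with their given orientation. -/
def Orientation.turn (o : T.Orientation) (t : T.CompD → K) (p : T.Pt) : K :=
  if o.out p then 1 else -(t (T.compOf p))⁻¹

/-- The factors between the equations. -/
def Orientation.rowFactor (o : T.Orientation) (t : T.CompD → K) :
    T.Crossing ⊕ T.ClosedPlumb → K
  | Sum.inl c =>
    if T.isOne c then
      if o.out (T.crossingPt c .ne) then -o.labelOf t (T.crossingPt c .nw)
      else -o.labelOf t (T.crossingPt c .ne)
    else
      if o.out (T.crossingPt c .nw) then -1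
      else -(o.labelOf t (T.crossingPt c .nw) * o.labelOf t (T.crossingPt c .ne))
  | Sum.inr y =>
    if T.closedIsGlue y then
      if o.out (T.closedFst y) then 1 else o.labelOf t (T.closedFst y)
    else
      if o.out (T.closedFst y) then -1 else -o.labelOf t (T.closedFst y)

theorem Orientation.unitOf_labelOf {U : Subgroup Kˣ} {t : T.CompD → K} (o : T.Orientation)
    (ht : ∀ c, UnitOf U (t c)) (p : T.Pt) : UnitOf U (o.labelOf t p) := by
  unfold labelOf
  split_ifs
  exacts [ht _, (ht _).inv]

theorem Orientation.unitOf_rowFactor {U : Subgroup Kˣ} {t : T.CompD → K} (o : T.Orientation)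
    (hU : -1 ∈ U) (ht : ∀ c, UnitOf U (t c)) (j) : UnitOf U (o.rowFactor t j) := by
  have hl := o.unitOf_labelOf ht
  rcases j with c | y <;> simp only [rowFactor] <;> split_ifs
  exacts [(hl _).neg hU, (hl _).neg hU, UnitOf.one.neg hU, ((hl _).mul (hl _)).neg hU, UnitOf.one,
    hl _, UnitOf.one.neg hU, (hl _).neg hU]

theorem Orientation.out_closedSnd (o : T.Orientation) (y : T.ClosedPlumb) :
    o.out (T.closedSnd y) = !o.out (T.closedFst y) := by
  rcases T.closed_spec y with ⟨-, h, -⟩ | ⟨-, h | h⟩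
  · rw [h, o.out_mate]
  · rw [o.out_glued _ _ h, Bool.not_not]
  · rw [o.out_glued _ _ h]

theorem compOf_closedSnd (y : T.ClosedPlumb) :
    T.compOf (T.closedSnd y) = T.compOf (T.closedFst y) := by
  rcases T.closed_spec y with ⟨-, h, -⟩ | ⟨-, h | h⟩
  · rw [h, compOf_mate]
  · rw [compOf_glued h]
  · rw [compOf_glued h]

/-- By the chain rule, replacing a generator by its inverse multiplies its column by `-t⁻¹`. The
word around a crossing agrees with the Wirtinger relator up to inversion and conjugation, which
multiplies its row by a unit. The possible directions at both kinds of crossing are checked one by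
one. -/
theorem Orientation.closedRows_mul_turn (o : T.Orientation) {t : T.CompD → K} (h0 : ∀ c, t c ≠ 0)
    (j) (p : T.Pt) :
    closedRows T (o.labelOf t) j p * o.turn t p = o.rowFactor t j * o.foxRows t j p := by
  classical
  -- The indicator function of `p` is made opaque, so that the claim becomes an identity of linear
  -- forms in its values, valid also if some of the ends coincide with `p`.
  obtain ⟨x, hx⟩ : ∃ x : T.Pt → K, ∀ q, x q = if q = p then 1 else 0 := ⟨_, fun _ => rfl⟩
  have hmul : ∀ (q : T.Pt) (a : K), (if q = p then a else 0) * o.turn t p =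
      a * o.turn t q * x q := by
    intro q a
    rw [hx]
    split_ifs with h
    · rw [h, mul_one]
    · simp
  have hsingle : ∀ (q : T.Pt) (a : K), (Pi.single q a : T.Pt → K) p = a * x q := by
    intro q a
    rw [Pi.single_apply, hx]
    simp [eq_comm]
  rcases j with c | y
  · have c1 : T.compOf (T.crossingPt c .se) = T.compOf (T.crossingPt c .nw) := by
      rw [← compOf_mate, T.mate_crossingPt]; rfl
    have c2 : T.compOf (T.crossingPt c .sw) = T.compOf (T.crossingPt c .ne) := by
      rw [← compOf_mate, T.mate_crossingPt]; rfl
    have o1 : o.out (T.crossingPt c .se) = !o.out (T.crossingPt c .nw) := by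
      rw [← o.out_mate, T.mate_crossingPt]; rfl
    have o2 : o.out (T.crossingPt c .sw) = !o.out (T.crossingPt c .ne) := by
      rw [← o.out_mate, T.mate_crossingPt]; rfl
    have n1 := h0 (T.compOf (T.crossingPt c .nw))
    have n2 := h0 (T.compOf (T.crossingPt c .ne))
    have hl : closedRows T (o.labelOf t) (Sum.inl c) p * o.turn t p =
        ∑ d, crossCoeff (T.isOne c) (fun d => o.labelOf t (T.crossingPt c d)) d *
          o.turn t (T.crossingPt c d) * x (T.crossingPt c d) := by
      simp only [closedRows, Sum.elim_inl, extend_apply, Finset.sum_mul]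
      refine Finset.sum_congr rfl fun d _ => ?_
      rw [← hmul]
    rw [hl, Corner.sum_univ]
    cases h1 : T.isOne c <;> cases h2 : o.out (T.crossingPt c .nw) <;>
      cases h3 : o.out (T.crossingPt c .ne) <;>
      simp [foxRows, hsingle, rowFactor, closedStart, closedNext, turn, labelOf, crossCoeff,
        positive, overPt, underPt, T.mate_crossingPt, Corner.opposite, o1, o2, c1, c2, h1, h2,
        h3] <;> field_simp <;> ring
  · have c1 := compOf_closedSnd (T := T) y
    have o1 := o.out_closedSnd y
    have n1 := h0 (T.compOf (T.closedFst y))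
    have hl : closedRows T (o.labelOf t) (Sum.inr y) p * o.turn t p =
        o.turn t (T.closedFst y) * x (T.closedFst y) +
        o.labelOf t (T.closedFst y) * o.turn t (T.closedSnd y) * x (T.closedSnd y) := by
      simp only [closedRows, Sum.elim_inr, pairRow, Pi.add_apply, add_mul, Pi.single_apply,
        eq_comm (a := p), hmul, one_mul]
    rw [hl]
    cases h1 : o.out (T.closedFst y) <;> cases h2 : T.closedIsGlue y <;>
      simp [foxRows, hsingle, rowFactor, closedStart, closedNext, turn, labelOf, o1, c1, h1, h2] <;>
      field_simp <;> ring

end Tangle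

/-! ### The Wirtinger relators and the rows of the Alexander matrix -/

section FoxRows

theorem fox_inv {α : Type} (a : α) (g : FreeGroup α) :
    fox a g⁻¹ = -(MonoidAlgebra.of ℤ _ g⁻¹ * fox a g) := by
  have h := fox_mul a g⁻¹ g
  rw [inv_mul_cancel, fox_one] at h
  exact eq_neg_of_add_eq_zero_left h.symm

namespace OrientedDiagram

variable (D : OrientedDiagram)

theorem Phi_of (g : FreeGroup D.Arc) : D.Phi (MonoidAlgebra.of ℤ _ g) =
    ((FreeGroup.lift fun a => Units.mk0 (tvar (D.comp a)) (tvar_ne_zero _)) g : RatFun D.Comp) := by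
  simp [Phi]

/-- The Alexander matrix of a diagram. -/
noncomputable def wirtingerRows (r : D.RelatorIndex) (a : D.Arc) : RatFun D.Comp :=
  D.Phi (fox a (D.relator r))

theorem wirtingerRows_inr (x : D.CircleArc) (a : D.Arc) : D.wirtingerRows (Sum.inr x) a = 0 := by
  change D.Phi (fox a 1) = 0
  rw [fox_one, map_zero]

open Classical in
theorem wirtingerRows_inl (c : D.Crossing) (h : D.comp (D.underIn c) = D.comp (D.underOut c))
    (a : D.Arc) : D.wirtingerRows (Sum.inl c) a =
      if D.positive c then
        (if D.overArc c = a then 1 - tvar (D.comp (D.underIn c)) else 0) +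
          (if D.underIn c = a then tvar (D.comp (D.overArc c)) else 0) -
          (if D.underOut c = a then 1 else 0)
      else
        (if D.overArc c = a then
            -((tvar (D.comp (D.overArc c)))⁻¹ * (1 - tvar (D.comp (D.underIn c)))) else 0) +
          (if D.underIn c = a then (tvar (D.comp (D.overArc c)))⁻¹ else 0) -
          (if D.underOut c = a then 1 else 0) := by
  have n1 := tvar_ne_zero (D.comp (D.overArc c))
  have n2 := tvar_ne_zero (D.comp (D.underOut c))
  unfold wirtingerRows relator
  cases hp : D.positive c
  · simp only [hp, Bool.false_eq_true, if_false, fox_mul, fox_inv, fox_of, map_add, map_mul, map_neg, Phi_of,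
      map_inv, FreeGroup.lift_apply_of, Units.val_mk0, Units.val_inv_eq_inv_val,
      h, apply_ite D.Phi, map_one, map_zero]
    split_ifs <;> (try field_simp) <;> ring
  · simp only [hp, if_true, fox_mul, fox_inv, fox_of, map_add, map_mul, map_neg, Phi_of,
      map_inv, FreeGroup.lift_apply_of, Units.val_mk0, Units.val_inv_eq_inv_val,
      h, apply_ite D.Phi, map_one, map_zero]
    split_ifs <;> (try field_simp) <;> ring

end OrientedDiagram

theorem Wiring.collapse_add {X Y P A K : Type} [Field K] [Fintype P] (W : Wiring X Y P A)
    (v w : P → K) (a : A) : W.collapse (v + w) a = W.collapse v a + W.collapse w a := by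
  simp only [collapse, ← Finset.sum_add_distrib]
  refine Finset.sum_congr rfl fun p _ => ?_
  split_ifs <;> simp

theorem Wiring.collapse_sub {X Y P A K : Type} [Field K] [Fintype P] (W : Wiring X Y P A)
    (v w : P → K) (a : A) : W.collapse (v - w) a = W.collapse v a - W.collapse w a := by
  simp only [collapse, ← Finset.sum_sub_distrib]
  refine Finset.sum_congr rfl fun p _ => ?_
  split_ifs <;> simp

open Classical in
theorem Wiring.collapse_single {X Y P A K : Type} [Field K] [Fintype P] (W : Wiring X Y P A)
    (p : P) (t : K) (a : A) : W.collapse (Pi.single p t) a = if W.arc p = a then t else 0 := by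
  unfold collapse
  rw [Finset.sum_eq_single p]
  · simp
  · intro q _ hq
    simp [hq]
  · simp

namespace Tangle

variable {T : Tangle} (o : T.Orientation) [Fintype T.Pt]

/-- All points of an arc stand for the same generator, so adding their coefficients gives the
derivative with respect to the arc. The under-arcs that enter and leave a crossing belong to one
component, which is why a single variable `k` suffices in `foxRows`. -/
theorem Orientation.collapse_foxRows_inl (c : T.Crossing) (a : T.ArcD) :
    o.wiring.collapse (o.foxRows (tvar : T.CompD → RatFun T.CompD) (Sum.inl c)) a =
      (T.denominator o).wirtingerRows (Sum.inl c) a := by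
  classical
  have hin : T.compOf (T.closedStart o.out (Sum.inl c)) = T.compOf (T.underPt c) := by
    simp only [closedStart]
    split_ifs
    exacts [compOf_mate _, rfl]
  have hout : T.compOf (T.closedNext o.out (Sum.inl c)) = T.compOf (T.underPt c) := by
    simp only [closedNext]
    split_ifs
    exacts [rfl, compOf_mate _]
  refine Eq.trans ?_
    ((T.denominator o).wirtingerRows_inl c (hin.trans hout.symm) a).symm
  change _ = if o.positive c = true then
      (if T.arcOf (T.overPt c) = a then
        1 - tvar (T.compOf (T.closedStart o.out (Sum.inl c))) else 0) +
      (if T.arcOf (T.closedStart o.out (Sum.inl c)) = a then tvar (T.compOf (T.overPt c)) else 0) -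
      (if T.arcOf (T.closedNext o.out (Sum.inl c)) = a then 1 else 0)
    else
      (if T.arcOf (T.overPt c) = a then -((tvar (T.compOf (T.overPt c)))⁻¹ *
        (1 - tvar (T.compOf (T.closedStart o.out (Sum.inl c))))) else 0) +
      (if T.arcOf (T.closedStart o.out (Sum.inl c)) = a then
        (tvar (T.compOf (T.overPt c)))⁻¹ else 0) -
      (if T.arcOf (T.closedNext o.out (Sum.inl c)) = a then 1 else 0)
  rw [hin]
  cases hp : o.positive c
  · simp only [foxRows, hp, Bool.false_eq_true, if_false, Wiring.collapse_sub,
      Wiring.collapse_add, Wiring.collapse_single]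
    rfl
  · simp only [foxRows, hp, if_true, Wiring.collapse_sub, Wiring.collapse_add,
      Wiring.collapse_single]
    rfl

end Tangle

end FoxRows

/-! ### The minors of the Alexander matrix -/

section Main

theorem rowMinor_reindex {L P P' J : Type} [Field L] [Finite P] [Finite P'] (g : P ≃ P')
    (e : P ≃ J) (M : J → P' → L) (j : J) (p : P) :
    rowMinor (g.symm.trans e) M j (g p) = rowMinor e (fun j p => M j (g p)) j p := by
  classical
  unfold rowMinor
  rw [rowDet_reindex]
  congr 1
  funext i q
  by_cases h : i = j
  · subst h
    simp [Pi.single_apply]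
  · rw [Function.update_of_ne h, Function.update_of_ne h]

/-- The minors of a wiring are those of the matrix of its components. -/
theorem Wiring.rowMinor_collapse {X Y P A K : Type} [Field K] [Fintype P] [Finite A]
    (W : Wiring X Y P A) {G : X ⊕ Y → P → K} {N : X ⊕ W.Circle → A → K}
    (hG : ∀ y, G (Sum.inr y) =
      open Classical in Pi.single (W.st (Sum.inr y)) 1 - Pi.single (W.nx (Sum.inr y)) 1)
    (hinl : ∀ x a, W.collapse (G (Sum.inl x)) a = N (Sum.inl x) a)
    (hinr : ∀ c a, N (Sum.inr c) a = 0) (i j : X ⊕ W.Circle) :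
    rowMinor W.arcEquiv.symm N i (W.arcEquiv j) =
      rowMinor W.st.symm G (W.st.symm (W.base i)) (W.base j) := by
  classical
  have : Finite (X ⊕ W.Circle) := Finite.of_equiv _ W.arcEquiv.symm
  have : Finite X := Finite.of_injective (Sum.inl : X → X ⊕ W.Circle) Sum.inl_injective
  have : Finite W.Circle := Finite.of_injective (Sum.inr : _ → X ⊕ W.Circle) Sum.inr_injective
  have := Fintype.ofFinite X
  have := Fintype.ofFinite W.Circle
  have hne : ∀ p, p ≠ W.base i → Function.update G (W.st.symm (W.base i))
      (Pi.single (W.base j) 1) (W.st.symm p) = G (W.st.symm p) := fun p hp =>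
    Function.update_of_ne (fun h => hp (W.st.symm.injective h)) _ _
  have hpl : ∀ p y, W.st (Sum.inr y) = p → G (W.st.symm p) =
      Pi.single p 1 - Pi.single (W.next p) 1 := by
    rintro _ y rfl
    rw [Equiv.symm_apply_apply, hG, next_st]
  have h1 : rowMinor W.st.symm G (W.st.symm (W.base i)) (W.base j) =
      Matrix.det (Matrix.of fun p => Function.update G (W.st.symm (W.base i))
        (Pi.single (W.base j) 1) (W.st.symm p)) := by
    unfold rowMinor
    rw [rowDet_eq]
    congr!
  have h2 : rowMinor W.arcEquiv.symm N i (W.arcEquiv j) =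
      Matrix.det (Matrix.of (Function.update (fun i j => N i (W.arcEquiv j)) i (Pi.single j 1))) := by
    refine (rowMinor_reindex W.arcEquiv (Equiv.refl _) N i j).trans ?_
    unfold rowMinor
    rw [rowDet_eq]
    congr!
  rw [h1, h2, W.det_eq_det_collapse]
  · congr 1
    ext k l
    simp only [Matrix.of_apply]
    by_cases hk : k = i
    · subst hk
      rw [Function.update_self, Function.update_self, collapse_single, ← arcEquiv_apply,
        Pi.single_apply]
      simp only [W.arcEquiv.injective.eq_iff, eq_comm]
    · rw [Function.update_of_ne hk, hne _ (W.base_injective.ne hk)]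
      rcases k with x | c
      · rw [← hinl]
        congr 2
        exact (W.st.symm_apply_apply _).symm
      -- The edge that starts at the chosen point of a circle stays on this circle, so its row
      -- collapses to zero, in agreement with the trivial relator.
      · obtain ⟨y, hy⟩ : ∃ y, W.st (Sum.inr y) = W.base (Sum.inr c) := by
          rcases h : W.st.symm (W.base (Sum.inr c)) with x | y
          · have h := W.st.symm_apply_eq.1 h
            refine absurd ?_ (c.2 x).1
            rw [← h, arc_base_inr]
          · exact ⟨y, (W.st.symm_apply_eq.1 h).symm⟩
        rw [hpl _ y hy, hinr, collapse_sub, collapse_single, collapse_single, ← hy, next_st, arc_nx,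
          sub_self]
  · intro p hp
    obtain ⟨y, hy⟩ := W.exists_st_inr hp
    rw [hne p fun h => hp ⟨i, h.symm⟩, hpl p y hy]

theorem det_submatrix_eq_rowMinor {K A R : Type} [Field K] [Finite A] {n : ℕ} (x : Fin (n + 1) ≃ A)
    (r : Fin (n + 1) ≃ R) (N : R → A → K) (i j : Fin (n + 1)) :
    ((Matrix.of fun i j => N (r i) (x j)).submatrix i.succAbove j.succAbove).det =
      (-1) ^ (i + j : ℕ) * rowMinor (x.symm.trans r) N (r i) (x j) := by
  rw [rowMinor_reindex, rowMinor_eq, Equiv.symm_apply_apply,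
    Matrix.adjugate_fin_succ_eq_det_submatrix, ← mul_assoc, ← mul_pow, neg_one_mul, neg_neg,
    one_pow, one_mul]

/-- The units of the ring of Laurent polynomials. -/
def monomialUnits (C : Type) : Subgroup (RatFun C)ˣ where
  carrier := {u | ∃ (s : ℤˣ) (k : C →₀ ℤ),
    (u : RatFun C) = ((s : ℤ) : RatFun C) * k.prod fun c e => tvar c ^ e}
  one_mem' := ⟨1, 0, by simp⟩
  mul_mem' := by
    classical
    rintro _ _ ⟨s, k, h⟩ ⟨s', k', h'⟩
    refine ⟨s * s', k + k', ?_⟩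
    rw [Units.val_mul, h, h', Finsupp.prod_add_index' (fun _ => zpow_zero _)
      fun c _ _ => zpow_add₀ (tvar_ne_zero c) _ _]
    push_cast
    ring
  inv_mem' := by
    rintro _ ⟨s, k, h⟩
    refine ⟨s, -k, ?_⟩
    rw [Units.val_inv_eq_inv_val, h, mul_inv, Finsupp.prod_neg_index fun _ => zpow_zero _]
    congr 1
    · rcases Int.units_eq_one_or s with rfl | rfl <;> norm_num
    · simp only [zpow_neg, Finsupp.prod, Finset.prod_inv_distrib]

theorem dotEq_iff {C : Type} {a b : RatFun C} :
    DotEq a b ↔ ∃ u, UnitOf (monomialUnits C) u ∧ a = u * b := by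
  constructor
  · rintro ⟨s, k, rfl⟩
    have hs : ((s : ℤ) : RatFun C) ≠ 0 := by
      rcases Int.units_eq_one_or s with rfl | rfl <;> norm_num
    have hk : (k.prod fun c e => tvar c ^ e) ≠ 0 :=
      Finset.prod_ne_zero_iff.2 fun c _ => zpow_ne_zero _ (tvar_ne_zero c)
    exact ⟨_, ⟨Units.mk0 _ (mul_ne_zero hs hk), ⟨s, k, rfl⟩, rfl⟩, rfl⟩
  · rintro ⟨_, ⟨u, ⟨s, k, h⟩, rfl⟩, rfl⟩
    exact ⟨s, k, by rw [h]⟩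

theorem neg_one_mem_monomialUnits (C : Type) : -1 ∈ monomialUnits C := ⟨-1, 0, by simp⟩

theorem unitOf_tvar {C : Type} (c : C) : UnitOf (monomialUnits C) (tvar c) :=
  ⟨Units.mk0 _ (tvar_ne_zero c), ⟨1, Finsupp.single c 1, by simp⟩, rfl⟩

theorem tvar_ne_one {C : Type} (c : C) : tvar c ≠ 1 := by
  intro h
  have h1 := IsFractionRing.injective (MvPolynomial C ℤ) (RatFun C)
    (h.trans (map_one _).symm)
  have h2 := congrArg (MvPolynomial.eval fun _ => 0) h1
  simp at h2

end Main

namespace Tangle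

variable {T : Tangle}

theorem Orientation.one_sub_labelOf (o : T.Orientation) (p : T.Pt) :
    ∃ u, UnitOf (monomialUnits T.CompD) u ∧
      1 - o.labelOf tvar p = u * (1 - tvar (T.compOf p)) := by
  unfold labelOf
  split_ifs
  · exact ⟨1, UnitOf.one, (one_mul _).symm⟩
  · refine ⟨-(tvar (T.compOf p))⁻¹, ((unitOf_tvar _).inv).neg (neg_one_mem_monomialUnits _), ?_⟩
    have := tvar_ne_zero (T.compOf p)
    field_simp
    ring

/-- The Alexander matrix of the denominator. -/
noncomputable def Orientation.alexanderRows (o : T.Orientation) :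
    T.Crossing ⊕ o.wiring.Circle → T.ArcD → RatFun T.CompD :=
  (T.denominator o).wirtingerRows

/-- The minors of the Alexander matrix. -/
theorem Orientation.exists_det_submatrix (o : T.Orientation) {zv zh : RatFun T.CompD}
    (hz : Computes T (o.labelOf tvar) zv zh) {n : ℕ} (x : Fin (n + 1) ≃ T.ArcD)
    (r : Fin (n + 1) ≃ T.Crossing ⊕ o.wiring.Circle) (i j : Fin (n + 1)) {c : T.CompD}
    (hc : ∀ p, T.arcOf p = x j → T.compOf p = c) :
    ∃ u : RatFun T.CompD, UnitOf (monomialUnits T.CompD) u ∧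
      (1 - o.labelOf tvar (T.ends .ne)) * ((Matrix.of fun i j =>
        o.alexanderRows (r i) (x j)).submatrix i.succAbove j.succAbove).det =
        u * ((1 - tvar c) * zh) := by
  have := Fintype.ofFinite T.Pt
  have hU := neg_one_mem_monomialUnits T.CompD
  obtain ⟨l, hl⟩ := o.wiring.arcEquiv.surjective (x j)
  obtain ⟨s, hs⟩ := exists_sign_rowDet (L := RatFun T.CompD) (x.symm.trans r)
    o.wiring.arcEquiv.symm
  have h0 : ∀ c : T.CompD, (tvar c : RatFun T.CompD) ≠ 0 := tvar_ne_zero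
  -- The minor is followed through its transformations: signs from the enumerations (`e1`, `e2`),
  -- arcs replaced by points (`e3`), given directions replaced by outward ones (`e4`), and the
  -- evaluation of the minor (`e5`).
  have e1 := det_submatrix_eq_rowMinor x r o.alexanderRows i j
  have e2 : rowMinor (x.symm.trans r) o.alexanderRows (r i) (x j) =
      ((s : ℤ) : RatFun T.CompD) * rowMinor o.wiring.arcEquiv.symm o.alexanderRows (r i) (x j) :=
    hs _
  have e3 : rowMinor o.wiring.arcEquiv.symm o.alexanderRows (r i) (o.wiring.arcEquiv l) =
      rowMinor o.wiring.st.symm (o.foxRows tvar) (o.wiring.st.symm (o.wiring.base (r i)))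
        (o.wiring.base l) :=
    o.wiring.rowMinor_collapse (fun y => rfl) (fun c a => o.collapse_foxRows_inl c a)
      (fun c a => (T.denominator o).wirtingerRows_inr c a) (r i) l
  obtain ⟨w, hw, e4⟩ := exists_unit_rowMinor (U := monomialUnits T.CompD) o.wiring.st.symm
    (δ := o.turn tvar) (u := o.rowFactor tvar) (fun p => by
      unfold turn
      split_ifs
      exacts [UnitOf.one, (unitOf_tvar _).inv.neg hU]) (o.unitOf_rowFactor hU unitOf_tvar)
    (o.closedRows_mul_turn h0) (o.wiring.st.symm (o.wiring.base (r i))) (o.wiring.base l)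
  obtain ⟨u, hu, e5⟩ := o.exists_minor hU unitOf_tvar tvar_ne_one o.wiring.st.symm
    (o.wiring.st.symm (o.wiring.base (r i))) (o.wiring.base l)
  obtain ⟨v, hv, e6⟩ := o.one_sub_labelOf (o.wiring.base l)
  obtain ⟨y, hy, -, e7⟩ :=
    hz.eq_outcome hU (o.closedCompatible unitOf_tvar tvar_ne_one).toCompatible
  have hy' : UnitOf (monomialUnits T.CompD) (y : RatFun T.CompD) := ⟨y, hy, rfl⟩
  rw [hc _ hl] at e6
  rw [hl] at e3
  obtain ⟨g, hg, hg'⟩ : ∃ g, UnitOf (monomialUnits T.CompD) g ∧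
      (-1 : RatFun T.CompD) ^ (i + j : ℕ) * ((s : ℤ) : RatFun T.CompD) = g := by
    refine ⟨_, (?_ : UnitOf _ _).mul (UnitOf.sign hU s), rfl⟩
    rcases neg_one_pow_eq_or (RatFun T.CompD) (i + j : ℕ) with h | h <;> rw [h]
    exacts [UnitOf.one, UnitOf.one.neg hU]
  refine ⟨g * w⁻¹ * u * v * (y : RatFun T.CompD)⁻¹,
    (((hg.mul hw.inv).mul hu).mul hv).mul hy'.inv, ?_⟩
  have hwn := hw.ne_zero
  have hyn := hy'.ne_zero
  rw [e1, e2, e3, ← mul_assoc ((-1) ^ _), hg']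
  rw [e4, e6] at e5
  rw [e7]
  field_simp
  linear_combination g * e5

end Tangle

end Arborescent

open Arborescent in
open Classical in
/-- For the oriented link `L = D(T)`: the arcs and the relators of its diagram are equally many, and,
however they are enumerated and whichever row and column are deleted, the Alexander polynomial is
`z_h(T)` if `L` is a knot and `z_h(T)/(1 - t_ne)` otherwise, up to `≐`, for every outcome
`(z_v(T), z_h(T))` of the recursive computation. -/
theorem theorem2p1 (T : Tangle) (o : T.Orientation) :
    (∃ n : ℕ, Nonempty (Fin (n + 1) ≃ (T.denominator o).Arc) ∧
      Nonempty (Fin (n + 1) ≃ (T.denominator o).RelatorIndex)) ∧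
    ∀ zv zh : RatFun (T.denominator o).Comp, Computes T o.label zv zh →
      ∀ (n : ℕ) (x : Fin (n + 1) ≃ (T.denominator o).Arc)
        (r : Fin (n + 1) ≃ (T.denominator o).RelatorIndex) (i₀ j₀ : Fin (n + 1)),
        DotEq ((T.denominator o).alexander x r i₀ j₀)
          (if (T.denominator o).IsKnot then zh
            else zh / (1 - o.label (T.ends Corner.ne))) := by
  refine ⟨Tangle.exists_enumerations o, fun zv zh hz n x r i₀ j₀ => dotEq_iff.2 ?_⟩
  obtain ⟨u, hu, h⟩ := o.exists_det_submatrix hz x r i₀ j₀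
    (c := (T.denominator o).comp (x j₀)) fun p hp => congrArg (T.denominator o).comp hp
  obtain ⟨v, hv, hv'⟩ := o.one_sub_labelOf (T.ends .ne)
  have n1 : ∀ c : T.CompD, (1 : RatFun T.CompD) - tvar c ≠ 0 := fun c =>
    sub_ne_zero.2 (tvar_ne_one c).symm
  have hvn := hv.ne_zero
  have h1 := n1 ((T.denominator o).comp (x j₀))
  have h2 := n1 (T.compOf (T.ends .ne))
  unfold OrientedDiagram.alexander
  split_ifs with hk
  -- With a single component the factors `1 - t` on the two sides belong to the same variable and
  -- cancel, up to a unit.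
  · obtain ⟨hs, -⟩ := Nat.card_eq_one_iff_unique.1 hk
    have e : (T.denominator o).comp (x j₀) = T.compOf (T.ends .ne) := hs.elim _ _
    refine ⟨v⁻¹ * u, hv.inv.mul hu, ?_⟩
    rw [hv', e] at h
    have key : ∀ {d τ z : RatFun T.CompD}, τ ≠ 0 → v * τ * d = u * (τ * z) →
        d = v⁻¹ * u * z := by
      intro d τ z hτ hd
      refine mul_left_cancel₀ (mul_ne_zero hvn hτ) (hd.trans ?_)
      field_simp
    exact key h2 h
  -- With several components the two factors may involve different variables; each is moved to the
  -- other side as a divisor.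
  · refine ⟨u, hu, ?_⟩
    have h3 : 1 - o.labelOf tvar (T.ends .ne) ≠ 0 := by
      rw [hv']
      exact mul_ne_zero hvn h2
    have key : ∀ {a d τ z : RatFun T.CompD}, a ≠ 0 → τ ≠ 0 → a * d = u * (τ * z) →
        d / τ = u * (z / a) := by
      intro a d τ z ha hτ hd
      field_simp
      linear_combination hd
    exact key h3 h1 h
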